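/- Let $K$ be an algebraically closed field of characteristic $0$, and let $X=\{Q_1=Q_2=0\}\subset\mathbb P^5_K$ be the intersection of two quadrics, $Q_2$ nonsingular, such that the pencil $\lambda Q_1+\mu Q_2$ has Segre symbol $[(1,1),(1,1),(1,1)]$. ($X$ is then a del Pezzo threefold of degree $4$ with terminal Gorenstein singularities and ample $-K_X$.) Let $\operatorname{Aut}(X)$ be the group of biregular automorphisms of $X$ over $K$, let $\operatorname{Aut}^0(X)$ be the kernel of its action on the Weil divisor class group $\operatorname{Cl}(X)$, and put $\widehat{\operatorname{Aut}}(X)=\operatorname{Aut}(X)/\operatorname{Aut}^0(X)$. For a finite subgroup $G\subset\operatorname{Aut}(X)$, the variety $X$ is called $G$-minimal if it is a $G\mathbb Q$-Fano variety, i.e. every $G$-invariant Weil divisor on $X$ is $\mathbb Q$-Cartier and $\operatorname{rk}\operatorname{Pic}(X)^G=1$. Let $G\subset\operatorname{Aut}(X)$ be a finite subgroup such that $X$ is $G$-minimal, and let $G'\subset\widehat{\operatorname{Aut}}(X)$ be its image. Then there are integers $k,l,m\ge 1$ and an exact sequence $$0\to C_k\times C_l\times C_m\to G\to G'\to 0,$$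 where $G\to G'$ is the natural projection, and $G'$ is isomorphic to one of the groups $$C_4,\quad C_2^2,\quad C_4\times C_2,\quad D_8,\quad C_2^3,\quad D_8\times C_2,\quad S_4,\quad C_2^3\rtimes C_3,\quad C_2^3\rtimes S_3,$$ where $C_n$ is the cyclic group of order $n$, $D_8$ is the dihedral group of order $8$, and in the last two groups $S_3$ and $C_3\subset S_3$ permute the three factors of $C_2^3$. Moreover, all nine groups occur. For each group $\Gamma$ of the list other than $D_8$, the images $G'\cong\Gamma$ of finite groups $G$ for which $X$ is $G$-minimal form exactly one conjugacy class of subgroups of $\widehat{\operatorname{Aut}}(X)$; those with $G'\cong D_8$ form exactly three conjugacy classes. -/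

import Mathlib

open Filter

noncomputable section

namespace ProjVar

/-! ### Projective space, Zariski topology, regular functions -/

/-- Projective space of dimension `n` over `K`, with homogeneous coordinates `x₀, …, xₙ`. -/
def ProjSpace (K : Type*) [Field K] (n : ℕ) : Type _ :=
  Projectivization K (Fin (n + 1) → K)

variable {K : Type*} [Field K] {n : ℕ}

/-- The value of a polynomial at a chosen representative of the point `p`. Only the vanishing of
homogeneous polynomials and quotients of homogeneous polynomials of equal degree are used below,
and these do not depend on the representative. -/
def evalAt (p : ProjSpace K n) (F : MvPolynomial (Fin (n + 1)) K) : K :=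
  MvPolynomial.eval (Projectivization.rep p) F

/-- The Zariski topology: the sets `F ≠ 0`, for `F` homogeneous, are a basis. -/
instance : TopologicalSpace (ProjSpace K n) :=
  TopologicalSpace.generateFrom
    {U | ∃ (d : ℕ) (F : MvPolynomial (Fin (n + 1)) K),
      F.IsHomogeneous d ∧ U = {p | evalAt p F ≠ 0}}

variable {X : Set (ProjSpace K n)}

/-- A function on `X` is regular at `p` if near `p` it is a quotient of two homogeneous polynomials
of the same degree whose denominator has no zero there. -/
def IsRegularAt (f : X → K) (p : X) : Prop :=
  ∃ U : Set X, IsOpen U ∧ p ∈ U ∧ ∃ (d : ℕ) (F G : MvPolynomial (Fin (n + 1)) K),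
    F.IsHomogeneous d ∧ G.IsHomogeneous d ∧
      ∀ x ∈ U, evalAt x.1 G ≠ 0 ∧ f x = evalAt x.1 F / evalAt x.1 G

/-- A function on `X` is regular on `U` if it is so at all points of `U`
(its values outside `U` are irrelevant when `U` is open). -/
def IsRegularOn (f : X → K) (U : Set X) : Prop := ∀ p ∈ U, IsRegularAt f p

theorem IsRegularAt.const (c : K) (p : X) : IsRegularAt (fun _ => c) p :=
  ⟨Set.univ, isOpen_univ, trivial, 0, MvPolynomial.C c, 1,
    MvPolynomial.isHomogeneous_C _ _, MvPolynomial.isHomogeneous_one _ _,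
    fun x _ => by simp [evalAt]⟩

theorem IsRegularAt.add {f g : X → K} {p : X} (hf : IsRegularAt f p) (hg : IsRegularAt g p) :
    IsRegularAt (f + g) p := by
  obtain ⟨U, hU, hpU, d, F, G, hF, hG, h⟩ := hf
  obtain ⟨V, hV, hpV, e, F', G', hF', hG', h'⟩ := hg
  refine ⟨U ∩ V, hU.inter hV, ⟨hpU, hpV⟩, d + e, F * G' + G * F', G * G',
    (hF.mul hG').add (hG.mul hF'), hG.mul hG', fun x hx => ?_⟩
  obtain ⟨h1, h2⟩ := h x hx.1
  obtain ⟨h3, h4⟩ := h' x hx.2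
  simp only [evalAt, map_mul, map_add, Pi.add_apply] at *
  exact ⟨mul_ne_zero h1 h3, by rw [h2, h4, div_add_div _ _ h1 h3]⟩

theorem IsRegularAt.mul {f g : X → K} {p : X} (hf : IsRegularAt f p) (hg : IsRegularAt g p) :
    IsRegularAt (f * g) p := by
  obtain ⟨U, hU, hpU, d, F, G, hF, hG, h⟩ := hf
  obtain ⟨V, hV, hpV, e, F', G', hF', hG', h'⟩ := hg
  refine ⟨U ∩ V, hU.inter hV, ⟨hpU, hpV⟩, d + e, F * F', G * G',
    hF.mul hF', hG.mul hG', fun x hx => ?_⟩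
  obtain ⟨h1, h2⟩ := h x hx.1
  obtain ⟨h3, h4⟩ := h' x hx.2
  simp only [evalAt, map_mul, Pi.mul_apply] at *
  exact ⟨mul_ne_zero h1 h3, by rw [h2, h4, div_mul_div_comm]⟩

theorem IsRegularAt.neg {f : X → K} {p : X} (hf : IsRegularAt f p) : IsRegularAt (-f) p := by
  have := (IsRegularAt.const (-1 : K) p).mul hf
  convert this using 1
  ext x
  simp

/-! ### Automorphisms of a variety -/

/-- `Aut(X)`: the homeomorphisms of `X` which, together with their inverses, pull regular functions
back to regular functions, that is, the biregular self-maps of `X`. -/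
def RegAut (X : Set (ProjSpace K n)) : Subgroup (X ≃ₜ X) where
  carrier := {φ | ∀ (f : X → K) (p : X), IsRegularAt (f ∘ φ) p ↔ IsRegularAt f (φ p)}
  one_mem' := fun _ _ => Iff.rfl
  mul_mem' := fun {φ ψ} hφ hψ f p => (hψ (f ∘ φ) p).trans (hφ f (ψ p))
  inv_mem' := fun {φ} hφ f p => by
    have h := hφ (f ∘ φ.symm) (φ.symm p)
    have h1 : (f ∘ φ.symm) ∘ φ = f := by ext x; simp
    rw [h1, φ.apply_symm_apply] at h
    exact h.symm

/-! ### Rational functions, local rings and orders of vanishing -/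

/-- The filter generated by the dense open subsets of `X`. -/
def genericFilter (X : Set (ProjSpace K n)) : Filter X where
  sets := {s | ∃ U ⊆ s, IsOpen U ∧ Dense U}
  univ_sets := ⟨Set.univ, subset_rfl, isOpen_univ, dense_univ⟩
  sets_of_superset := fun ⟨U, h, h'⟩ hst => ⟨U, h.trans hst, h'⟩
  inter_sets := fun ⟨U, h, hU, hU'⟩ ⟨V, k, hV, hV'⟩ =>
    ⟨U ∩ V, Set.inter_subset_inter h k, hU.inter hV, hU'.inter_of_isOpen_left hV' hU⟩

/-- Functions on `X`, two of them being identified if they agree on a dense open subset. -/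
abbrev GenericGerm (X : Set (ProjSpace K n)) : Type _ := Germ (genericFilter X) K

/-- The ring `K(X)` of rational functions (the function field if `X` is irreducible): classes of
functions which are regular on a dense open subset. -/
def functionField (X : Set (ProjSpace K n)) : Subring (GenericGerm X) where
  carrier := {γ | ∃ (f : X → K) (U : Set X), IsOpen U ∧ Dense U ∧ IsRegularOn f U ∧ γ = ↑f}
  one_mem' := ⟨1, Set.univ, isOpen_univ, dense_univ, fun p _ => IsRegularAt.const 1 p, rfl⟩
  zero_mem' := ⟨0, Set.univ, isOpen_univ, dense_univ, fun p _ => IsRegularAt.const 0 p, rfl⟩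
  add_mem' := by
    rintro _ _ ⟨f, U, hU, hU', hf, rfl⟩ ⟨g, V, hV, hV', hg, rfl⟩
    exact ⟨f + g, U ∩ V, hU.inter hV, hU'.inter_of_isOpen_left hV' hU,
      fun p hp => (hf p hp.1).add (hg p hp.2), rfl⟩
  mul_mem' := by
    rintro _ _ ⟨f, U, hU, hU', hf, rfl⟩ ⟨g, V, hV, hV', hg, rfl⟩
    exact ⟨f * g, U ∩ V, hU.inter hV, hU'.inter_of_isOpen_left hV' hU,
      fun p hp => (hf p hp.1).mul (hg p hp.2), rfl⟩
  neg_mem' := by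
    rintro _ ⟨f, U, hU, hU', hf, rfl⟩
    exact ⟨-f, U, hU, hU', fun p hp => (hf p hp).neg, rfl⟩

/-- The local ring `𝒪_{X,Z}` of a (necessarily irreducible) variety `X` along an irreducible closed
subset `Z`: rational functions which are regular on some open set that meets `Z`. -/
def localRing (Z : TopologicalSpace.IrreducibleCloseds X) : Subring (GenericGerm X) where
  carrier := {γ | ∃ (f : X → K) (U : Set X), IsOpen U ∧ ((Z : Set X) ∩ U).Nonempty ∧
    IsRegularOn f U ∧ γ = ↑f}
  one_mem' := ⟨1, Set.univ, isOpen_univ, by simpa using Z.isIrreducible.1,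
    fun p _ => IsRegularAt.const 1 p, rfl⟩
  zero_mem' := ⟨0, Set.univ, isOpen_univ, by simpa using Z.isIrreducible.1,
    fun p _ => IsRegularAt.const 0 p, rfl⟩
  add_mem' := by
    rintro _ _ ⟨f, U, hU, hU', hf, rfl⟩ ⟨g, V, hV, hV', hg, rfl⟩
    exact ⟨f + g, U ∩ V, hU.inter hV, Z.isIrreducible.2 U V hU hV hU' hV',
      fun p hp => (hf p hp.1).add (hg p hp.2), rfl⟩
  mul_mem' := by
    rintro _ _ ⟨f, U, hU, hU', hf, rfl⟩ ⟨g, V, hV, hV', hg, rfl⟩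
    exact ⟨f * g, U ∩ V, hU.inter hV, Z.isIrreducible.2 U V hU hV hU' hV',
      fun p hp => (hf p hp.1).mul (hg p hp.2), rfl⟩
  neg_mem' := by
    rintro _ ⟨f, U, hU, hU', hf, rfl⟩
    exact ⟨-f, U, hU, hU', fun p hp => (hf p hp).neg, rfl⟩

/-- Prime divisors of `X`: irreducible closed subsets of codimension one. -/
def PrimeDivisor (X : Set (ProjSpace K n)) : Type _ :=
  {Z : TopologicalSpace.IrreducibleCloseds X // Order.coheight Z = 1}

/-- `f` has order `m` along the prime divisor `Z`: `f = a / b` with `a, b ∈ 𝒪_{X,Z}` not zero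
divisors, and `m = length (𝒪/a) - length (𝒪/b)`. -/
def HasOrd (Z : PrimeDivisor X) (f : GenericGerm X) (m : ℤ) : Prop :=
  ∃ (a b : localRing Z.1) (k l : ℕ), a ∈ nonZeroDivisors (localRing Z.1) ∧
    b ∈ nonZeroDivisors (localRing Z.1) ∧ f * b = a ∧
    Ring.ord (localRing Z.1) a = k ∧ Ring.ord (localRing Z.1) b = l ∧ m = k - l

theorem HasOrd.one (Z : PrimeDivisor X) : HasOrd Z 1 0 :=
  ⟨1, 1, 0, 0, one_mem _, one_mem _, by simp, by simp, by simp, by simp⟩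

theorem HasOrd.mul {Z : PrimeDivisor X} {f g : GenericGerm X} {m m' : ℤ}
    (hf : HasOrd Z f m) (hg : HasOrd Z g m') : HasOrd Z (f * g) (m + m') := by
  obtain ⟨a, b, k, l, ha, hb, h, hk, hl, rfl⟩ := hf
  obtain ⟨a', b', k', l', ha', hb', h', hk', hl', rfl⟩ := hg
  refine ⟨a * a', b * b', k + k', l + l', mul_mem ha ha', mul_mem hb hb', ?_, ?_, ?_, ?_⟩
  · push_cast
    rw [← h, ← h']
    ring
  · rw [Ring.ord_mul _ ha', hk, hk']; simp
  · rw [Ring.ord_mul _ hb', hl, hl']; simp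
  · push_cast; ring

theorem HasOrd.inv {Z : PrimeDivisor X} {f g : GenericGerm X} {m : ℤ}
    (hf : HasOrd Z f m) (hfg : g * f = 1) : HasOrd Z g (-m) := by
  obtain ⟨a, b, k, l, ha, hb, h, hk, hl, rfl⟩ := hf
  refine ⟨b, a, l, k, hb, ha, ?_, hl, hk, by ring⟩
  rw [← h, ← mul_assoc, hfg, one_mul]

/-! ### Weil divisors, Cartier divisors, class group, Picard group -/

/-- The group of Weil divisors of `X`. -/
abbrev Div (X : Set (ProjSpace K n)) : Type _ := PrimeDivisor X →₀ ℤ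

/-- Principal divisors: the divisors of invertible rational functions. -/
def principal (X : Set (ProjSpace K n)) : AddSubgroup (Div X) where
  carrier := {D | ∃ f : (functionField X)ˣ, ∀ Z, HasOrd Z (f : functionField X).1 (D Z)}
  zero_mem' := ⟨1, fun Z => HasOrd.one Z⟩
  add_mem' := by
    rintro D E ⟨f, hf⟩ ⟨g, hg⟩
    exact ⟨f * g, fun Z => (hf Z).mul (hg Z)⟩
  neg_mem' := by
    rintro D ⟨f, hf⟩
    exact ⟨f⁻¹, fun Z => (hf Z).inv (congrArg Subtype.val f.inv_mul)⟩

/-- Cartier divisors, as Weil divisors: those which are principal near every point. -/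
def cartier (X : Set (ProjSpace K n)) : AddSubgroup (Div X) where
  carrier := {D | ∀ p : X, ∃ U : Set X, IsOpen U ∧ p ∈ U ∧ ∃ f : (functionField X)ˣ,
    ∀ Z : PrimeDivisor X, ((Z.1 : Set X) ∩ U).Nonempty → HasOrd Z (f : functionField X).1 (D Z)}
  zero_mem' := fun _ => ⟨Set.univ, isOpen_univ, trivial, 1, fun Z _ => HasOrd.one Z⟩
  add_mem' := by
    intro D E hD hE p
    obtain ⟨U, hU, hpU, f, hf⟩ := hD p
    obtain ⟨V, hV, hpV, g, hg⟩ := hE p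
    exact ⟨U ∩ V, hU.inter hV, ⟨hpU, hpV⟩, f * g, fun Z ⟨x, hx, hxU, hxV⟩ =>
      (hf Z ⟨x, hx, hxU⟩).mul (hg Z ⟨x, hx, hxV⟩)⟩
  neg_mem' := by
    intro D hD p
    obtain ⟨U, hU, hpU, f, hf⟩ := hD p
    exact ⟨U, hU, hpU, f⁻¹, fun Z hZ => (hf Z hZ).inv (congrArg Subtype.val f.inv_mul)⟩

/-- The Weil divisor class group `Cl(X)`. -/
abbrev Cl (X : Set (ProjSpace K n)) : Type _ := Div X ⧸ principal X

/-- The Picard group (of a normal variety), as the subgroup of `Cl(X)` of classes of Cartier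
divisors. -/
def pic (X : Set (ProjSpace K n)) : AddSubgroup (Cl X) :=
  (cartier X).map (QuotientAddGroup.mk' (principal X))

/-! ### The action of `Aut(X)` on divisors and on `Cl(X)` -/

/-- The image of an irreducible closed set under a homeomorphism, as an order isomorphism. -/
def irredOrderIso (φ : X ≃ₜ X) :
    TopologicalSpace.IrreducibleCloseds X ≃o TopologicalSpace.IrreducibleCloseds X where
  toFun Z := ⟨φ '' Z, Z.isIrreducible.image φ φ.continuous.continuousOn,
    φ.isClosedMap _ Z.isClosed⟩
  invFun Z := ⟨φ.symm '' Z, Z.isIrreducible.image φ.symm φ.symm.continuous.continuousOn,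
    φ.symm.isClosedMap _ Z.isClosed⟩
  left_inv Z := TopologicalSpace.IrreducibleCloseds.ext (by
    change φ.symm '' (φ '' (Z : Set X)) = Z
    simp [Set.image_image])
  right_inv Z := TopologicalSpace.IrreducibleCloseds.ext (by
    change φ '' (φ.symm '' (Z : Set X)) = Z
    simp [Set.image_image])
  map_rel_iff' {Z W} := by
    change φ '' (Z : Set X) ⊆ φ '' (W : Set X) ↔ (Z : Set X) ⊆ W
    exact Set.image_subset_image_iff φ.injective

/-- `Aut(X)` acts on prime divisors by `g • Z = g(Z)`. -/
instance : MulAction (RegAut X) (PrimeDivisor X) where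
  smul g Z := ⟨irredOrderIso g.1 Z.1, (Order.coheight_orderIso _ _).trans Z.2⟩
  one_smul Z := Subtype.ext (TopologicalSpace.IrreducibleCloseds.ext (by
    change (id : X → X) '' (Z.1 : Set X) = Z.1
    simp))
  mul_smul g h Z := Subtype.ext (TopologicalSpace.IrreducibleCloseds.ext (by
    change (g.1 ∘ h.1) '' (Z.1 : Set X) = g.1 '' (h.1 '' (Z.1 : Set X))
    exact Set.image_comp _ _ _))

theorem coe_smul (g : RegAut X) (Z : PrimeDivisor X) :
    ((g • Z).1 : Set X) = g.1 '' (Z.1 : Set X) := rfl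

/-- `Aut(X)` acts on Weil divisors by `g • ∑ n_Z Z = ∑ n_Z g(Z)`. -/
instance : DistribMulAction (RegAut X) (Div X) where
  smul g D := D.mapDomain (g • ·)
  one_smul D := by
    change D.mapDomain _ = D
    simp only [one_smul]
    exact Finsupp.mapDomain_id
  mul_smul g h D := by
    change D.mapDomain _ = (D.mapDomain _).mapDomain _
    rw [← Finsupp.mapDomain_comp]
    congr 1
    ext Z
    simp [mul_smul]
  smul_zero _ := Finsupp.mapDomain_zero
  smul_add _ _ _ := Finsupp.mapDomain_add

theorem smul_div_apply (g : RegAut X) (D : Div X) (Z : PrimeDivisor X) :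
    (g • D) (g • Z) = D Z :=
  Finsupp.mapDomain_apply (MulAction.injective g) D Z

theorem ringOrd_ringEquiv {R S : Type*} [CommRing R] [CommRing S] (e : R ≃+* S) (a : R) :
    Ring.ord S (e a) = Ring.ord R a := by
  let _ : Algebra R S := (e : R →+* S).toAlgebra
  have hs : Function.Surjective (algebraMap R S) := e.surjective
  have hmap : Ideal.span {e a} = (Ideal.span {a}).map (e : R →+* S) := by
    rw [Ideal.map_span, Set.image_singleton]
    rfl
  let q : (R ⧸ Ideal.span {a}) ≃+* (S ⧸ Ideal.span {e a}) := Ideal.quotientEquiv _ _ e hmap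
  let q' : (R ⧸ Ideal.span {a}) ≃ₗ[R] (S ⧸ Ideal.span {e a}) :=
    { q with
      map_smul' := by
        intro r x
        obtain ⟨x, rfl⟩ := Ideal.Quotient.mk_surjective x
        change q (Ideal.Quotient.mk _ (r * x)) = r • Ideal.Quotient.mk _ (e x)
        change Ideal.Quotient.mk _ (e (r * x)) = Ideal.Quotient.mk _ (e r * e x)
        rw [map_mul] }
  rw [Ring.ord, Ring.ord, q'.length_eq, Module.length_eq_of_surjective hs]

theorem tendsto_genericFilter (φ : X ≃ₜ X) : Tendsto φ (genericFilter X) (genericFilter X) := by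
  rintro s ⟨U, hUs, hU, hU'⟩
  exact ⟨φ ⁻¹' U, Set.preimage_mono hUs, hU.preimage φ.continuous,
    hU'.preimage φ.isOpenMap⟩

/-- Transport of functions by a homeomorphism: `f ↦ f ∘ φ⁻¹`. -/
def germMap (φ : X ≃ₜ X) : GenericGerm X →+* GenericGerm X where
  toFun γ := γ.compTendsto φ.symm (tendsto_genericFilter φ.symm)
  map_one' := rfl
  map_zero' := rfl
  map_mul' γ δ := by
    induction γ, δ using Germ.inductionOn₂
    rfl
  map_add' γ δ := by
    induction γ, δ using Germ.inductionOn₂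
    rfl

theorem germMap_coe (φ : X ≃ₜ X) (f : X → K) :
    germMap φ (f : GenericGerm X) = ((f ∘ φ.symm : X → K) : GenericGerm X) := rfl

theorem germMap_germMap (φ ψ : X ≃ₜ X) (γ : GenericGerm X) :
    germMap φ (germMap ψ γ) = germMap (φ * ψ) γ := by
  induction γ using Germ.inductionOn
  rfl

theorem germMap_one (γ : GenericGerm X) : germMap (1 : X ≃ₜ X) γ = γ := by
  induction γ using Germ.inductionOn
  rfl

theorem isRegularOn_comp_symm (g : RegAut X) {f : X → K} {U : Set X} (hf : IsRegularOn f U) :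
    IsRegularOn (f ∘ g.1.symm) (g.1 '' U) := by
  rintro _ ⟨p, hp, rfl⟩
  have h1 : (f ∘ g.1.symm) ∘ g.1 = f := by ext x; simp
  exact (g.2 (f ∘ g.1.symm) p).1 (by rw [h1]; exact hf p hp)

theorem germMap_mem_functionField (g : RegAut X) {γ : GenericGerm X}
    (h : γ ∈ functionField X) : germMap g.1 γ ∈ functionField X := by
  obtain ⟨f, U, hU, hU', hf, rfl⟩ := h
  refine ⟨f ∘ g.1.symm, g.1 '' U, g.1.isOpenMap U hU, ?_, isRegularOn_comp_symm g hf, rfl⟩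
  exact g.1.surjective.denseRange.dense_image g.1.continuous hU'

theorem germMap_mem_localRing (g : RegAut X) (Z : PrimeDivisor X) {γ : GenericGerm X}
    (h : γ ∈ localRing Z.1) : germMap g.1 γ ∈ localRing (g • Z).1 := by
  obtain ⟨f, U, hU, ⟨x, hx, hxU⟩, hf, rfl⟩ := h
  exact ⟨f ∘ g.1.symm, g.1 '' U, g.1.isOpenMap U hU,
    ⟨g.1 x, ⟨x, hx, rfl⟩, ⟨x, hxU, rfl⟩⟩, isRegularOn_comp_symm g hf, rfl⟩

/-- The isomorphism `𝒪_{X,Z} ≃ 𝒪_{X,g(Z)}` induced by an automorphism `g`. -/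
def localRingEquiv (g : RegAut X) (Z : PrimeDivisor X) :
    localRing Z.1 ≃+* localRing (g • Z).1 where
  toFun a := ⟨germMap g.1 a.1, germMap_mem_localRing g Z a.2⟩
  invFun a := ⟨germMap (g⁻¹).1 a.1, by
    have := germMap_mem_localRing g⁻¹ (g • Z) a.2
    rwa [inv_smul_smul] at this⟩
  left_inv a := Subtype.ext (by
    change germMap _ (germMap _ _) = _
    rw [germMap_germMap, ← Subgroup.coe_mul, inv_mul_cancel, Subgroup.coe_one, germMap_one])
  right_inv a := Subtype.ext (by
    change germMap _ (germMap _ _) = _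
    rw [germMap_germMap, ← Subgroup.coe_mul, mul_inv_cancel, Subgroup.coe_one, germMap_one])
  map_mul' a b := Subtype.ext (map_mul (germMap g.1) a.1 b.1)
  map_add' a b := Subtype.ext (map_add (germMap g.1) a.1 b.1)

theorem HasOrd.map (g : RegAut X) {Z : PrimeDivisor X} {f : GenericGerm X} {m : ℤ}
    (h : HasOrd Z f m) : HasOrd (g • Z) (germMap g.1 f) m := by
  obtain ⟨a, b, k, l, ha, hb, h, hk, hl, rfl⟩ := h
  let e := localRingEquiv g Z
  refine ⟨e a, e b, k, l, ?_, ?_, ?_, ?_, ?_, rfl⟩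
  · rw [← MulEquivClass.map_nonZeroDivisors e]
    exact Submonoid.mem_map_of_mem _ ha
  · rw [← MulEquivClass.map_nonZeroDivisors e]
    exact Submonoid.mem_map_of_mem _ hb
  · change germMap g.1 f * germMap g.1 b = germMap g.1 a
    rw [← map_mul, h]
  · rw [ringOrd_ringEquiv, hk]
  · rw [ringOrd_ringEquiv, hl]

theorem smul_mem_principal (g : RegAut X) {D : Div X} (hD : D ∈ principal X) :
    g • D ∈ principal X := by
  obtain ⟨f, hf⟩ := hD
  let F : functionField X →+* functionField X :=
    ((germMap g.1).comp (functionField X).subtype).codRestrict _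
      (fun x => germMap_mem_functionField g x.2)
  refine ⟨Units.map (F : functionField X →* functionField X) f, fun Z => ?_⟩
  have h := (hf (g⁻¹ • Z)).map g
  rw [← smul_div_apply g D (g⁻¹ • Z), smul_inv_smul] at h
  exact h

/-- `Aut(X)` acts on `Cl(X)`: the class of `D` is sent to the class of `g(D)`. -/
instance : DistribMulAction (RegAut X) (Cl X) where
  smul g := QuotientAddGroup.map (principal X) (principal X) (DistribSMul.toAddMonoidHom _ g)
    (fun _ hD => smul_mem_principal g hD)
  one_smul c := by
    induction c using QuotientAddGroup.induction_on with
    | H D => exact congrArg (QuotientAddGroup.mk (s := principal X)) (one_smul (RegAut X) D)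
  mul_smul g h c := by
    induction c using QuotientAddGroup.induction_on with
    | H D => exact congrArg (QuotientAddGroup.mk (s := principal X)) (mul_smul g h D)
  smul_zero g := map_zero (QuotientAddGroup.map (principal X) (principal X)
    (DistribSMul.toAddMonoidHom (Div X) g) (fun _ hD => smul_mem_principal g hD))
  smul_add g := map_add (QuotientAddGroup.map (principal X) (principal X)
    (DistribSMul.toAddMonoidHom (Div X) g) (fun _ hD => smul_mem_principal g hD))

theorem smul_mk (g : RegAut X) (D : Div X) :
    g • (QuotientAddGroup.mk D : Cl X) = QuotientAddGroup.mk (g • D) := rfl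

/-- `Aut⁰(X)`: the kernel of the action of `Aut(X)` on `Cl(X)`. -/
def aut0 (X : Set (ProjSpace K n)) : Subgroup (RegAut X) :=
  (DistribMulAction.toAddMonoidEnd (RegAut X) (Cl X)).ker

instance : (aut0 X).Normal := MonoidHom.normal_ker _

/-- `Âut(X) = Aut(X) / Aut⁰(X)`, the group through which `Aut(X)` acts effectively on `Cl(X)`. -/
abbrev AutHat (X : Set (ProjSpace K n)) : Type _ := RegAut X ⧸ aut0 X

/-- The projection `Aut(X) → Âut(X)`. -/
def toAutHat (X : Set (ProjSpace K n)) : RegAut X →* AutHat X := QuotientGroup.mk' (aut0 X)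

/-! ### `G`-minimality -/

/-- `Pic(X)^G`. -/
def picInvariants (G : Subgroup (RegAut X)) : AddSubgroup (Cl X) where
  carrier := {c | c ∈ pic X ∧ ∀ g ∈ G, g • c = c}
  zero_mem' := ⟨zero_mem _, fun g _ => smul_zero g⟩
  add_mem' := fun ha hb => ⟨add_mem ha.1 hb.1, fun g hg => by
    rw [smul_add, ha.2 g hg, hb.2 g hg]⟩
  neg_mem' := fun ha => ⟨neg_mem ha.1, fun g hg => by rw [smul_neg, ha.2 g hg]⟩

/-- For a del Pezzo threefold `X` (terminal Gorenstein singularities, `-K_X` ample; these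
conditions do not involve `G`), `X` is `G`-minimal, i.e. a `Gℚ`-Fano variety, if it is
`Gℚ`-factorial (every `G`-invariant Weil divisor is `ℚ`-Cartier) and `ρ^G(X) = rk Pic(X)^G = 1`. -/
def IsGMinimal (G : Subgroup (RegAut X)) : Prop :=
  (∀ D : Div X, (∀ g ∈ G, g • D = D) → ∃ N : ℕ, 0 < N ∧ N • D ∈ cartier X) ∧
    Module.finrank ℤ (picInvariants G) = 1

/-- The images `G' ⊆ Âut(X)` of the finite groups `G ⊆ Aut(X)` for which `X` is `G`-minimal. -/
def minimalImages (X : Set (ProjSpace K n)) : Set (Subgroup (AutHat X)) :=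
  {G' | ∃ G : Subgroup (RegAut X), Finite G ∧ IsGMinimal G ∧ G' = G.map (toAutHat X)}

/-- The conjugacy class of a subgroup. -/
def conjClass {H : Type*} [Group H] (S : Subgroup H) : Set (Subgroup H) :=
  {T | ∃ a : H, T = S.map (MulAut.conj a).toMonoidHom}

/-- The number of conjugacy classes in `Âut(X)` of images `G'` as above isomorphic to `Γ`. -/
def numClasses (X : Set (ProjSpace K n)) (Γ : Type) [Group Γ] : ℕ :=
  {c : Set (Subgroup (AutHat X)) |
    ∃ G' ∈ minimalImages X, Nonempty (G' ≃* Γ) ∧ c = conjClass G'}.ncard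

/-! ### Pencils of quadrics and the Segre symbol -/

/-- The matrix `A + tB` over `K[t]`. -/
def pencil {m : ℕ} (A B : Matrix (Fin m) (Fin m) K) :
    Matrix (Fin m) (Fin m) (Polynomial K) :=
  A.map Polynomial.C + (Polynomial.X : Polynomial K) • B.map Polynomial.C

/-- The least multiplicity `l_i` of the root `t` in the minors of order `m - i` of `A + tB`. -/
def minorMult {m : ℕ} (A B : Matrix (Fin m) (Fin m) K) (t : K) (i : ℕ) : ℕ :=
  (⨅ (r : Fin (m - i) ↪o Fin m) (c : Fin (m - i) ↪o Fin m),
    emultiplicity (Polynomial.X - Polynomial.C t) ((pencil A B).submatrix r c).det).toNat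

/-- The characteristic numbers `e_i = l_i - l_{i+1}`, `0 ≤ i ≤ d`, of a root `t` of the discriminant
`det (A + tB)`, where `d + 1` is the corank of the singular quadric `A + tB`. -/
def charNumbers {m : ℕ} (A B : Matrix (Fin m) (Fin m) K) (t : K) : List ℕ :=
  (List.range (m - (A + t • B).rank)).map fun i => minorMult A B t i - minorMult A B t (i + 1)

open Classical in
/-- The Segre symbol of the pencil `λA + μB` with `B` nondegenerate (so that every root of the
discriminant is of the form `(1 : t)`), up to the order of the brackets. -/
def segreSymbol {m : ℕ} (A B : Matrix (Fin m) (Fin m) K) : Multiset (List ℕ) :=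
  (pencil A B).det.roots.toFinset.val.map (charNumbers A B)

/-- The intersection of the quadrics with matrices `A` and `B`. -/
def quadricIntersection (A B : Matrix (Fin (n + 1)) (Fin (n + 1)) K) : Set (ProjSpace K n) :=
  {p | (Projectivization.rep p) ⬝ᵥ A.mulVec (Projectivization.rep p) = 0 ∧
    (Projectivization.rep p) ⬝ᵥ B.mulVec (Projectivization.rep p) = 0}

/-! ### The finite groups of the classification -/

/-- The cyclic group of order `m` (for `m ≥ 1`), written multiplicatively. -/
abbrev Cyc (m : ℕ) : Type := Multiplicative (ZMod m)

/-- `C₂³ ⋊ S₃`, where `S₃` permutes the three factors. -/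
abbrev C2CubedS3 : Type := (Fin 3 → Cyc 2) ⋊[mulAutArrow] Equiv.Perm (Fin 3)

/-- `C₂³ ⋊ C₃`, where `C₃ = A₃` permutes the three factors cyclically. -/
abbrev C2CubedC3 : Type := (Fin 3 → Cyc 2) ⋊[mulAutArrow] alternatingGroup (Fin 3)

end ProjVar

end

/-! ### Regular functions and orders of vanishing -/

open Filter
noncomputable section
namespace ProjVar
open MvPolynomial

section Basics

variable {K : Type*} [Field K] {n : ℕ}

/-! Toric form. Three brackets of length two mean that three quadrics of the pencil have corank two.
Their kernels are two-dimensional, mutually orthogonal for `B`, and span the space. A suitably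
scaled hyperbolic pair in each kernel gives coordinates in which X is y₀₀y₀₁ = y₁₀y₁₁ = y₂₀y₂₁
(`nonempty_toricCoords`). So X is a toric threefold. The complement of the torus is a union of eight
planes, indexed by the vertices s of a cube: plane s is cut out by the three coordinates (i, s i).
The generic point of plane s lies in a chart 𝔸¹ × 𝔾ₘ² which meets no other plane. Hence orders along
divisors are read off from factorisations in a polynomial ring in three variables. Every divisor is
equivalent to a combination of planes, and the principal combinations are divisors of monomials
(`exists_sub_mem_principal`, `exists_eq_monoOrd`).

Automorphisms. A rational function whose only poles lie along one plane is constant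
(`eq_const_of_hasOrd`), so a plane is the only prime divisor in its class. Therefore Aut⁰ fixes
every plane, and since it contains the torus, every automorphism permutes the planes
(`exists_smul_D`). Divisors of quotients of coordinates go to divisors of monomials, which forces
the permutation of the vertices to be a symmetry of the cube. Permutations of the coordinates
realise all symmetries, whence Aut/Aut⁰ ≅ C₂³ ⋊ S₃ (`autHatEquiv`). Moreover Aut⁰ embeds in (Kˣ)³,
whose finite subgroups are products of three cyclic groups (`exists_ker_equiv_cyc`).

Minimality. The sum of the planes is Cartier, and an integral function on the vertices is rationally
equivalent to a multiple of it exactly when it is affine. By averaging over G, minimality means that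
every invariant function on the vertices is affine (`isGMinimal_iff`). For the indicator of the
orbit of a vertex this says that the orbit is the whole cube or a facet (`IsMinimalSym.cases`).

Group theory. A facet as orbit leaves C₄, C₂² and D₈. If the group is transitive, its translations
have index at most two in C₂³; in index two they are the kernel of a linear form over 𝔽₂ which is
invariant under the linear parts. This leaves eight more groups up to conjugacy. Among the eleven
groups `rep`, the order and the number of elements with square one separate the nine isomorphism
types, and the three copies of D₈ are pairwise not conjugate. -/

theorem eval_smul_of_isHomogeneous {σ : Type*} [Fintype σ] {F : MvPolynomial σ K} {d : ℕ}
    (hF : F.IsHomogeneous d) (a : K) (v : σ → K) : eval (a • v) F = a ^ d * eval v F := by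
  classical
  rw [eval_eq', eval_eq', Finset.mul_sum]
  refine Finset.sum_congr rfl fun m hm => ?_
  have hd : ∑ i, m i = d := by
    have := hF (mem_support_iff.1 hm)
    rw [Finsupp.weight_apply, Finsupp.sum_fintype _ _ (by simp)] at this
    simpa using this
  simp only [Pi.smul_apply, smul_eq_mul, mul_pow, Finset.prod_mul_distrib]
  rw [Finset.prod_pow_eq_pow_sum, hd]
  ring

theorem isOpen_evalAt_ne {F : MvPolynomial (Fin (n + 1)) K} {d : ℕ} (hF : F.IsHomogeneous d) :
    IsOpen {p : ProjSpace K n | evalAt p F ≠ 0} :=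
  TopologicalSpace.isOpen_generateFrom_of_mem ⟨d, F, hF, rfl⟩

/-- The product of two forms cuts out the intersection of their principal open sets, so the
generating family is a basis and not only a subbasis. -/
theorem exists_evalAt_ne_of_isOpen {U : Set (ProjSpace K n)} (hU : IsOpen U) {p : ProjSpace K n}
    (hp : p ∈ U) : ∃ (d : ℕ) (F : MvPolynomial (Fin (n + 1)) K), F.IsHomogeneous d ∧
      evalAt p F ≠ 0 ∧ ∀ q, evalAt q F ≠ 0 → q ∈ U := by
  induction hU with
  | basic s hs =>
    obtain ⟨d, F, hF, rfl⟩ := hs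
    exact ⟨d, F, hF, hp, fun q hq => hq⟩
  | univ => exact ⟨0, 1, isHomogeneous_one _ _, by simp [evalAt], fun _ _ => trivial⟩
  | inter s t _ _ hs ht =>
    obtain ⟨d, F, hF, h1, h2⟩ := hs hp.1
    obtain ⟨e, G, hG, h3, h4⟩ := ht hp.2
    refine ⟨d + e, F * G, hF.mul hG, by simpa [evalAt] using ⟨h1, h3⟩, fun q hq => ?_⟩
    simp only [evalAt, map_mul, ne_eq, mul_eq_zero, not_or] at hq
    exact ⟨h2 q hq.1, h4 q hq.2⟩
  | sUnion S _ ih =>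
    obtain ⟨s, hs, hps⟩ := hp
    obtain ⟨d, F, hF, h1, h2⟩ := ih s hs hps
    exact ⟨d, F, hF, h1, fun q hq => ⟨s, hs, h2 q hq⟩⟩

variable {X : Set (ProjSpace K n)}

theorem isOpen_coe_evalAt_ne (X : Set (ProjSpace K n)) {F : MvPolynomial (Fin (n + 1)) K} {d : ℕ}
    (hF : F.IsHomogeneous d) : IsOpen {p : X | evalAt p.1 F ≠ 0} :=
  (isOpen_evalAt_ne hF).preimage continuous_subtype_val

theorem exists_coe_evalAt_ne_of_isOpen {U : Set X} (hU : IsOpen U) {p : X}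
    (hp : p ∈ U) : ∃ (d : ℕ) (F : MvPolynomial (Fin (n + 1)) K), F.IsHomogeneous d ∧
      evalAt p.1 F ≠ 0 ∧ ∀ q : X, evalAt q.1 F ≠ 0 → q ∈ U := by
  obtain ⟨V, hV, rfl⟩ := isOpen_induced_iff.1 hU
  obtain ⟨d, F, hF, h1, h2⟩ := exists_evalAt_ne_of_isOpen hV hp
  exact ⟨d, F, hF, h1, fun q hq => h2 _ hq⟩

/-- Regular functions which agree on a dense set agree wherever they are regular. -/
theorem IsRegularAt.eq_of_dense {f g : X → K} {p : X} (hf : IsRegularAt f p)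
    (hg : IsRegularAt g p) {V : Set X} (hV : Dense V) (h : ∀ x ∈ V, f x = g x) : f p = g p := by
  obtain ⟨U, hU, hpU, d, F, G, hF, hG, h1⟩ := hf
  obtain ⟨U', hU', hpU', e, F', G', hF', hG', h2⟩ := hg
  by_contra hne
  -- Where both fractions are defined, f ≠ g is the nonvanishing of this form, an open condition. If
  -- it held at p, the open set would meet the dense set on which f = g.
  have hH : (F * G' - F' * G).IsHomogeneous (d + e) :=
    (hF.mul hG').sub (by rw [add_comm d e]; exact hF'.mul hG)
  have key : ∀ x ∈ U ∩ U', evalAt x.1 (F * G' - F' * G) = 0 ↔ f x = g x := by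
    intro x hx
    obtain ⟨h3, h4⟩ := h1 x hx.1
    obtain ⟨h5, h6⟩ := h2 x hx.2
    rw [h4, h6, div_eq_div_iff h3 h5]
    simp only [evalAt, map_sub, map_mul, sub_eq_zero]
  obtain ⟨x, hx, hxV⟩ := hV.inter_open_nonempty
    ((U ∩ U') ∩ {x : X | evalAt x.1 (F * G' - F' * G) ≠ 0})
    ((hU.inter hU').inter (isOpen_coe_evalAt_ne X hH))
    ⟨p, ⟨hpU, hpU'⟩, fun h0 => hne ((key p ⟨hpU, hpU'⟩).1 h0)⟩
  exact hx.2 ((key x hx.1).2 (h x hxV))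

theorem germ_eq_iff {f g : X → K} :
    (f : GenericGerm X) = g ↔ ∃ U : Set X, IsOpen U ∧ Dense U ∧ ∀ x ∈ U, f x = g x := by
  rw [Germ.coe_eq]
  constructor
  · rintro ⟨U, h, hU, hU'⟩
    exact ⟨U, hU, hU', fun x hx => h hx⟩
  · rintro ⟨U, hU, hU', h⟩
    exact ⟨U, fun x hx => h x hx, hU, hU'⟩

theorem IsRegularOn.eq_of_germ_eq {f g : X → K} {U : Set X} (hf : IsRegularOn f U)
    (hg : IsRegularOn g U) (h : (f : GenericGerm X) = g) : ∀ p ∈ U, f p = g p := by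
  obtain ⟨V, -, hV, h⟩ := germ_eq_iff.1 h
  exact fun p hp => (hf p hp).eq_of_dense (hg p hp) hV h

theorem IsRegularAt.inv {f : X → K} {p : X} (hf : IsRegularAt f p) (h0 : f p ≠ 0) :
    IsRegularAt f⁻¹ p := by
  obtain ⟨U, hU, hpU, d, F, G, hF, hG, h⟩ := hf
  refine ⟨U ∩ {x : X | evalAt x.1 F ≠ 0}, hU.inter (isOpen_coe_evalAt_ne X hF), ⟨hpU, ?_⟩,
    d, G, F, hG, hF, fun x hx => ⟨hx.2, ?_⟩⟩
  · intro h1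
    apply h0
    rw [(h p hpU).2, h1, zero_div]
  · rw [Pi.inv_apply, (h x hx.1).2, inv_div]

theorem IsRegularAt.congr {f g : X → K} {U : Set X} (hU : IsOpen U) {p : X} (hp : p ∈ U)
    (hf : IsRegularAt f p) (h : ∀ x ∈ U, f x = g x) : IsRegularAt g p := by
  obtain ⟨V, hV, hpV, d, F, G, hF, hG, h'⟩ := hf
  exact ⟨V ∩ U, hV.inter hU, ⟨hpV, hp⟩, d, F, G, hF, hG, fun x hx =>
    ⟨(h' x hx.1).1, by rw [← h x hx.2, (h' x hx.1).2]⟩⟩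

theorem isRegularAt_div {d : ℕ} {F G : MvPolynomial (Fin (n + 1)) K} (hF : F.IsHomogeneous d)
    (hG : G.IsHomogeneous d) {p : X} (hp : evalAt p.1 G ≠ 0) :
    IsRegularAt (fun x : X => evalAt x.1 F / evalAt x.1 G) p :=
  ⟨{x : X | evalAt x.1 G ≠ 0}, isOpen_coe_evalAt_ne X hG, hp, d, F, G, hF, hG,
    fun _ hx => ⟨hx, rfl⟩⟩

/-! ### Orders of vanishing -/

/-- Two presentations as fractions cross-multiply to `a * b' = a' * b`. `Ring.ord` is additive on
products with a non-zero-divisor, and the lengths involved are finite, so they cancel. -/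
theorem HasOrd.unique {Z : PrimeDivisor X} {f : GenericGerm X} {m m' : ℤ}
    (h : HasOrd Z f m) (h' : HasOrd Z f m') : m = m' := by
  obtain ⟨a, b, k, l, ha, hb, h, hk, hl, rfl⟩ := h
  obtain ⟨a', b', k', l', ha', hb', h', hk', hl', rfl⟩ := h'
  have e : a * b' = a' * b := Subtype.ext (by
    push_cast
    rw [← h, ← h']
    ring)
  have := congrArg (Ring.ord (localRing Z.1)) e
  rw [Ring.ord_mul _ hb', Ring.ord_mul _ hb, hk, hl, hk', hl'] at this
  have h2 : k + l' = k' + l := by exact_mod_cast this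
  omega

theorem HasOrd.pow {Z : PrimeDivisor X} {f : GenericGerm X} {m : ℤ} (h : HasOrd Z f m) (k : ℕ) :
    HasOrd Z (f ^ k) (k * m) := by
  induction k with
  | zero => simpa using HasOrd.one Z
  | succ k ih =>
    rw [pow_succ]
    convert ih.mul h using 1
    push_cast
    ring

theorem HasOrd.zero_of_mul_eq_one {Z : PrimeDivisor X} {f g : GenericGerm X}
    (hf : f ∈ localRing Z.1) (hg : g ∈ localRing Z.1) (h : f * g = 1) : HasOrd Z f 0 := by
  have hu : IsUnit (⟨f, hf⟩ : localRing Z.1) := .of_mul_eq_one ⟨g, hg⟩ (Subtype.ext h)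
  exact ⟨⟨f, hf⟩, 1, 0, 0, hu.mem_nonZeroDivisors, one_mem _, by simp,
    by simp [Ring.ord_of_isUnit hu], by simp, by simp⟩

theorem HasOrd.zero_of_regular {Z : PrimeDivisor X} {f : X → K} {U : Set X} (hU : IsOpen U)
    (hUd : Dense U) (hZ : ((Z.1 : Set X) ∩ U).Nonempty) (hf : IsRegularOn f U)
    (h0 : ∀ p ∈ U, f p ≠ 0) : HasOrd Z (f : GenericGerm X) 0 := by
  refine HasOrd.zero_of_mul_eq_one (g := ((f⁻¹ : X → K) : GenericGerm X)) ⟨f, U, hU, hZ, hf, rfl⟩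
    ⟨f⁻¹, U, hU, hZ, fun p hp => (hf p hp).inv (h0 p hp), rfl⟩ ?_
  exact germ_eq_iff.2 ⟨U, hU, hUd, fun x hx => by simp [mul_inv_cancel₀ (h0 x hx)]⟩

end Basics

end ProjVar
end

open Filter
noncomputable section
namespace ProjVar
open MvPolynomial

/-! ### Toric coordinates -/

/-- Linear coordinates `y_(i,ε)` on `ℙ⁵` in which `X` is given by
`y_(0,0) y_(0,1) = y_(1,0) y_(1,1) = y_(2,0) y_(2,1)`. -/
structure ToricCoords {K : Type*} [Field K] (X : Set (ProjSpace K 5)) where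
  L : (Fin 6 → K) ≃ₗ[K] (Fin 3 × ZMod 2 → K)
  mem_iff : ∀ p : ProjSpace K 5, p ∈ X ↔ ∀ i, L (Projectivization.rep p) (i, 0) *
    L (Projectivization.rep p) (i, 1) =
      L (Projectivization.rep p) (0, 0) * L (Projectivization.rep p) (0, 1)

theorem ZMod.two_cases (a : ZMod 2) : a = 0 ∨ a = 1 := by
  revert a; decide

theorem ZMod.add_one_ne_self (a : ZMod 2) : a + 1 ≠ a := by
  revert a; decide

theorem ZMod.ne_iff_eq_add_one {a b : ZMod 2} : a ≠ b ↔ a = b + 1 := by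
  revert a b; decide

theorem ZMod.add_one_add_one (a : ZMod 2) : a + 1 + 1 = a := by
  revert a; decide

/-- The vertices of the cube, which index the planes in `X`. -/
abbrev Cube : Type := Fin 3 → ZMod 2

namespace ToricCoords

variable {K : Type*} [Field K] {X : Set (ProjSpace K 5)} (C : ToricCoords X)

/-- The homogeneous coordinates of a point, with respect to a chosen representative. -/
def cd (p : X) : Fin 3 × ZMod 2 → K := C.L (Projectivization.rep p.1)

/-- The coordinates as linear forms. -/
def form (k : Fin 3 × ZMod 2) : MvPolynomial (Fin 6) K :=
  ∑ j, MvPolynomial.C (C.L (Pi.single j 1) k) * MvPolynomial.X j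

theorem form_isHomogeneous (k : Fin 3 × ZMod 2) : (C.form k).IsHomogeneous 1 := by
  refine IsHomogeneous.sum _ _ _ fun j _ => ?_
  simpa using (isHomogeneous_C (Fin 6) (C.L (Pi.single j 1) k)).mul (isHomogeneous_X K j)

theorem form_pow_isHomogeneous (k : Fin 3 × ZMod 2) (d : ℕ) :
    (C.form k ^ d).IsHomogeneous d := by
  simpa using (C.form_isHomogeneous k).pow d

theorem eval_form (v : Fin 6 → K) (k : Fin 3 × ZMod 2) : eval v (C.form k) = C.L v k := by
  have h : v = ∑ j, v j • (Pi.single j 1 : Fin 6 → K) := by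
    ext i
    simp [Finset.sum_apply, Pi.single_apply]
  conv_rhs => rw [h]
  simp [form, map_sum, mul_comm]

theorem evalAt_form (p : X) (k : Fin 3 × ZMod 2) : evalAt p.1 (C.form k) = C.cd p k :=
  C.eval_form _ _

theorem isOpen_cd_ne (k : Fin 3 × ZMod 2) : IsOpen {p : X | C.cd p k ≠ 0} := by
  simpa only [evalAt_form] using isOpen_coe_evalAt_ne X (C.form_isHomogeneous k)

theorem exists_cd_ne (p : X) : ∃ k, C.cd p k ≠ 0 := by
  by_contra! h
  have h1 : C.L (Projectivization.rep p.1) = 0 := funext h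
  exact Projectivization.rep_nonzero p.1 (by simpa using h1)

theorem prod_eq (p : X) (i j : Fin 3) (ε δ : ZMod 2) :
    C.cd p (i, ε) * C.cd p (i, ε + 1) = C.cd p (j, δ) * C.cd p (j, δ + 1) := by
  have h := (C.mem_iff p.1).1 p.2
  have h1 : ∀ i ε, C.cd p (i, ε) * C.cd p (i, ε + 1) = C.cd p (0, 0) * C.cd p (0, 1) := by
    intro i ε
    rw [cd, ← h i]
    rcases ZMod.two_cases ε with rfl | rfl
    · simp
    · rw [show (1 : ZMod 2) + 1 = 0 by decide, mul_comm]
  rw [h1, h1]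

/-- The point with given homogeneous coordinates. -/
def pt (y : Fin 3 × ZMod 2 → K) (h0 : y ≠ 0)
    (h : ∀ i, y (i, 0) * y (i, 1) = y (0, 0) * y (0, 1)) : X :=
  ⟨Projectivization.mk K (C.L.symm y) (by simpa using h0), by
    refine (C.mem_iff (Projectivization.mk K (C.L.symm y) (by simpa using h0))).2 ?_
    obtain ⟨a, ha⟩ := Projectivization.exists_smul_eq_mk_rep K (C.L.symm y) (by simpa using h0)
    intro i
    rw [← ha, Units.smul_def]
    simp only [map_smul, LinearEquiv.apply_symm_apply, Pi.smul_apply, smul_eq_mul]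
    linear_combination (a : K) ^ 2 * h i⟩

theorem exists_cd_pt (y : Fin 3 × ZMod 2 → K) (h0 : y ≠ 0)
    (h : ∀ i, y (i, 0) * y (i, 1) = y (0, 0) * y (0, 1)) :
    ∃ a : K, a ≠ 0 ∧ ∀ k, C.cd (C.pt y h0 h) k = a * y k := by
  obtain ⟨a, ha⟩ := Projectivization.exists_smul_eq_mk_rep K (C.L.symm y) (by simpa using h0)
  refine ⟨a, a.ne_zero, fun k => ?_⟩
  rw [cd]
  change C.L (Projectivization.rep (Projectivization.mk K (C.L.symm y) _)) k = _
  rw [← ha, Units.smul_def]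
  simp

theorem eq_of_cd {p q : X} {a : K} (h : ∀ k, C.cd p k = a * C.cd q k) : p = q := by
  apply Subtype.ext
  have h1 : C.L (Projectivization.rep p.1) = C.L (a • Projectivization.rep q.1) := by
    ext k
    simpa [cd] using h k
  have h2 := C.L.injective h1
  have e1 := Projectivization.mk_rep (p.1 : Projectivization K (Fin 6 → K))
  have e2 := Projectivization.mk_rep (q.1 : Projectivization K (Fin 6 → K))
  rw [← e1, ← e2]
  exact (Projectivization.mk_eq_mk_iff' K _ _ _ _).2 ⟨a, h2.symm⟩

theorem evalAt_pt (y : Fin 3 × ZMod 2 → K) (h0 : y ≠ 0)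
    (h : ∀ i, y (i, 0) * y (i, 1) = y (0, 0) * y (0, 1)) {F : MvPolynomial (Fin 6) K} {d : ℕ}
    (hF : F.IsHomogeneous d) :
    evalAt (C.pt y h0 h).1 F = 0 ↔ eval (C.L.symm y) F = 0 := by
  obtain ⟨a, ha⟩ := Projectivization.exists_smul_eq_mk_rep K (C.L.symm y) (by simpa using h0)
  change eval (Projectivization.rep (Projectivization.mk K (C.L.symm y) _)) F = 0 ↔ _
  rw [← ha, Units.smul_def, eval_smul_of_isHomogeneous hF]
  simp

/-! ### Charts -/

/-- The affine chart attached to a vertex of the cube. -/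
def U (s : Cube) : Set X := {p | ∀ i, C.cd p (i, s i + 1) ≠ 0}

/-- The torus. -/
def T : Set X := {p | ∀ k, C.cd p k ≠ 0}

/-- The planes in `X`. -/
def plane (s : Cube) : Set X := {p | ∀ i, C.cd p (i, s i) = 0}

theorem isOpen_U (s : Cube) : IsOpen (C.U s) := by
  have : C.U s = ⋂ i, {p | C.cd p (i, s i + 1) ≠ 0} := by ext; simp [U]
  rw [this]
  exact isOpen_iInter_of_finite fun i => C.isOpen_cd_ne _

theorem isOpen_T : IsOpen C.T := by
  have : C.T = ⋂ k, {p | C.cd p k ≠ 0} := by ext; simp [T]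
  rw [this]
  exact isOpen_iInter_of_finite fun i => C.isOpen_cd_ne _

theorem isClosed_plane (s : Cube) : IsClosed (C.plane s) := by
  have : C.plane s = ⋂ i, {p | C.cd p (i, s i) ≠ 0}ᶜ := by ext; simp [plane]
  rw [this]
  exact isClosed_iInter fun i => (C.isOpen_cd_ne _).isClosed_compl

theorem T_subset_U (s : Cube) : C.T ⊆ C.U s := fun _ hp _ => hp _

/-- The affine coordinates on the chart. -/
def c (s : Cube) (p : X) : Fin 3 → K :=
  ![C.cd p (0, s 0) / C.cd p (0, s 0 + 1), C.cd p (1, s 1 + 1) / C.cd p (0, s 0 + 1),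
    C.cd p (2, s 2 + 1) / C.cd p (0, s 0 + 1)]

/-- Homogeneous coordinates of the point with given affine coordinates. -/
def vec (s : Cube) (a : Fin 3 → K) (k : Fin 3 × ZMod 2) : K :=
  if k.2 = s k.1 then ![a 0 * a 1 * a 2, a 0 * a 2, a 0 * a 1] k.1
  else ![a 1 * a 2, a 1 * (a 1 * a 2), a 2 * (a 1 * a 2)] k.1

/-- The homogeneous coordinates as polynomials in the affine ones. -/
def vecPoly (s : Cube) (k : Fin 3 × ZMod 2) : MvPolynomial (Fin 3) K :=
  if k.2 = s k.1 then ![.X 0 * .X 1 * .X 2, .X 0 * .X 2, .X 0 * .X 1] k.1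
  else ![.X 1 * .X 2, .X 1 * (.X 1 * .X 2), .X 2 * (.X 1 * .X 2)] k.1

theorem eval_vecPoly (s : Cube) (a : Fin 3 → K) (k : Fin 3 × ZMod 2) :
    eval a (vecPoly s k) = vec s a k := by
  obtain ⟨i, ε⟩ := k
  unfold vec vecPoly
  dsimp only
  split_ifs <;> fin_cases i <;> simp

theorem vec_same (s : Cube) (a : Fin 3 → K) (i : Fin 3) :
    vec s a (i, s i) = ![a 0 * a 1 * a 2, a 0 * a 2, a 0 * a 1] i := by simp [vec]

theorem vec_opp (s : Cube) (a : Fin 3 → K) (i : Fin 3) :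
    vec s a (i, s i + 1) = ![a 1 * a 2, a 1 * (a 1 * a 2), a 2 * (a 1 * a 2)] i := by
  simp [vec]

theorem forall_index {P : Fin 3 × ZMod 2 → Prop} (s : Cube) (h1 : ∀ i, P (i, s i))
    (h2 : ∀ i, P (i, s i + 1)) : ∀ k, P k := by
  rintro ⟨i, ε⟩
  by_cases h : ε = s i
  · exact h ▸ h1 i
  · rw [ZMod.ne_iff_eq_add_one.1 h]
    exact h2 i

theorem vec_prod (s : Cube) (a : Fin 3 → K) (i : Fin 3) :
    vec s a (i, 0) * vec s a (i, 1) = a 0 * a 1 * a 2 * (a 1 * a 2) := by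
  have h : vec s a (i, s i) * vec s a (i, s i + 1) = a 0 * a 1 * a 2 * (a 1 * a 2) := by
    rw [vec_same, vec_opp]
    fin_cases i <;> simp <;> ring
  rcases ZMod.two_cases (s i) with h1 | h1 <;> rw [h1] at h
  · simpa using h
  · rw [show (1 : ZMod 2) + 1 = 0 by decide, mul_comm] at h
    exact h

/-- With (x, y, z) = `c s p` and the coordinate `(0, s 0 + 1)` scaled to 1, the coordinates opposite
to s are (1, y, z), and the equations of X give (x, x/y, x/z) for the others. `vec` is this vector
times yz, which clears the denominators; accordingly the factor `l` is that coordinate divided by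
yz. -/
theorem cd_eq_vec (s : Cube) {p : X} (hp : p ∈ C.U s) :
    ∃ l : K, l ≠ 0 ∧ ∀ k, C.cd p k = l * vec s (C.c s p) k := by
  have h0 := hp 0
  have h1 := hp 1
  have h2 := hp 2
  refine ⟨C.cd p (0, s 0 + 1) ^ 3 / (C.cd p (1, s 1 + 1) * C.cd p (2, s 2 + 1)), by positivity, ?_⟩
  refine forall_index s (fun i => ?_) (fun i => ?_)
  · rw [vec_same]
    have e1 := C.prod_eq p 1 0 (s 1) (s 0)
    have e2 := C.prod_eq p 2 0 (s 2) (s 0)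
    fin_cases i <;> simp [c] <;> field_simp
    · linear_combination e1
    · linear_combination e2
  · rw [vec_opp]
    fin_cases i <;> simp [c] <;> field_simp

/-- Together with `eq_of_c_eq` this identifies the chart with 𝔸¹ × 𝔾ₘ². -/
theorem exists_point (s : Cube) (a : Fin 3 → K) (h1 : a 1 ≠ 0) (h2 : a 2 ≠ 0) :
    ∃ p ∈ C.U s, C.c s p = a := by
  have hv : ∀ i, vec s a (i, s i + 1) ≠ 0 := by
    intro i
    rw [vec_opp]
    fin_cases i <;> simp [h1, h2]
  have h0 : vec s a ≠ 0 := fun h => hv 0 (by rw [h]; rfl)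
  have hp : ∀ i, vec s a (i, 0) * vec s a (i, 1) = vec s a (0, 0) * vec s a (0, 1) :=
    fun i => by rw [vec_prod, vec_prod]
  obtain ⟨l, hl, h⟩ := C.exists_cd_pt _ h0 hp
  refine ⟨C.pt _ h0 hp, fun i => ?_, ?_⟩
  · rw [h]
    exact mul_ne_zero hl (hv i)
  · ext i
    fin_cases i <;> simp only [c, h, vec_same, vec_opp] <;> simp <;> field_simp

theorem c_one_ne (s : Cube) {p : X} (hp : p ∈ C.U s) : C.c s p 1 ≠ 0 :=
  div_ne_zero (hp 1) (hp 0)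

theorem c_two_ne (s : Cube) {p : X} (hp : p ∈ C.U s) : C.c s p 2 ≠ 0 :=
  div_ne_zero (hp 2) (hp 0)

theorem mem_T_iff (s : Cube) {p : X} (hp : p ∈ C.U s) : p ∈ C.T ↔ C.c s p 0 ≠ 0 := by
  constructor
  · intro h
    exact div_ne_zero (h _) (h _)
  · intro h
    have h00 : C.cd p (0, s 0) ≠ 0 := fun h0 => h (by simp [c, h0])
    refine forall_index s (fun i => ?_) hp
    intro h1
    have := C.prod_eq p i 0 (s i) (s 0)
    rw [h1, zero_mul] at this
    exact mul_ne_zero h00 (hp 0) this.symm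

theorem mem_plane_iff (s : Cube) {p : X} (hp : p ∈ C.U s) : p ∈ C.plane s ↔ C.c s p 0 = 0 := by
  constructor
  · intro h
    simp [c, h 0]
  · intro h i
    have h00 : C.cd p (0, s 0) = 0 := by
      have := (div_eq_zero_iff.1 (show C.cd p (0, s 0) / C.cd p (0, s 0 + 1) = 0 from h))
      exact this.resolve_right (hp 0)
    have := C.prod_eq p i 0 (s i) (s 0)
    rw [h00, zero_mul] at this
    exact (mul_eq_zero.1 this).resolve_right (hp i)

theorem eq_of_c_eq (s : Cube) {p q : X} (hp : p ∈ C.U s) (hq : q ∈ C.U s)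
    (h : C.c s p = C.c s q) : p = q := by
  obtain ⟨l, hl, h1⟩ := C.cd_eq_vec s hp
  obtain ⟨m, hm, h2⟩ := C.cd_eq_vec s hq
  refine C.eq_of_cd (a := l / m) fun k => ?_
  rw [h1, h2, h]
  field_simp

/-- Every point outside the torus lies in one of the planes. -/
theorem exists_mem_plane {p : X} (hp : p ∉ C.T) : ∃ s, p ∈ C.plane s := by
  simp only [T, Set.mem_ofPred_eq, not_forall, not_not] at hp
  obtain ⟨⟨j, δ⟩, hk⟩ := hp
  have h : ∀ i, ∃ ε, C.cd p (i, ε) = 0 := by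
    intro i
    have := C.prod_eq p i j 0 δ
    rw [hk, zero_mul] at this
    rcases mul_eq_zero.1 this with h | h
    · exact ⟨_, h⟩
    · exact ⟨_, h⟩
  choose s hs using h
  exact ⟨s, hs⟩

/-! ### Polynomials on the charts -/

/-- Pull-back of polynomials to an affine chart. -/
def pull (s : Cube) : MvPolynomial (Fin 6) K →ₐ[K] MvPolynomial (Fin 3) K :=
  aeval fun j => ∑ k, MvPolynomial.C (C.L.symm (Pi.single k 1) j) * vecPoly s k

theorem eval_pull (s : Cube) (F : MvPolynomial (Fin 6) K) (a : Fin 3 → K) :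
    eval a (C.pull s F) = eval (C.L.symm (vec s a)) F := by
  have h : C.L.symm (vec s a) = fun j => eval a
      (∑ k, MvPolynomial.C (C.L.symm (Pi.single k 1) j) * vecPoly s k) := by
    have h1 : vec s a = ∑ k, vec s a k • (Pi.single k 1 : Fin 3 × ZMod 2 → K) := by
      ext i
      simp [Finset.sum_apply, Pi.single_apply]
    conv_lhs => rw [h1]
    ext j
    simp [map_sum, eval_vecPoly, mul_comm]
  rw [h]
  induction F using MvPolynomial.induction_on with
  | C r => simp [pull]
  | add F G hF hG => simp only [map_add, hF, hG]
  | mul_X F i hF => rw [map_mul, map_mul, hF, map_mul]; simp [pull]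

theorem evalAt_eq_pull (s : Cube) {p : X} (hp : p ∈ C.U s) : ∃ l : K, l ≠ 0 ∧
    ∀ (d : ℕ) (F : MvPolynomial (Fin 6) K), F.IsHomogeneous d →
      evalAt p.1 F = l ^ d * eval (C.c s p) (C.pull s F) := by
  obtain ⟨l, hl, h⟩ := C.cd_eq_vec s hp
  refine ⟨l, hl, fun d F hF => ?_⟩
  rw [eval_pull, ← eval_smul_of_isHomogeneous hF, ← map_smul]
  have : l • vec s (C.c s p) = C.L (Projectivization.rep p.1) := by
    ext k
    exact (h k).symm
  rw [this, LinearEquiv.symm_apply_apply]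
  rfl

/-- Powers of the form `(0, s 0 + 1)`, which has no zero on the chart, bring the summands to equal
degree. With `pull` in the other direction, forms on X and polynomials in the three affine
coordinates define the same open sets and the same quotients on the chart. -/
theorem exists_homogenization (s : Cube) (P : MvPolynomial (Fin 3) K) :
    ∃ (d : ℕ) (F : MvPolynomial (Fin 6) K), F.IsHomogeneous d ∧
      ∀ p ∈ C.U s, evalAt p.1 F = C.cd p (0, s 0 + 1) ^ d * eval (C.c s p) P := by
  have key : ∀ i, ∃ k, ∀ p : X, C.c s p i = C.cd p k / C.cd p (0, s 0 + 1) := by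
    intro i
    fin_cases i
    · exact ⟨_, fun p => rfl⟩
    · exact ⟨_, fun p => rfl⟩
    · exact ⟨_, fun p => rfl⟩
  induction P using MvPolynomial.induction_on with
  | C r => exact ⟨0, MvPolynomial.C r, isHomogeneous_C _ _, fun p _ => by simp [evalAt]⟩
  | add P Q hP hQ =>
    obtain ⟨d, F, hF, h1⟩ := hP
    obtain ⟨e, G, hG, h2⟩ := hQ
    have hf := C.form_pow_isHomogeneous (0, s 0 + 1)
    refine ⟨d + e, F * C.form (0, s 0 + 1) ^ e + C.form (0, s 0 + 1) ^ d * G, ?_, fun p hp => ?_⟩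
    · exact (hF.mul (hf e)).add ((hf d).mul hG)
    · have h3 := h1 p hp
      have h4 := h2 p hp
      have h5 := C.evalAt_form p (0, s 0 + 1)
      simp only [evalAt, map_add, map_mul, map_pow] at *
      rw [h3, h4, h5]
      ring
  | mul_X P i hP =>
    obtain ⟨d, F, hF, h1⟩ := hP
    obtain ⟨k, hk⟩ := key i
    refine ⟨d + 1, F * C.form k, hF.mul (C.form_isHomogeneous k), fun p hp => ?_⟩
    have h3 := h1 p hp
    have h5 := C.evalAt_form p k
    simp only [evalAt, map_mul, eval_X] at *
    rw [h3, h5, hk]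
    have := hp 0
    field_simp
    ring

theorem isOpen_eval_ne (s : Cube) (P : MvPolynomial (Fin 3) K) :
    IsOpen {p : X | p ∈ C.U s ∧ eval (C.c s p) P ≠ 0} := by
  obtain ⟨d, F, hF, h⟩ := C.exists_homogenization s P
  have : {p : X | p ∈ C.U s ∧ eval (C.c s p) P ≠ 0} = C.U s ∩ {p : X | evalAt p.1 F ≠ 0} := by
    ext p
    simp only [Set.mem_ofPred_eq, Set.mem_inter_iff, and_congr_right_iff]
    intro hp
    rw [h p hp]
    simp [hp 0]
  rw [this]
  exact (C.isOpen_U s).inter (isOpen_coe_evalAt_ne X hF)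

theorem exists_eval_ne_of_isOpen (s : Cube) {O : Set X} (hO : IsOpen O) {p : X} (hp : p ∈ O)
    (hps : p ∈ C.U s) : ∃ P : MvPolynomial (Fin 3) K, eval (C.c s p) P ≠ 0 ∧
      ∀ q ∈ C.U s, eval (C.c s q) P ≠ 0 → q ∈ O := by
  obtain ⟨d, F, hF, h1, h2⟩ := exists_coe_evalAt_ne_of_isOpen hO hp
  refine ⟨C.pull s F, ?_, fun q hq h => h2 q ?_⟩
  · obtain ⟨l, hl, h⟩ := C.evalAt_eq_pull s hps
    rw [h d F hF] at h1
    exact right_ne_zero_of_mul h1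
  · obtain ⟨l, hl, h'⟩ := C.evalAt_eq_pull s hq
    rw [h' d F hF]
    exact mul_ne_zero (pow_ne_zero _ hl) h

theorem isRegularAt_eval_div (s : Cube) (P Q : MvPolynomial (Fin 3) K) {p : X} (hp : p ∈ C.U s)
    (hQ : eval (C.c s p) Q ≠ 0) :
    IsRegularAt (fun x : X => eval (C.c s x) P / eval (C.c s x) Q) p := by
  obtain ⟨d, F, hF, h1⟩ := C.exists_homogenization s P
  obtain ⟨e, G, hG, h2⟩ := C.exists_homogenization s Q
  have hf := C.form_pow_isHomogeneous (0, s 0 + 1)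
  have hp0 := hp 0
  refine IsRegularAt.congr (C.isOpen_eval_ne s Q) ⟨hp, hQ⟩ (isRegularAt_div (d := d + e)
    (F := F * C.form (0, s 0 + 1) ^ e) (G := C.form (0, s 0 + 1) ^ d * G)
    (hF.mul (hf e)) ((hf d).mul hG) ?_) ?_
  · have h4 := h2 p hp
    have h5 := C.evalAt_form p (0, s 0 + 1)
    simp only [evalAt, map_mul, map_pow] at *
    rw [h4, h5]
    exact mul_ne_zero (pow_ne_zero _ hp0) (mul_ne_zero (pow_ne_zero _ hp0) hQ)
  · rintro x ⟨hx, hx'⟩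
    have h3 := h1 x hx
    have h4 := h2 x hx
    have h5 := C.evalAt_form x (0, s 0 + 1)
    have hx0 := hx 0
    simp only [evalAt, map_mul, map_pow] at *
    rw [h3, h4, h5]
    field_simp

theorem exists_eval_div (s : Cube) {f : X → K} {p : X} (hf : IsRegularAt f p) (hp : p ∈ C.U s) :
    ∃ P Q : MvPolynomial (Fin 3) K, eval (C.c s p) Q ≠ 0 ∧ ∀ x ∈ C.U s, eval (C.c s x) Q ≠ 0 →
      f x * eval (C.c s x) Q = eval (C.c s x) P := by
  obtain ⟨O, hO, hpO, d, F, G, hF, hG, h⟩ := hf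
  obtain ⟨R, hR, h'⟩ := C.exists_eval_ne_of_isOpen s hO hpO hp
  -- The extra factor `R` confines the nonvanishing locus of the denominator to the neighbourhood
  -- where f is a fraction, so the identity holds wherever the denominator is nonzero on the chart.
  refine ⟨R * C.pull s F, R * C.pull s G, ?_, fun x hx hx0 => ?_⟩
  · obtain ⟨l, hl, h1⟩ := C.evalAt_eq_pull s hp
    have := (h p hpO).1
    rw [h1 d G hG] at this
    rw [map_mul]
    exact mul_ne_zero hR (right_ne_zero_of_mul this)
  · rw [map_mul] at hx0
    obtain ⟨h2, h3⟩ := h x (h' x hx (left_ne_zero_of_mul hx0))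
    obtain ⟨l, hl, h1⟩ := C.evalAt_eq_pull s hx
    have h4 := right_ne_zero_of_mul hx0
    rw [h3, h1 d G hG, h1 d F hF, map_mul, map_mul]
    field_simp

end ToricCoords

end ProjVar
end

/-! ### Density of the torus, prime divisors, and orders of rational functions -/

open Filter
noncomputable section
set_option linter.unusedSectionVars false
namespace ProjVar
open MvPolynomial TopologicalSpace

/-- In an irreducible space the whole space is the only maximal irreducible closed set, so coheight
zero means being everything. -/
theorem coheight_eq_one_iff {α : Type*} [TopologicalSpace α] [IrreducibleSpace α]
    (Z : IrreducibleCloseds α) : Order.coheight Z = 1 ↔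
      (Z : Set α) ≠ Set.univ ∧ ∀ W : IrreducibleCloseds α, Z < W → (W : Set α) = Set.univ := by
  have hmax : ∀ W : IrreducibleCloseds α, IsMax W ↔ (W : Set α) = Set.univ := by
    intro W
    constructor
    · intro h
      let top : IrreducibleCloseds α := ⟨Set.univ, IrreducibleSpace.isIrreducible_univ α,
        isClosed_univ⟩
      have : top ≤ W := h (show (W : Set α) ⊆ Set.univ from Set.subset_univ _)
      exact Set.univ_subset_iff.1 this
    · intro h V _
      change (V : Set α) ⊆ W
      rw [h]
      exact Set.subset_univ _
  constructor
  · intro h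
    have h' := (Order.coheight_eq_coe_add_one_iff (x := Z) (n := 0)).1 (by simpa using h)
    refine ⟨fun h0 => ?_, fun W hW => ?_⟩
    · rw [Order.coheight_eq_zero.2 ((hmax Z).2 h0)] at h
      exact zero_ne_one h
    · exact (hmax W).1 (Order.coheight_eq_zero.1 (le_antisymm (by simpa using h'.2.2 W hW) bot_le))
  · rintro ⟨h1, h2⟩
    apply le_antisymm
    · refine (Order.coheight_le_coe_iff (n := 1)).2 fun W hW => ?_
      rw [Order.coheight_eq_zero.2 ((hmax W).2 (h2 W hW))]
      exact_mod_cast zero_lt_one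
    · rw [Order.one_le_iff_ne_zero, Order.coheight_ne_zero, hmax]
      exact h1

namespace ToricCoords

variable {K : Type*} [Field K] {X : Set (ProjSpace K 5)} (C : ToricCoords X)

/-! ### Density of the torus -/

theorem exists_poly_along_curve (Y : Fin 3 × ZMod 2 → Polynomial K) (F : MvPolynomial (Fin 6) K) :
    ∃ g : Polynomial K, ∀ t, g.eval t = eval (C.L.symm fun k => (Y k).eval t) F := by
  refine ⟨aeval (fun j => ∑ k, Polynomial.C (C.L.symm (Pi.single k 1) j) * Y k) F, fun t => ?_⟩
  have h : (C.L.symm fun k => (Y k).eval t) = fun j => Polynomial.eval t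
      (∑ k, Polynomial.C (C.L.symm (Pi.single k 1) j) * Y k) := by
    have h1 : (fun k => (Y k).eval t) =
        ∑ k, (Y k).eval t • (Pi.single k 1 : Fin 3 × ZMod 2 → K) := by
      ext i
      simp [Finset.sum_apply, Pi.single_apply]
    conv_lhs => rw [h1]
    ext j
    simp [map_sum, Polynomial.eval_finsetSum, mul_comm]
  rw [h]
  induction F using MvPolynomial.induction_on with
  | C r => simp
  | add F G hF hG => simp only [map_add, Polynomial.eval_add, hF, hG]
  | mul_X F i hF => rw [map_mul, Polynomial.eval_mul, hF, map_mul]; simp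

variable [IsAlgClosed K]

/-- The point p is moved along a curve in X: the coordinates opposite to s become vᵢ = uᵢ + T, and
the coordinate (i, s i) becomes δT times the product of the other two v's. The three products in the
equations of X all equal δT·v₀v₁v₂, and T = 0 gives p. A general value of T stays in `O` and lies in
the chart. The choice δ = 1 yields points of the torus, δ = 0 points of the plane inside the chart.
-/
theorem exists_near_plane (s : Cube) {O : Set X} (hO : IsOpen O) {p : X} (hpO : p ∈ O)
    (hp : p ∈ C.plane s) (δ : K) : ∃ q ∈ O, q ∈ C.U s ∧ ∃ r ≠ 0, C.cd q (0, s 0) = r * δ := by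
  obtain ⟨d, F, hF, h1, h2⟩ := exists_coe_evalAt_ne_of_isOpen hO hpO
  set u : Fin 3 → K := fun i => C.cd p (i, s i + 1) with hu
  let v : Fin 3 → Polynomial K := fun i => Polynomial.C (u i) + Polynomial.X
  let Y : Fin 3 × ZMod 2 → Polynomial K := fun k =>
    if k.2 = s k.1 then Polynomial.C δ * Polynomial.X * ![v 1 * v 2, v 0 * v 2, v 0 * v 1] k.1
    else v k.1
  have hY1 : ∀ i, Y (i, s i) =
      Polynomial.C δ * Polynomial.X * ![v 1 * v 2, v 0 * v 2, v 0 * v 1] i := by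
    intro i; simp [Y]
  have hY2 : ∀ i, Y (i, s i + 1) = v i := by intro i; simp [Y]
  have hYp : ∀ i, Y (i, s i) * Y (i, s i + 1) =
      Polynomial.C δ * Polynomial.X * (v 0 * v 1 * v 2) := by
    intro i
    rw [hY1, hY2]
    fin_cases i <;> simp <;> ring
  have hYp' : ∀ i, Y (i, 0) * Y (i, 1) = Polynomial.C δ * Polynomial.X * (v 0 * v 1 * v 2) := by
    intro i
    have h := hYp i
    rcases ZMod.two_cases (s i) with h1 | h1 <;> rw [h1] at h
    · simpa using h
    · rw [show (1 : ZMod 2) + 1 = 0 by decide, mul_comm] at h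
      exact h
  obtain ⟨g, hg⟩ := C.exists_poly_along_curve Y F
  have hg0 : g.eval 0 ≠ 0 := by
    rw [hg]
    have : (fun k => (Y k).eval 0) = C.L (Projectivization.rep p.1) := by
      ext k
      refine forall_index (P := fun k => (Y k).eval 0 = C.L (Projectivization.rep p.1) k) s
        (fun i => ?_) (fun i => ?_) k
      · rw [hY1]
        simpa [plane] using (show 0 = C.L _ _ from (hp i).symm)
      · rw [hY2]
        simp [v, hu, cd]
    rw [this, LinearEquiv.symm_apply_apply]
    exact h1
  have hne : g * (Polynomial.X * (v 0 * v 1 * v 2)) ≠ 0 := by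
    have hv : ∀ i, v i ≠ 0 := fun i => by
      have : v i = Polynomial.X + Polynomial.C (u i) := add_comm _ _
      rw [this]
      exact Polynomial.X_add_C_ne_zero _
    have : g ≠ 0 := fun h => hg0 (by simp [h])
    simp [this, hv, Polynomial.X_ne_zero]
  obtain ⟨t, ht⟩ : ∃ t, (g * (Polynomial.X * (v 0 * v 1 * v 2))).eval t ≠ 0 := by
    by_contra! h
    exact hne (Polynomial.funext (by simpa using h))
  simp only [Polynomial.eval_mul, Polynomial.eval_X, ne_eq, mul_eq_zero, not_or] at ht
  obtain ⟨ht1, ht2, ⟨ht3, ht4⟩, ht5⟩ := ht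
  have hv : ∀ i, (v i).eval t ≠ 0 := by
    intro i; fin_cases i <;> assumption
  let y : Fin 3 × ZMod 2 → K := fun k => (Y k).eval t
  have hy2 : ∀ i, y (i, s i + 1) = (v i).eval t := fun i => by simp only [y, hY2]
  have hy0 : y ≠ 0 := fun h => hv 0 (by rw [← hy2, h]; rfl)
  have hyp : ∀ i, y (i, 0) * y (i, 1) = y (0, 0) * y (0, 1) := by
    intro i
    simp only [y, ← Polynomial.eval_mul, hYp']
  obtain ⟨a, ha, hcd⟩ := C.exists_cd_pt y hy0 hyp
  refine ⟨C.pt y hy0 hyp, h2 _ ?_, fun i => ?_, a * t * (v 1).eval t * (v 2).eval t, ?_, ?_⟩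
  · rw [ne_eq, C.evalAt_pt _ _ _ hF, ← hg]
    exact ht1
  · rw [hcd, hy2]
    exact mul_ne_zero ha (hv i)
  · exact mul_ne_zero (mul_ne_zero (mul_ne_zero ha ht2) (hv 1)) (hv 2)
  · rw [hcd]
    simp only [y, hY1]
    simp
    ring

theorem exists_mem_T {O : Set X} (hO : IsOpen O) (hne : O.Nonempty) : (O ∩ C.T).Nonempty := by
  obtain ⟨p, hp⟩ := hne
  by_cases hT : p ∈ C.T
  · exact ⟨p, hp, hT⟩
  obtain ⟨s, hs⟩ := C.exists_mem_plane hT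
  obtain ⟨q, hq, hqs, r, hr, h⟩ := C.exists_near_plane s hO hp hs 1
  refine ⟨q, hq, (C.mem_T_iff s hqs).2 (div_ne_zero ?_ (hqs 0))⟩
  rw [h, mul_one]
  exact hr

theorem exists_mem_plane_inter_U (s : Cube) {O : Set X} (hO : IsOpen O) {p : X} (hpO : p ∈ O)
    (hp : p ∈ C.plane s) : ∃ q ∈ O, q ∈ C.U s ∧ q ∈ C.plane s := by
  obtain ⟨q, hq, hqs, r, -, h⟩ := C.exists_near_plane s hO hpO hp 0
  exact ⟨q, hq, hqs, (C.mem_plane_iff s hqs).2 (by simp [c, h])⟩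

theorem exists_eval_ne (s : Cube) {P : MvPolynomial (Fin 3) K} (hP : P ≠ 0) :
    ∃ p ∈ C.T, eval (C.c s p) P ≠ 0 := by
  have h : P * (.X 0 * .X 1 * .X 2) ≠ 0 := by simp [hP]
  obtain ⟨a, ha⟩ : ∃ a, eval a (P * (.X 0 * .X 1 * .X 2)) ≠ 0 := by
    by_contra! h'
    exact h (MvPolynomial.funext (by simpa using h'))
  simp only [map_mul, eval_X, ne_eq, mul_eq_zero, not_or] at ha
  obtain ⟨h1, ⟨h2, h3⟩, h4⟩ := ha
  obtain ⟨p, hp, rfl⟩ := C.exists_point s a h3 h4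
  exact ⟨p, (C.mem_T_iff s hp).2 h2, h1⟩

include C in
-- Every nonempty open set meets the torus, hence one chart, where it contains the nonvanishing
-- locus of a nonzero polynomial; the product of two such polynomials is nonzero.
theorem irreducibleSpace : IrreducibleSpace X where
  isPreirreducible_univ := by
    rintro O O' hO hO' ⟨p, -, hp⟩ ⟨p', -, hp'⟩
    obtain ⟨q, hq, hqT⟩ := C.exists_mem_T hO ⟨p, hp⟩
    obtain ⟨q', hq', hqT'⟩ := C.exists_mem_T hO' ⟨p', hp'⟩
    obtain ⟨P, hP, h1⟩ := C.exists_eval_ne_of_isOpen 0 hO hq (C.T_subset_U 0 hqT)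
    obtain ⟨Q, hQ, h2⟩ := C.exists_eval_ne_of_isOpen 0 hO' hq' (C.T_subset_U 0 hqT')
    have h0 : P * Q ≠ 0 := mul_ne_zero (fun h => hP (by simp [h])) (fun h => hQ (by simp [h]))
    obtain ⟨r, hr, h3⟩ := C.exists_eval_ne 0 h0
    rw [map_mul] at h3
    have hr' := C.T_subset_U 0 hr
    exact ⟨r, trivial, h1 r hr' (left_ne_zero_of_mul h3), h2 r hr' (right_ne_zero_of_mul h3)⟩
  toNonempty := by
    obtain ⟨p, -⟩ := C.exists_point 0 (fun _ => (1 : K)) one_ne_zero one_ne_zero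
    exact ⟨p⟩

include C in
theorem dense_of_isOpen {O : Set X} (hO : IsOpen O) (hne : O.Nonempty) : Dense O := by
  have := C.irreducibleSpace
  exact hO.dense hne

/-! ### Rational functions in a chart -/

/-- The rational function defined by a polynomial in the affine coordinates. -/
def ev (s : Cube) : MvPolynomial (Fin 3) K →+* GenericGerm X where
  toFun P := ((fun p => eval (C.c s p) P : X → K) : GenericGerm X)
  map_one' := by simp only [map_one]; rfl
  map_zero' := by simp only [map_zero]; rfl
  map_mul' P Q := by simp only [map_mul]; rfl
  map_add' P Q := by simp only [map_add]; rfl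

theorem ev_apply (s : Cube) (P : MvPolynomial (Fin 3) K) :
    C.ev s P = ((fun p => eval (C.c s p) P : X → K) : GenericGerm X) := rfl

/-- The locus in a chart where a polynomial does not vanish. -/
def basic (s : Cube) (P : MvPolynomial (Fin 3) K) : Set X := {p | p ∈ C.U s ∧ eval (C.c s p) P ≠ 0}

theorem dense_basic (s : Cube) {P : MvPolynomial (Fin 3) K} (hP : P ≠ 0) :
    Dense (C.basic s P) := by
  obtain ⟨p, hp, h⟩ := C.exists_eval_ne s hP
  exact C.dense_of_isOpen (C.isOpen_eval_ne s P) ⟨p, C.T_subset_U s hp, h⟩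

theorem ev_mul_inv (s : Cube) {P : MvPolynomial (Fin 3) K} (hP : P ≠ 0) :
    C.ev s P * ((fun p => 1 / eval (C.c s p) P : X → K) : GenericGerm X) = 1 :=
  germ_eq_iff.2 ⟨C.basic s P, C.isOpen_eval_ne s P, C.dense_basic s hP, fun x hx => by
    simp [mul_inv_cancel₀ hx.2]⟩

theorem isUnit_ev (s : Cube) {P : MvPolynomial (Fin 3) K} (hP : P ≠ 0) : IsUnit (C.ev s P) :=
  .of_mul_eq_one _ (C.ev_mul_inv s hP)

theorem ev_ne_zero (s : Cube) {P : MvPolynomial (Fin 3) K} (hP : P ≠ 0) : C.ev s P ≠ 0 := by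
  intro h
  obtain ⟨O, hO, hOd, h'⟩ := germ_eq_iff.1 (show ((fun p => eval (C.c s p) P : X → K) :
    GenericGerm X) = ((0 : X → K) : GenericGerm X) from h)
  have := C.irreducibleSpace
  obtain ⟨x, hx, hx'⟩ := hOd.inter_open_nonempty _ (C.isOpen_eval_ne s P) (C.dense_basic s hP).nonempty
  exact hx.2 (h' x hx')

theorem ev_injective (s : Cube) : Function.Injective (C.ev s) := by
  rw [injective_iff_map_eq_zero]
  intro P h
  by_contra h0
  exact C.ev_ne_zero s h0 h

theorem germ_mul_ev (s : Cube) {f : X → K} {P Q : MvPolynomial (Fin 3) K} (hQ : Q ≠ 0)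
    (h : ∀ x ∈ C.U s, eval (C.c s x) Q ≠ 0 → f x * eval (C.c s x) Q = eval (C.c s x) P) :
    (f : GenericGerm X) * C.ev s Q = C.ev s P :=
  germ_eq_iff.2 ⟨C.basic s Q, C.isOpen_eval_ne s Q, C.dense_basic s hQ, fun x hx => h x hx.1 hx.2⟩

theorem eq_germ_div (s : Cube) {γ : GenericGerm X} {P Q : MvPolynomial (Fin 3) K} (hQ : Q ≠ 0)
    (h : γ * C.ev s Q = C.ev s P) :
    γ = ((fun p => eval (C.c s p) P / eval (C.c s p) Q : X → K) : GenericGerm X) := by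
  refine (C.isUnit_ev s hQ).mul_right_cancel (h.trans (C.germ_mul_ev s hQ fun x _ hx => ?_).symm)
  field_simp

/-- In each chart the function field is the field of fractions of K[x, y, z]. -/
theorem mem_functionField_iff (s : Cube) {γ : GenericGerm X} : γ ∈ functionField X ↔
    ∃ P Q : MvPolynomial (Fin 3) K, Q ≠ 0 ∧ γ * C.ev s Q = C.ev s P := by
  constructor
  · rintro ⟨f, O, hO, hOd, hf, rfl⟩
    have := C.irreducibleSpace
    obtain ⟨p, hp, hpT⟩ := C.exists_mem_T hO hOd.nonempty
    obtain ⟨P, Q, hQ, h⟩ := C.exists_eval_div s (hf p hp) (C.T_subset_U s hpT)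
    have hQ0 : Q ≠ 0 := fun h => hQ (by simp [h])
    exact ⟨P, Q, hQ0, C.germ_mul_ev s hQ0 h⟩
  · rintro ⟨P, Q, hQ, h⟩
    exact ⟨_, C.basic s Q, C.isOpen_eval_ne s Q, C.dense_basic s hQ,
      fun p hp => C.isRegularAt_eval_div s P Q hp.1 hp.2, C.eq_germ_div s hQ h⟩

theorem ev_mem_functionField (s : Cube) (P : MvPolynomial (Fin 3) K) :
    C.ev s P ∈ functionField X :=
  (C.mem_functionField_iff s).2 ⟨P, 1, one_ne_zero, by simp⟩

/-! ### Ideals of closed subsets -/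

/-- The ideal of a subset of `X` in a chart. -/
def I (s : Cube) (Z : Set X) : Ideal (MvPolynomial (Fin 3) K) where
  carrier := {P | ∀ p ∈ Z, p ∈ C.U s → eval (C.c s p) P = 0}
  zero_mem' := fun p _ _ => by simp
  add_mem' := fun ha hb p hp hps => by simp [ha p hp hps, hb p hp hps]
  smul_mem' := fun r P hP p hp hps => by simp [hP p hp hps]

theorem mem_I {s : Cube} {Z : Set X} {P : MvPolynomial (Fin 3) K} :
    P ∈ C.I s Z ↔ ∀ p ∈ Z, p ∈ C.U s → eval (C.c s p) P = 0 := Iff.rfl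

theorem I_anti (s : Cube) {Z W : Set X} (h : Z ⊆ W) : C.I s W ≤ C.I s Z :=
  fun _ hP p hp => hP p (h hp)

theorem I_isPrime (s : Cube) {Z : Set X} (hZ : IsIrreducible Z) (hne : (Z ∩ C.U s).Nonempty) :
    (C.I s Z).IsPrime := by
  refine ⟨fun h => ?_, fun {P Q} h => ?_⟩
  · obtain ⟨p, hp, hps⟩ := hne
    have : (1 : MvPolynomial (Fin 3) K) ∈ C.I s Z := by rw [h]; trivial
    simpa using this p hp hps
  · by_contra! h'
    simp only [mem_I, not_forall] at h'
    obtain ⟨⟨p, hp, hps, h1⟩, q, hq, hqs, h2⟩ := h'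
    obtain ⟨r, hr, hr1, hr2⟩ := hZ.2 _ _ (C.isOpen_eval_ne s P) (C.isOpen_eval_ne s Q)
      ⟨p, hp, hps, h1⟩ ⟨q, hq, hqs, h2⟩
    have := h r hr hr1.1
    rw [map_mul] at this
    exact (mul_ne_zero hr1.2 hr2.2) this

/-- If Z were not contained in W, irreducibility would give a point of Z in the chart and off W. A
basic neighbourhood of it off W is defined by a polynomial which vanishes on W but not on Z. -/
theorem subset_of_I_le (s : Cube) {Z W : Set X} (hZ : IsIrreducible Z)
    (hne : (Z ∩ C.U s).Nonempty) (hW : IsClosed W) (h : C.I s W ≤ C.I s Z) : Z ⊆ W := by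
  intro p hp
  by_contra hpW
  obtain ⟨q, hq, hqW, hqs⟩ := hZ.2 _ _ hW.isOpen_compl (C.isOpen_U s) ⟨p, hp, hpW⟩ hne
  obtain ⟨P, hP, h'⟩ := C.exists_eval_ne_of_isOpen s hW.isOpen_compl hqW hqs
  refine hP (h (fun x hx hxs => ?_) q hq hqs)
  by_contra h0
  exact h' x hxs h0 hx

theorem I_univ (s : Cube) : C.I s Set.univ = ⊥ := by
  rw [eq_bot_iff]
  intro P hP
  by_contra h0
  obtain ⟨p, hp, h⟩ := C.exists_eval_ne s (show P ≠ 0 from h0)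
  exact h (hP p trivial (C.T_subset_U s hp))

/-! ### Prime divisors -/

/-- The equation of the complement of a chart in affine space. -/
def yz : MvPolynomial (Fin 3) K := .X 1 * .X 2

theorem yz_ne_zero : (yz : MvPolynomial (Fin 3) K) ≠ 0 := by simp [yz]

theorem eval_yz_ne_zero (s : Cube) {p : X} (hp : p ∈ C.U s) : eval (C.c s p) yz ≠ 0 := by
  simp [yz, C.c_one_ne s hp, C.c_two_ne s hp]

/-- The zero locus of the irreducible polynomial `q` meets the chart. -/
def MeetsChart (q : MvPolynomial (Fin 3) K) : Prop := ¬ q ∣ yz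

/-- The closure in `X` of the zero locus of a polynomial in a chart. -/
def zeros (s : Cube) (q : MvPolynomial (Fin 3) K) : Set X :=
  closure {p | p ∈ C.U s ∧ eval (C.c s p) q = 0}

theorem mem_I_zeros_iff (s : Cube) {q P : MvPolynomial (Fin 3) K} :
    P ∈ C.I s (C.zeros s q) ↔ ∀ p ∈ C.U s, eval (C.c s p) q = 0 → eval (C.c s p) P = 0 := by
  constructor
  · intro h p hp hq
    exact h p (subset_closure ⟨hp, hq⟩) hp
  · intro h p hp hps
    by_contra h0
    obtain ⟨x, hx, hx'⟩ := mem_closure_iff.1 hp _ (C.isOpen_eval_ne s P) ⟨hps, h0⟩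
    exact hx.2 (h x hx'.1 hx'.2)

theorem I_zeros (s : Cube) {q : MvPolynomial (Fin 3) K} (hq : Irreducible q)
    (hq' : MeetsChart q) : C.I s (C.zeros s q) = Ideal.span {q} := by
  have hp := hq.prime
  have : (Ideal.span {q}).IsPrime := (Ideal.span_singleton_prime hp.ne_zero).2 hp
  ext P
  rw [mem_I_zeros_iff, Ideal.mem_span_singleton]
  constructor
  · intro h
    -- The chart sees only the zeros of q with yz ≠ 0. The factor `yz` makes the product vanish at
    -- all zeros of q in affine space, so that the Nullstellensatz applies; the prime q does not
    -- divide `yz` and can be cancelled from it.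
    have h1 : P * yz ∈ vanishingIdeal K (zeroLocus K (Ideal.span {q})) := by
      rw [mem_vanishingIdeal_iff]
      intro a ha
      rw [mem_zeroLocus_iff] at ha
      have ha' : eval a q = 0 := by
        simpa [aeval_eq_eval] using ha q (Ideal.mem_span_singleton_self q)
      simp only [map_mul, aeval_X, yz]
      by_cases h1 : a 1 = 0
      · simp [h1]
      by_cases h2 : a 2 = 0
      · simp [h2]
      obtain ⟨p, hp, rfl⟩ := C.exists_point s a h1 h2
      have := h p hp ha'
      simp [aeval_eq_eval, this]
    rw [IsPrime.vanishingIdeal_zeroLocus, Ideal.mem_span_singleton] at h1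
    exact (hp.dvd_or_dvd h1).resolve_right hq'
  · rintro ⟨Q, rfl⟩ p hp h
    rw [map_mul, h, zero_mul]

theorem isIrreducible_zeros (s : Cube) {q : MvPolynomial (Fin 3) K} (hq : Irreducible q)
    (hq' : MeetsChart q) : IsIrreducible (C.zeros s q) := by
  have hp := hq.prime
  have hI := C.I_zeros s hq hq'
  have hmem : ∀ P, ¬ q ∣ P → ∃ p ∈ C.U s, eval (C.c s p) q = 0 ∧ eval (C.c s p) P ≠ 0 := by
    intro P hP
    rw [← Ideal.mem_span_singleton, ← hI, mem_I_zeros_iff] at hP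
    push Not at hP
    exact hP
  have hmem' : ∀ {P p}, p ∈ C.U s → eval (C.c s p) q = 0 → eval (C.c s p) P ≠ 0 → ¬ q ∣ P := by
    rintro P p - h1 h2 ⟨Q, rfl⟩
    exact h2 (by rw [map_mul, h1, zero_mul])
  refine IsIrreducible.closure ⟨?_, ?_⟩
  · obtain ⟨p, hp, h, -⟩ := hmem 1 (fun h => hp.not_isUnit (isUnit_of_dvd_one h))
    exact ⟨p, hp, h⟩
  · rintro O O' hO hO' ⟨p, ⟨hps, hpq⟩, hpO⟩ ⟨p', ⟨hps', hpq'⟩, hpO'⟩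
    obtain ⟨P, hP, h1⟩ := C.exists_eval_ne_of_isOpen s hO hpO hps
    obtain ⟨Q, hQ, h2⟩ := C.exists_eval_ne_of_isOpen s hO' hpO' hps'
    obtain ⟨r, hr, hr1, hr2⟩ := hmem (P * Q)
      (hp.not_dvd_mul (hmem' hps hpq hP) (hmem' hps' hpq' hQ))
    rw [map_mul] at hr2
    exact ⟨r, ⟨hr, hr1⟩, h1 r hr (left_ne_zero_of_mul hr2), h2 r hr (right_ne_zero_of_mul hr2)⟩

theorem zeros_inter_U (s : Cube) {q : MvPolynomial (Fin 3) K} (hq : Irreducible q)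
    (hq' : MeetsChart q) : (C.zeros s q ∩ C.U s).Nonempty := by
  have hI := C.I_zeros s hq hq'
  by_contra h
  have h1 : (1 : MvPolynomial (Fin 3) K) ∈ C.I s (C.zeros s q) :=
    fun p hp hps => (h ⟨p, hp, hps⟩).elim
  rw [hI, Ideal.mem_span_singleton] at h1
  exact hq.not_isUnit (isUnit_of_dvd_one h1)

theorem zeros_ne_univ (s : Cube) {q : MvPolynomial (Fin 3) K} (hq : Irreducible q)
    (hq' : MeetsChart q) : C.zeros s q ≠ Set.univ := by
  intro h
  have hI := C.I_zeros s hq hq'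
  rw [h, I_univ] at hI
  exact hq.ne_zero (Ideal.span_singleton_eq_bot.1 hI.symm)

/-- The prime ideal of W is contained in (q). If it is nonzero it contains a prime element, which is
a multiple of q and therefore associated to q. -/
theorem eq_univ_or_subset_zeros (s : Cube) {q : MvPolynomial (Fin 3) K} (hq : Irreducible q)
    (hq' : MeetsChart q) {W : Set X} (hW : IsIrreducible W) (hWc : IsClosed W)
    (hle : C.zeros s q ⊆ W) : W = Set.univ ∨ W ⊆ C.zeros s q := by
  have := C.irreducibleSpace
  have hI := C.I_zeros s hq hq'
  have hWne : (W ∩ C.U s).Nonempty :=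
    (C.zeros_inter_U s hq hq').mono (Set.inter_subset_inter_left _ hle)
  have hP := C.I_isPrime s hW hWne
  by_cases h0 : C.I s W = ⊥
  · refine Or.inl (Set.univ_subset_iff.1 (C.subset_of_I_le s
      (IrreducibleSpace.isIrreducible_univ X) ?_ hWc (by rw [h0]; exact bot_le)))
    exact hWne.mono (Set.inter_subset_inter_left _ (Set.subset_univ _))
  · obtain ⟨r, hr, hr'⟩ := hP.exists_mem_prime_of_ne_bot h0
    have hrq := C.I_anti s hle hr
    rw [hI, Ideal.mem_span_singleton] at hrq
    have hass := hq.associated_of_dvd hr'.irreducible hrq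
    refine Or.inr (C.subset_of_I_le s hW hWne isClosed_closure ?_)
    rw [hI, Ideal.span_singleton_le_iff_mem]
    exact (C.I s W).mem_of_dvd hass.symm.dvd hr

theorem coheight_eq_one_of_coe_eq_zeros (s : Cube) {q : MvPolynomial (Fin 3) K}
    (hq : Irreducible q) (hq' : MeetsChart q) (Z : IrreducibleCloseds X)
    (hZ : (Z : Set X) = C.zeros s q) : Order.coheight Z = 1 := by
  have := C.irreducibleSpace
  rw [coheight_eq_one_iff, hZ]
  refine ⟨C.zeros_ne_univ s hq hq', fun W hW => ?_⟩
  have hle : (Z : Set X) ⊆ W := hW.le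
  refine (C.eq_univ_or_subset_zeros s hq hq' W.isIrreducible W.isClosed (hZ ▸ hle)).resolve_right
    fun h => ?_
  rw [← hZ] at h
  exact hW.not_ge h

theorem exists_divisor (s : Cube) {q : MvPolynomial (Fin 3) K} (hq : Irreducible q)
    (hq' : MeetsChart q) : ∃ Z : PrimeDivisor X, (Z.1 : Set X) = C.zeros s q :=
  ⟨⟨⟨C.zeros s q, C.isIrreducible_zeros s hq hq', isClosed_closure⟩,
    C.coheight_eq_one_of_coe_eq_zeros s hq hq' _ rfl⟩, rfl⟩

/-- The prime divisor defined by an irreducible polynomial in a chart. -/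
def divisor (s : Cube) {q : MvPolynomial (Fin 3) K} (hq : Irreducible q)
    (hq' : MeetsChart q) : PrimeDivisor X :=
  (C.exists_divisor s hq hq').choose

theorem coe_divisor (s : Cube) {q : MvPolynomial (Fin 3) K} (hq : Irreducible q)
    (hq' : MeetsChart q) : ((C.divisor s hq hq').1 : Set X) = C.zeros s q :=
  (C.exists_divisor s hq hq').choose_spec

theorem I_divisor (s : Cube) {q : MvPolynomial (Fin 3) K} (hq : Irreducible q)
    (hq' : MeetsChart q) : C.I s (C.divisor s hq hq').1 = Ideal.span {q} := by
  rw [coe_divisor, I_zeros C s hq hq']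

theorem divisor_inter_U (s : Cube) {q : MvPolynomial (Fin 3) K} (hq : Irreducible q)
    (hq' : MeetsChart q) : (((C.divisor s hq hq').1 : Set X) ∩ C.U s).Nonempty := by
  rw [coe_divisor]
  exact C.zeros_inter_U s hq hq'

include C in
theorem primeDivisor_ne_univ (Z : PrimeDivisor X) : (Z.1 : Set X) ≠ Set.univ := by
  have := C.irreducibleSpace
  exact ((coheight_eq_one_iff Z.1).1 Z.2).1

include C in
theorem primeDivisor_eq_of_subset {Z W : PrimeDivisor X} (h : (Z.1 : Set X) ⊆ W.1) : Z = W := by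
  have := C.irreducibleSpace
  by_contra hne
  refine C.primeDivisor_ne_univ W (((coheight_eq_one_iff Z.1).1 Z.2).2 W.1 (lt_of_le_of_ne h ?_))
  exact fun h => hne (Subtype.ext h)

/-- A prime divisor which meets a chart is given by an irreducible polynomial there. -/
theorem exists_I_eq (s : Cube) (Z : PrimeDivisor X) (hZ : ((Z.1 : Set X) ∩ C.U s).Nonempty) :
    ∃ q : MvPolynomial (Fin 3) K, Irreducible q ∧ C.I s Z.1 = Ideal.span {q} := by
  have hP := C.I_isPrime s Z.1.isIrreducible hZ
  have := C.irreducibleSpace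
  have h0 : C.I s Z.1 ≠ ⊥ := by
    intro h0
    refine C.primeDivisor_ne_univ Z (Set.univ_subset_iff.1 (C.subset_of_I_le s
      (IrreducibleSpace.isIrreducible_univ X) ?_ Z.1.isClosed (by rw [h0]; exact bot_le)))
    exact hZ.mono (Set.inter_subset_inter_left _ (Set.subset_univ _))
  obtain ⟨q, hq, hqp⟩ := hP.exists_mem_prime_of_ne_bot h0
  have hq' : MeetsChart q := by
    intro h
    obtain ⟨p, hp, hps⟩ := hZ
    exact C.eval_yz_ne_zero s hps ((C.I s Z.1).mem_of_dvd h hq p hp hps)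
  refine ⟨q, hqp.irreducible, ?_⟩
  have : Z = C.divisor s hqp.irreducible hq' := by
    refine C.primeDivisor_eq_of_subset (C.subset_of_I_le s Z.1.isIrreducible hZ
      (C.divisor s hqp.irreducible hq').1.isClosed ?_)
    rw [I_divisor, Ideal.span_singleton_le_iff_mem]
    exact hq
  rw [this, I_divisor]

theorem irreducible_X_zero : Irreducible (MvPolynomial.X 0 : MvPolynomial (Fin 3) K) := X_prime.irreducible

theorem meetsChart_X_zero : MeetsChart (MvPolynomial.X 0 : MvPolynomial (Fin 3) K) := by
  refine (X_prime (R := K)).not_dvd_mul ?_ ?_ <;> simp [X_dvd_X]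

theorem zeros_X_zero (s : Cube) : C.zeros s (.X 0) = C.plane s := by
  apply Set.Subset.antisymm
  · refine closure_minimal ?_ (C.isClosed_plane s)
    rintro p ⟨hp, h⟩
    exact (C.mem_plane_iff s hp).2 (by simpa using h)
  · intro p hp
    rw [zeros, mem_closure_iff]
    intro O hO hpO
    obtain ⟨q, hq, hqs, hqp⟩ := C.exists_mem_plane_inter_U s hO hpO hp
    exact ⟨q, hq, hqs, by simpa using (C.mem_plane_iff s hqs).1 hqp⟩

/-- The planes as prime divisors. -/
def D (s : Cube) : PrimeDivisor X := C.divisor s irreducible_X_zero meetsChart_X_zero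

theorem coe_D (s : Cube) : ((C.D s).1 : Set X) = C.plane s :=
  (C.coe_divisor s _ _).trans (C.zeros_X_zero s)

theorem I_D (s : Cube) : C.I s (C.D s).1 = Ideal.span {.X 0} :=
  C.I_divisor s irreducible_X_zero meetsChart_X_zero

theorem D_inter_U (s : Cube) : (((C.D s).1 : Set X) ∩ C.U s).Nonempty :=
  C.divisor_inter_U s irreducible_X_zero meetsChart_X_zero

theorem D_inter_U_eq (s t : Cube) (h : (((C.D s).1 : Set X) ∩ C.U t).Nonempty) : s = t := by
  obtain ⟨p, hp, hpt⟩ := h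
  rw [coe_D] at hp
  by_contra hne
  obtain ⟨i, hi⟩ := Function.ne_iff.1 hne
  exact hpt i (by rw [← ZMod.ne_iff_eq_add_one.1 hi]; exact hp i)

theorem D_injective : Function.Injective C.D := fun s t h =>
  C.D_inter_U_eq s t (h ▸ C.D_inter_U t)

theorem D_inter_T (s : Cube) : ((C.D s).1 : Set X) ∩ C.T = ∅ := by
  ext p
  simp only [coe_D, Set.mem_inter_iff, Set.mem_empty_iff_false, iff_false, not_and]
  exact fun h h' => h' _ (h 0)

/-- Off the torus X is a finite union of planes, and an irreducible closed set inside such a union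
lies in one of them. -/
theorem exists_eq_D {Z : PrimeDivisor X} (hZ : (Z.1 : Set X) ∩ C.T = ∅) : ∃ s, Z = C.D s := by
  have h : (Z.1 : Set X) ⊆ ⋃₀ (Set.range C.plane) := by
    intro p hp
    obtain ⟨s, hs⟩ := C.exists_mem_plane (p := p) fun hT => by
      have : p ∈ (Z.1 : Set X) ∩ C.T := ⟨hp, hT⟩
      simp [hZ] at this
    exact ⟨_, ⟨s, rfl⟩, hs⟩
  obtain ⟨W, hW, hs⟩ := isIrreducible_iff_sUnion_isClosed.1 Z.1.isIrreducible
    (Set.finite_range C.plane).toFinset (by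
      simp only [Set.Finite.mem_toFinset]
      rintro _ ⟨s, rfl⟩
      exact C.isClosed_plane s) (by simpa using h)
  obtain ⟨s, rfl⟩ := (Set.Finite.mem_toFinset _).1 hW
  exact ⟨s, C.primeDivisor_eq_of_subset (by rwa [coe_D])⟩

/-- The charts do not cover X, but no prime divisor avoids all of them, so every order can be
computed with polynomials. -/
theorem exists_inter_U (Z : PrimeDivisor X) : ∃ s, ((Z.1 : Set X) ∩ C.U s).Nonempty := by
  by_cases h : ((Z.1 : Set X) ∩ C.T).Nonempty
  · exact ⟨0, h.mono (Set.inter_subset_inter_right _ (C.T_subset_U 0))⟩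
  · obtain ⟨s, rfl⟩ := C.exists_eq_D (Set.not_nonempty_iff_eq_empty.1 h)
    exact ⟨s, C.D_inter_U s⟩

/-! ### Orders of rational functions -/

/-- The local ring along Z is the localisation of K[x, y, z] at the prime ideal of Z. -/
theorem mem_localRing_iff (s : Cube) (Z : IrreducibleCloseds X)
    (hZ : ((Z : Set X) ∩ C.U s).Nonempty) {γ : GenericGerm X} : γ ∈ localRing Z ↔
    ∃ P Q : MvPolynomial (Fin 3) K, Q ∉ C.I s Z ∧ γ * C.ev s Q = C.ev s P := by
  constructor
  · rintro ⟨f, O, hO, hOZ, hf, rfl⟩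
    obtain ⟨p, hp, hpO, hps⟩ := Z.isIrreducible.2 _ _ hO (C.isOpen_U s) hOZ hZ
    obtain ⟨P, Q, hQ, h⟩ := C.exists_eval_div s (hf p hpO) hps
    exact ⟨P, Q, fun h => hQ (h p hp hps), C.germ_mul_ev s (fun h => hQ (by simp [h])) h⟩
  · rintro ⟨P, Q, hQ, h⟩
    have hQ0 : Q ≠ 0 := fun h => hQ (h ▸ zero_mem _)
    simp only [mem_I, not_forall] at hQ
    obtain ⟨p, hp, hps, hpQ⟩ := hQ
    exact ⟨_, C.basic s Q, C.isOpen_eval_ne s Q, ⟨p, hp, hps, hpQ⟩,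
      fun p hp => C.isRegularAt_eval_div s P Q hp.1 hp.2, C.eq_germ_div s hQ0 h⟩

theorem ev_mem_localRing (s : Cube) (Z : IrreducibleCloseds X)
    (hZ : ((Z : Set X) ∩ C.U s).Nonempty) (P : MvPolynomial (Fin 3) K) :
    C.ev s P ∈ localRing Z :=
  (C.mem_localRing_iff s Z hZ).2 ⟨P, 1, fun h => by
    obtain ⟨p, hp, hps⟩ := hZ
    simpa using h p hp hps, by simp⟩

section Order

variable (s : Cube) (Z : PrimeDivisor X) (hZ : ((Z.1 : Set X) ∩ C.U s).Nonempty)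
  {q : MvPolynomial (Fin 3) K} (hI : C.I s Z.1 = Ideal.span {q})

include hZ in
theorem exists_inv_mem_localRing {P : MvPolynomial (Fin 3) K} (hP : P ∉ C.I s Z.1) :
    ∃ γ ∈ localRing Z.1, C.ev s P * γ = 1 := by
  have hP0 : P ≠ 0 := fun h => hP (h ▸ zero_mem _)
  refine ⟨_, ?_, C.ev_mul_inv s hP0⟩
  refine (C.mem_localRing_iff s Z.1 hZ).2 ⟨1, P, hP, ?_⟩
  rw [mul_comm, C.ev_mul_inv s hP0, map_one]

include hZ in
theorem hasOrd_ev_zero {P : MvPolynomial (Fin 3) K} (hP : P ∉ C.I s Z.1) :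
    HasOrd Z (C.ev s P) 0 := by
  obtain ⟨γ, hγ, h⟩ := C.exists_inv_mem_localRing s Z hZ hP
  exact HasOrd.zero_of_mul_eq_one (C.ev_mem_localRing s Z.1 hZ P) hγ h

include hZ hI in
-- A fraction in the local ring is invertible unless q divides its numerator. So q generates a
-- maximal ideal, and the quotient by it is a field, of length one.
theorem hasOrd_ev_one (hq : q ≠ 0) : HasOrd Z (C.ev s q) 1 := by
  let a : localRing Z.1 := ⟨C.ev s q, C.ev_mem_localRing s Z.1 hZ q⟩
  have ha : a ∈ nonZeroDivisors (localRing Z.1) := by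
    rw [mem_nonZeroDivisors_iff_right]
    intro x hx
    apply Subtype.ext
    exact (C.isUnit_ev s hq).mul_right_cancel ((congrArg Subtype.val hx).trans (zero_mul _).symm)
  refine ⟨a, 1, 1, 0, ha, one_mem _, by simp [a], ?_, by simp, by simp⟩
  have hmax : (Ideal.span {a}).IsMaximal := by
    rw [Ideal.isMaximal_iff]
    constructor
    · rw [Ideal.mem_span_singleton]
      rintro ⟨⟨γ, hγ⟩, h⟩
      have h1 : (1 : GenericGerm X) = C.ev s q * γ := congrArg Subtype.val h
      obtain ⟨P, Q, hQ, h2⟩ := (C.mem_localRing_iff s Z.1 hZ).1 hγ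
      apply hQ
      have : C.ev s Q = C.ev s (q * P) := by
        rw [map_mul, ← h2, ← mul_assoc, ← h1, one_mul]
      rw [hI, C.ev_injective s this]
      exact Ideal.mul_mem_right _ _ (Ideal.mem_span_singleton_self q)
    · rintro J ⟨γ, hγ⟩ hJ hx hxJ
      obtain ⟨P, Q, hQ, h2⟩ := (C.mem_localRing_iff s Z.1 hZ).1 hγ
      obtain ⟨δ, hδ, hδ'⟩ := C.exists_inv_mem_localRing s Z hZ hQ
      by_cases hP : P ∈ C.I s Z.1
      · exfalso
        apply hx
        rw [hI, Ideal.mem_span_singleton] at hP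
        obtain ⟨P', rfl⟩ := hP
        rw [Ideal.mem_span_singleton]
        refine ⟨⟨C.ev s P', C.ev_mem_localRing s Z.1 hZ P'⟩ * ⟨δ, hδ⟩, Subtype.ext ?_⟩
        change γ = C.ev s q * (C.ev s P' * δ)
        rw [← mul_assoc, ← map_mul, ← h2, mul_assoc, hδ', mul_one]
      · obtain ⟨ε, hε, hε'⟩ := C.exists_inv_mem_localRing s Z hZ hP
        have : (1 : localRing Z.1) = ⟨γ, hγ⟩ *
            (⟨C.ev s Q, C.ev_mem_localRing s Z.1 hZ Q⟩ * ⟨ε, hε⟩) := by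
          apply Subtype.ext
          change 1 = γ * (C.ev s Q * ε)
          rw [← mul_assoc, h2, hε']
        rw [this]
        exact J.mul_mem_right _ hxJ
  rw [Ring.ord, Nat.cast_one, Module.length_eq_one_iff,
    isSimpleModule_iff_isSimpleModule_of_algebraMap_surjective
      (S := localRing Z.1 ⧸ Ideal.span {a}) Ideal.Quotient.mk_surjective]
  let := Ideal.Quotient.field (Ideal.span {a})
  exact instIsSimpleModule _

include hZ hI in
theorem hasOrd_ev (hq : Irreducible q) {P : MvPolynomial (Fin 3) K} {k : ℕ} (hP : ¬ q ∣ P) :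
    HasOrd Z (C.ev s (q ^ k * P)) k := by
  rw [map_mul, map_pow]
  have h1 := (C.hasOrd_ev_one s Z hZ hI hq.ne_zero).pow k
  have h2 : HasOrd Z (C.ev s P) 0 :=
    C.hasOrd_ev_zero s Z hZ (by rwa [hI, Ideal.mem_span_singleton])
  simpa using h1.mul h2

include hZ hI in
theorem exists_hasOrd_ev (hq : Irreducible q) {P : MvPolynomial (Fin 3) K} (hP : P ≠ 0) :
    ∃ k : ℕ, HasOrd Z (C.ev s P) k ∧ (q ∣ P → 0 < k) := by
  obtain ⟨k, P', hP', rfl⟩ : ∃ k P', ¬ q ∣ P' ∧ P = q ^ k * P' := by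
    obtain ⟨P', h, h'⟩ :=
      (FiniteMultiplicity.of_prime_left hq.prime hP).exists_eq_pow_mul_and_not_dvd
    exact ⟨_, P', h', h⟩
  refine ⟨k, C.hasOrd_ev s Z hZ hI hq hP', fun h => Nat.pos_of_ne_zero ?_⟩
  rintro rfl
  exact hP' (by simpa using h)

end Order

theorem exists_quotient (s : Cube) (f : (functionField X)ˣ) :
    ∃ P Q : MvPolynomial (Fin 3) K, P ≠ 0 ∧ Q ≠ 0 ∧ IsRelPrime P Q ∧
      (f : functionField X).1 * C.ev s Q = C.ev s P := by
  obtain ⟨P, Q, hQ, h⟩ := (C.mem_functionField_iff s).1 (f : functionField X).2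
  have hfu : IsUnit (f : functionField X).1 := f.isUnit.map (functionField X).subtype
  have hP : P ≠ 0 := by
    rintro rfl
    rw [map_zero] at h
    have := C.ev_ne_zero s hQ
    exact this (hfu.mul_left_cancel (h.trans (mul_zero _).symm))
  obtain ⟨P', Q', R, hrel, rfl, rfl⟩ := UniqueFactorizationMonoid.exists_reduced_factors P hP Q
  refine ⟨P', Q', right_ne_zero_of_mul hP, right_ne_zero_of_mul hQ, hrel,
    (C.isUnit_ev s (left_ne_zero_of_mul hP)).mul_left_cancel ?_⟩
  rw [← map_mul, ← h, map_mul]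
  ring

theorem hasOrd_quotient (s : Cube) {Z : PrimeDivisor X} {f : (functionField X)ˣ}
    {P Q : MvPolynomial (Fin 3) K} (hQ : Q ≠ 0)
    (h : (f : functionField X).1 * C.ev s Q = C.ev s P) {k l : ℤ} (h1 : HasOrd Z (C.ev s P) k)
    (h2 : HasOrd Z (C.ev s Q) l) : HasOrd Z (f : functionField X).1 (k - l) := by
  have h3 := h1.mul (h2.inv (g := _) ((mul_comm _ _).trans (C.ev_mul_inv s hQ)))
  rw [← h, mul_assoc, C.ev_mul_inv s hQ, mul_one] at h3
  exact h3

include C in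
theorem exists_hasOrd (f : (functionField X)ˣ) (Z : PrimeDivisor X) :
    ∃ m, HasOrd Z (f : functionField X).1 m := by
  obtain ⟨s, hs⟩ := C.exists_inter_U Z
  obtain ⟨q, hq, hI⟩ := C.exists_I_eq s Z hs
  obtain ⟨P, Q, hP, hQ, -, h⟩ := C.exists_quotient s f
  obtain ⟨k, hk, -⟩ := C.exists_hasOrd_ev s Z hs hI hq hP
  obtain ⟨l, hl, -⟩ := C.exists_hasOrd_ev s Z hs hI hq hQ
  exact ⟨_, C.hasOrd_quotient s hQ h hk hl⟩

/-- A rational function whose poles in a chart lie on `R = 0` becomes regular after multiplication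
by a power of `R`. -/
theorem exists_mul_pow_eq (s : Cube) (f : (functionField X)ˣ) (R : MvPolynomial (Fin 3) K)
    (hR : ∀ q, ¬ q ∣ R → MeetsChart q)
    (h : ∀ Z : PrimeDivisor X, ((Z.1 : Set X) ∩ C.U s).Nonempty → R ∉ C.I s Z.1 →
      ∃ m, 0 ≤ m ∧ HasOrd Z (f : functionField X).1 m) :
    ∃ (N : ℕ) (P : MvPolynomial (Fin 3) K),
      (f : functionField X).1 * C.ev s R ^ N = C.ev s P := by
  obtain ⟨P, Q, hP, hQ, hrel, hf⟩ := C.exists_quotient s f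
  -- A prime factor of the denominator which does not divide `R` defines a divisor meeting the
  -- chart. In a reduced fraction it does not divide the numerator, so f would have negative order
  -- there.
  have hdvd : ∀ q, Prime q → q ∣ Q → q ∣ R := by
    intro q hq hqQ
    by_contra hqR
    have hq' : MeetsChart q := hR q hqR
    have hI := C.I_divisor s hq.irreducible hq'
    have hZ := C.divisor_inter_U s hq.irreducible hq'
    obtain ⟨m, hm, hm'⟩ := h (C.divisor s hq.irreducible hq') hZ (by
      rw [hI, Ideal.mem_span_singleton]
      exact hqR)
    obtain ⟨l, hl, hl'⟩ := C.exists_hasOrd_ev s _ hZ hI hq.irreducible hQ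
    have hqP : ¬ q ∣ P := fun h => hq.not_isUnit (hrel h hqQ)
    have hk := C.hasOrd_ev s (C.divisor s hq.irreducible hq') hZ hI hq.irreducible (k := 0) hqP
    rw [pow_zero, one_mul] at hk
    have := (C.hasOrd_quotient s hQ hf hk hl).unique hm'
    have := hl' hqQ
    omega
  have hpow : ∃ N, Q ∣ R ^ N := by
    clear hf hrel
    induction Q using UniqueFactorizationMonoid.induction_on_prime with
    | h₁ => exact (hQ rfl).elim
    | h₂ u hu => exact ⟨0, hu.dvd⟩
    | h₃ a p ha hp ih =>
      obtain ⟨N, hN⟩ := ih ha fun q hq h => hdvd q hq (h.mul_left p)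
      exact ⟨N + 1, by rw [pow_succ']; exact mul_dvd_mul (hdvd p hp (dvd_mul_right _ _)) hN⟩
  obtain ⟨N, Q', hN⟩ := hpow
  refine ⟨N, P * Q', ?_⟩
  rw [← map_pow, hN, map_mul, map_mul, ← mul_assoc, hf]

end ToricCoords

end ProjVar
end

open Filter
noncomputable section
set_option linter.unusedSectionVars false
namespace ProjVar
open MvPolynomial TopologicalSpace

/-! ### Linear automorphisms -/

section Linear

variable {K : Type*} [Field K] {n : ℕ}

/-- The action of a linear automorphism on projective space. -/
def moveBy (N : (Fin (n + 1) → K) ≃ₗ[K] (Fin (n + 1) → K)) (p : ProjSpace K n) : ProjSpace K n :=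
  Projectivization.mk K (N (Projectivization.rep p))
    (by simpa using Projectivization.rep_nonzero p)

theorem exists_rep_moveBy (N : (Fin (n + 1) → K) ≃ₗ[K] (Fin (n + 1) → K)) (p : ProjSpace K n) :
    ∃ a : K, a ≠ 0 ∧ Projectivization.rep (moveBy N p) = a • N (Projectivization.rep p) := by
  obtain ⟨a, ha⟩ := Projectivization.exists_smul_eq_mk_rep K (N (Projectivization.rep p))
    (by simpa using Projectivization.rep_nonzero p)
  exact ⟨a, a.ne_zero, ha.symm⟩

theorem projSpace_ext {p q : ProjSpace K n} {a : K}
    (h : Projectivization.rep p = a • Projectivization.rep q) : p = q := by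
  have e1 := Projectivization.mk_rep (p : Projectivization K (Fin (n + 1) → K))
  have e2 := Projectivization.mk_rep (q : Projectivization K (Fin (n + 1) → K))
  rw [← e1, ← e2]
  exact (Projectivization.mk_eq_mk_iff' K _ _ _ _).2 ⟨a, h.symm⟩

theorem moveBy_one (p : ProjSpace K n) : moveBy 1 p = p := by
  obtain ⟨a, -, h⟩ := exists_rep_moveBy 1 p
  exact projSpace_ext h

theorem moveBy_mul (N M : (Fin (n + 1) → K) ≃ₗ[K] (Fin (n + 1) → K)) (p : ProjSpace K n) :
    moveBy (N * M) p = moveBy N (moveBy M p) := by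
  obtain ⟨a, -, h⟩ := exists_rep_moveBy (N * M) p
  obtain ⟨b, hb0, hb⟩ := exists_rep_moveBy N (moveBy M p)
  obtain ⟨c, hc0, hc⟩ := exists_rep_moveBy M p
  refine projSpace_ext (a := a * b⁻¹ * c⁻¹) ?_
  rw [h, hb, hc, map_smul, smul_smul, smul_smul, LinearEquiv.mul_apply]
  congr 1
  field_simp

/-- Linear substitution in a polynomial. -/
def linSubst (N : (Fin (n + 1) → K) ≃ₗ[K] (Fin (n + 1) → K))
    (F : MvPolynomial (Fin (n + 1)) K) : MvPolynomial (Fin (n + 1)) K :=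
  aeval (fun j => ∑ i, MvPolynomial.C (N (Pi.single i 1) j) * MvPolynomial.X i) F

theorem linSubst_isHomogeneous (N : (Fin (n + 1) → K) ≃ₗ[K] (Fin (n + 1) → K))
    {F : MvPolynomial (Fin (n + 1)) K} {d : ℕ} (hF : F.IsHomogeneous d) :
    (linSubst N F).IsHomogeneous d := by
  have := hF.aeval (S := K) (n := 1) (fun j => ∑ i, MvPolynomial.C (N (Pi.single i 1) j) *
    (MvPolynomial.X i : MvPolynomial (Fin (n + 1)) K)) (fun j => ?_)
  · simpa [linSubst] using this
  · refine IsHomogeneous.sum _ _ _ fun i _ => ?_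
    simpa using (isHomogeneous_C (Fin (n + 1)) (N (Pi.single i 1) j)).mul (isHomogeneous_X K i)

theorem eval_linSubst (N : (Fin (n + 1) → K) ≃ₗ[K] (Fin (n + 1) → K))
    (F : MvPolynomial (Fin (n + 1)) K) (v : Fin (n + 1) → K) :
    eval v (linSubst N F) = eval (N v) F := by
  have h : N v = fun j => eval v
      (∑ i, MvPolynomial.C (N (Pi.single i 1) j) * MvPolynomial.X i) := by
    have h1 : v = ∑ i, v i • (Pi.single i 1 : Fin (n + 1) → K) := by
      ext i
      simp [Finset.sum_apply, Pi.single_apply]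
    conv_lhs => rw [h1]
    ext j
    simp [map_sum, mul_comm]
  rw [h]
  induction F using MvPolynomial.induction_on with
  | C r => simp [linSubst]
  | add F G hF hG => simp only [linSubst, map_add] at *; rw [hF, hG]
  | mul_X F i hF => simp only [linSubst, map_mul] at *; rw [hF]; simp

theorem exists_evalAt_moveBy (N : (Fin (n + 1) → K) ≃ₗ[K] (Fin (n + 1) → K)) (p : ProjSpace K n) :
    ∃ a : K, a ≠ 0 ∧ ∀ (d : ℕ) (F : MvPolynomial (Fin (n + 1)) K), F.IsHomogeneous d →
      evalAt (moveBy N p) F = a ^ d * evalAt p (linSubst N F) := by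
  obtain ⟨a, ha, h⟩ := exists_rep_moveBy N p
  refine ⟨a, ha, fun d F hF => ?_⟩
  rw [evalAt, h, eval_smul_of_isHomogeneous hF, evalAt, eval_linSubst]

/-- The linear automorphisms which preserve `X`. -/
def linStab (X : Set (ProjSpace K n)) : Subgroup ((Fin (n + 1) → K) ≃ₗ[K] (Fin (n + 1) → K)) where
  carrier := {N | ∀ p, moveBy N p ∈ X ↔ p ∈ X}
  one_mem' := fun p => by rw [moveBy_one]
  mul_mem' := fun {N M} hN hM p => by rw [moveBy_mul, hN, hM]
  inv_mem' := fun {N} hN p => by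
    rw [← hN, ← moveBy_mul, mul_inv_cancel, moveBy_one]

variable {X : Set (ProjSpace K n)}

theorem continuous_moveBy (N : linStab X) :
    Continuous fun p : X => (⟨moveBy N.1 p.1, (N.2 p.1).2 p.2⟩ : X) := by
  refine continuous_induced_rng.2 (continuous_generateFrom_iff.2 ?_)
  rintro _ ⟨d, F, hF, rfl⟩
  have : ((Subtype.val ∘ fun p : X => (⟨moveBy N.1 p.1, (N.2 p.1).2 p.2⟩ : X)) ⁻¹'
      {p | evalAt p F ≠ 0}) = {p : X | evalAt p.1 (linSubst N.1 F) ≠ 0} := by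
    ext p
    obtain ⟨a, ha, h⟩ := exists_evalAt_moveBy N.1 p.1
    simp [h d F hF, ha]
  rw [this]
  exact isOpen_coe_evalAt_ne X (linSubst_isHomogeneous N.1 hF)

/-- The homeomorphism defined by a linear automorphism. -/
def linHomeo : linStab X →* (X ≃ₜ X) where
  toFun N :=
    { toFun := fun p => ⟨moveBy N.1 p.1, (N.2 p.1).2 p.2⟩
      invFun := fun p => ⟨moveBy (N⁻¹).1 p.1, ((N⁻¹).2 p.1).2 p.2⟩
      left_inv := fun p => Subtype.ext (by
        change moveBy _ (moveBy _ _) = _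
        rw [← moveBy_mul, ← Subgroup.coe_mul, inv_mul_cancel, Subgroup.coe_one, moveBy_one])
      right_inv := fun p => Subtype.ext (by
        change moveBy _ (moveBy _ _) = _
        rw [← moveBy_mul, ← Subgroup.coe_mul, mul_inv_cancel, Subgroup.coe_one, moveBy_one])
      continuous_toFun := continuous_moveBy N
      continuous_invFun := continuous_moveBy N⁻¹ }
  map_one' := Homeomorph.ext fun p => Subtype.ext (moveBy_one p.1)
  map_mul' N M := Homeomorph.ext fun p => Subtype.ext (moveBy_mul N.1 M.1 p.1)

theorem isRegularAt_comp_linHomeo (N : linStab X) {f : X → K} {p : X}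
    (h : IsRegularAt f (linHomeo N p)) : IsRegularAt (f ∘ linHomeo N) p := by
  obtain ⟨U, hU, hp, d, F, G, hF, hG, h⟩ := h
  refine ⟨linHomeo N ⁻¹' U, hU.preimage (linHomeo N).continuous, hp, d, linSubst N.1 F,
    linSubst N.1 G, linSubst_isHomogeneous N.1 hF, linSubst_isHomogeneous N.1 hG, fun x hx => ?_⟩
  obtain ⟨h1, h2⟩ := h _ hx
  obtain ⟨a, ha, h3⟩ := exists_evalAt_moveBy N.1 x.1
  have e : (linHomeo N x).1 = moveBy N.1 x.1 := rfl
  rw [e, h3 d G hG] at h1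
  rw [e, h3 d G hG, h3 d F hF, mul_div_mul_left _ _ (pow_ne_zero _ ha)] at h2
  exact ⟨right_ne_zero_of_mul h1, h2⟩

/-- The regular automorphism defined by a linear automorphism. -/
def linAut : linStab X →* RegAut X :=
  linHomeo.codRestrict (RegAut X) fun N f p => by
    constructor
    · intro h
      have h1 := isRegularAt_comp_linHomeo N⁻¹ (f := f ∘ linHomeo N) (p := linHomeo N p) (by
        rw [map_inv]
        exact (((linHomeo N).symm_apply_apply p).symm ▸ h))
      have h2 : (f ∘ linHomeo N) ∘ linHomeo N⁻¹ = f := by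
        ext x
        change f (linHomeo N (linHomeo N⁻¹ x)) = f x
        rw [map_inv]
        exact congrArg f ((linHomeo N).apply_symm_apply x)
      rwa [h2] at h1
    · exact isRegularAt_comp_linHomeo N

end Linear

theorem mulAutArrow_apply_apply (π : Equiv.Perm (Fin 3)) (a : Fin 3 → Cyc 2) (i : Fin 3) :
    mulAutArrow π a i = a (π⁻¹ i) := rfl

/-- The action of `C₂³ ⋊ S₃` on the six coordinates. -/
def idx : C2CubedS3 →* Equiv.Perm (Fin 3 × ZMod 2) where
  toFun w :=
    { toFun := fun k => (w.right k.1, k.2 + (w.left (w.right k.1)).toAdd)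
      invFun := fun k => (w.right⁻¹ k.1, k.2 - (w.left k.1).toAdd)
      left_inv := fun k => by ext <;> simp
      right_inv := fun k => by ext <;> simp }
  map_one' := by ext k <;> simp
  map_mul' v w := by
    ext k
    · simp
    · simp only [SemidirectProduct.mul_left, SemidirectProduct.mul_right, Equiv.Perm.mul_apply,
        Equiv.coe_fn_mk, Pi.mul_apply, mulAutArrow_apply_apply, toAdd_mul, Equiv.Perm.inv_def, Equiv.symm_apply_apply]
      ring

theorem idx_apply (w : C2CubedS3) (i : Fin 3) (ε : ZMod 2) :
    idx w (i, ε) = (w.right i, ε + (w.left (w.right i)).toAdd) := rfl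

/-- The action of `C₂³ ⋊ S₃` on the vertices of the cube. -/
def act : C2CubedS3 →* Equiv.Perm Cube where
  toFun w :=
    { toFun := fun s i => s (w.right⁻¹ i) + (w.left i).toAdd
      invFun := fun s i => s (w.right i) - (w.left (w.right i)).toAdd
      left_inv := fun k => by ext; simp
      right_inv := fun k => by ext; simp }
  map_one' := by ext k; simp
  map_mul' v w := by
    ext s i
    simp only [SemidirectProduct.mul_left, SemidirectProduct.mul_right, Equiv.Perm.mul_apply,
      Equiv.coe_fn_mk, Pi.mul_apply, mulAutArrow_apply_apply, toAdd_mul, mul_inv_rev]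
    ring

theorem act_apply (w : C2CubedS3) (s : Cube) (i : Fin 3) :
    act w s i = s (w.right⁻¹ i) + (w.left i).toAdd := rfl

/-- The two actions are compatible: the hyperplanes cutting out the plane s go to those cutting out
the plane `act w s`. -/
theorem idx_act (w : C2CubedS3) (s : Cube) (i : Fin 3) :
    idx w (i, s i) = (w.right i, act w s (w.right i)) := by
  simp [idx_apply, act_apply]

namespace ToricCoords

variable {K : Type*} [Field K] {X : Set (ProjSpace K 5)} (C : ToricCoords X)

/-- A linear map in toric coordinates, as a linear map in the given coordinates. -/
def conj : ((Fin 3 × ZMod 2 → K) ≃ₗ[K] (Fin 3 × ZMod 2 → K)) →*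
    ((Fin (5 + 1) → K) ≃ₗ[K] (Fin (5 + 1) → K)) where
  toFun M := (C.L.trans M).trans C.L.symm
  map_one' := by ext; simp
  map_mul' M N := by ext; simp

theorem conj_apply (M : (Fin 3 × ZMod 2 → K) ≃ₗ[K] (Fin 3 × ZMod 2 → K)) (v : Fin (5 + 1) → K) :
    C.conj M v = C.L.symm (M (C.L v)) := rfl

theorem cd_of_rep {N : (Fin 3 × ZMod 2 → K) ≃ₗ[K] (Fin 3 × ZMod 2 → K)} (p : X) :
    ∃ a : K, a ≠ 0 ∧ C.L (Projectivization.rep (moveBy (C.conj N) p.1)) = a • N (C.cd p) := by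
  obtain ⟨a, ha, h⟩ := exists_rep_moveBy (C.conj N) p.1
  refine ⟨a, ha, ?_⟩
  rw [h, map_smul, conj_apply, LinearEquiv.apply_symm_apply]
  rfl

theorem conj_mem_linStab {N : (Fin 3 × ZMod 2 → K) ≃ₗ[K] (Fin 3 × ZMod 2 → K)}
    (hN : ∀ y : Fin 3 × ZMod 2 → K, (∀ i, N y (i, 0) * N y (i, 1) = N y (0, 0) * N y (0, 1)) ↔
      ∀ i, y (i, 0) * y (i, 1) = y (0, 0) * y (0, 1)) : C.conj N ∈ linStab X := by
  intro p
  rw [C.mem_iff, C.mem_iff]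
  obtain ⟨a, ha, h⟩ := exists_rep_moveBy (C.conj N) p
  have h' : C.L (Projectivization.rep (moveBy (C.conj N) p)) =
      a • N (C.L (Projectivization.rep p)) := by
    rw [h, map_smul, conj_apply, LinearEquiv.apply_symm_apply]
  have key : ∀ y z : Fin 3 × ZMod 2 → K, z = a • y →
      ((∀ i, z (i, 0) * z (i, 1) = z (0, 0) * z (0, 1)) ↔
        ∀ i, y (i, 0) * y (i, 1) = y (0, 0) * y (0, 1)) := by
    rintro y _ rfl
    refine forall_congr' fun i => ?_
    simp only [Pi.smul_apply, smul_eq_mul]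
    constructor
    · intro h
      apply mul_left_cancel₀ (mul_ne_zero ha ha)
      linear_combination h
    · intro h
      linear_combination (a * a) * h
  exact (key _ _ h').trans (hN _)

/-- Permutation of the coordinates by `C₂³ ⋊ S₃`. -/
def permLin (K : Type*) [Field K] :
    C2CubedS3 →* ((Fin 3 × ZMod 2 → K) ≃ₗ[K] (Fin 3 × ZMod 2 → K)) where
  toFun w := LinearEquiv.funCongrLeft K K (idx w)⁻¹
  map_one' := by
    ext y k
    simp [LinearEquiv.funCongrLeft_apply, LinearMap.funLeft_apply]
  map_mul' v w := by
    ext y k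
    simp [LinearEquiv.funCongrLeft_apply, LinearMap.funLeft_apply]

theorem permLin_apply (w : C2CubedS3) (y : Fin 3 × ZMod 2 → K) (k : Fin 3 × ZMod 2) :
    permLin K w y (idx w k) = y k := by
  simp [permLin, LinearEquiv.funCongrLeft_apply, LinearMap.funLeft_apply]

theorem rel_permLin (w : C2CubedS3) {y : Fin 3 × ZMod 2 → K}
    (h : ∀ i, y (i, 0) * y (i, 1) = y (0, 0) * y (0, 1)) (i : Fin 3) :
    permLin K w y (i, 0) * permLin K w y (i, 1) = y (0, 0) * y (0, 1) := by
  obtain ⟨i, rfl⟩ := w.right.surjective i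
  rw [← h i]
  have h0 := permLin_apply w y (i, 0)
  have h1 := permLin_apply w y (i, 1)
  rw [idx_apply] at h0 h1
  rcases ZMod.two_cases (w.left (w.right i)).toAdd with e | e <;> rw [e] at h0 h1
  · rw [add_zero] at h0 h1
    rw [h0, h1]
  · rw [show (1 : ZMod 2) + 1 = 0 by decide] at h1
    rw [zero_add] at h0
    rw [h0, h1, mul_comm]

theorem rel_permLin_iff (w : C2CubedS3) (y : Fin 3 × ZMod 2 → K) :
    (∀ i, permLin K w y (i, 0) * permLin K w y (i, 1) =
      permLin K w y (0, 0) * permLin K w y (0, 1)) ↔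
      ∀ i, y (i, 0) * y (i, 1) = y (0, 0) * y (0, 1) := by
  constructor
  · intro h i
    have e : permLin K w⁻¹ (permLin K w y) = y := by
      rw [← LinearEquiv.mul_apply, ← map_mul, inv_mul_cancel, map_one]
      rfl
    have h1 := rel_permLin w⁻¹ h i
    have h2 := rel_permLin w⁻¹ h 0
    rw [e] at h1 h2
    rw [h1, h2]
  · intro h i
    rw [rel_permLin w h i, rel_permLin w h 0]

/-- The automorphisms of `X` which permute the coordinates. -/
def permAut : C2CubedS3 →* RegAut X :=
  linAut.comp ((C.conj.comp (permLin K)).codRestrict (linStab X)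
    fun w => C.conj_mem_linStab (rel_permLin_iff w))

theorem exists_cd_permAut (w : C2CubedS3) (p : X) :
    ∃ a : K, a ≠ 0 ∧ ∀ k, C.cd ((C.permAut w).1 p) (idx w k) = a * C.cd p k := by
  obtain ⟨a, ha, h⟩ := C.cd_of_rep (N := permLin K w) p
  refine ⟨a, ha, fun k => ?_⟩
  have : C.cd ((C.permAut w).1 p) =
    C.L (Projectivization.rep (moveBy (C.conj (permLin K w)) p.1)) := rfl
  rw [this, h, Pi.smul_apply, permLin_apply, smul_eq_mul]

/-- Multiplication of the coordinates by scalars. -/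
def torusLin (t : Fin 3 × ZMod 2 → Kˣ) : (Fin 3 × ZMod 2 → K) ≃ₗ[K] (Fin 3 × ZMod 2 → K) :=
  LinearEquiv.piCongrRight fun k => LinearEquiv.smulOfUnit (t k)

theorem torusLin_apply (t : Fin 3 × ZMod 2 → Kˣ) (y : Fin 3 × ZMod 2 → K) (k : Fin 3 × ZMod 2) :
    torusLin t y k = t k * y k := rfl

/-- These are the automorphisms coming from the torus. They preserve each plane and carry any point
with nonzero coordinates to any other such point. -/
theorem exists_torusAut (t : Fin 3 × ZMod 2 → Kˣ)
    (ht : ∀ i, t (i, 0) * t (i, 1) = t (0, 0) * t (0, 1)) :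
    ∃ g : RegAut X, ∀ p, ∃ a : K, a ≠ 0 ∧ ∀ k, C.cd (g.1 p) k = a * (t k * C.cd p k) := by
  have hmem : C.conj (torusLin t) ∈ linStab X := by
    refine C.conj_mem_linStab fun y => forall_congr' fun i => ?_
    have e : ∀ i, ((t (i, 0) : K) * t (i, 1)) = t (0, 0) * t (0, 1) := fun i => by
      exact_mod_cast congrArg Units.val (ht i)
    simp only [torusLin_apply]
    constructor
    · intro h
      have h0 : ((t (0, 0) : K) * t (0, 1)) ≠ 0 := by simp
      apply mul_left_cancel₀ h0
      linear_combination h - y (i, 0) * y (i, 1) * e i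
    · intro h
      linear_combination ((t (0, 0) : K) * t (0, 1)) * h + y (i, 0) * y (i, 1) * e i
  refine ⟨linAut ⟨_, hmem⟩, fun p => ?_⟩
  obtain ⟨a, ha, h⟩ := C.cd_of_rep (N := torusLin t) p
  refine ⟨a, ha, fun k => ?_⟩
  have : C.cd ((linAut ⟨_, hmem⟩ : RegAut X).1 p) =
    C.L (Projectivization.rep (moveBy (C.conj (torusLin t)) p.1)) := rfl
  rw [this, h]
  rfl

end ToricCoords

end ProjVar
end

/-! ### Rational functions with poles along a single plane -/

open Filter
noncomputable section
set_option linter.unusedSectionVars false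
namespace ProjVar
open MvPolynomial TopologicalSpace

/-- A polynomial in x which is also a polynomial in x⁻¹ is constant: multiplied by a power of X
equal to the degree of `B`, `A` becomes the reverse of `B`, whose degree is no larger than that
power. -/
theorem eval_eq_eval_of_eval_inv {K : Type*} [Field K] [Infinite K] {A B : Polynomial K}
    (h : ∀ x : K, x ≠ 0 → A.eval x = B.eval x⁻¹) (x y : K) : A.eval x = A.eval y := by
  have h1 : A * Polynomial.X ^ B.natDegree = B.reverse := by
    apply Polynomial.eq_of_infinite_eval_eq
    refine Set.Infinite.mono (s := {0}ᶜ) ?_ (Set.finite_singleton _).infinite_compl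
    intro x hx
    have hx0 : x ≠ 0 := hx
    let := invertibleOfNonzero (inv_ne_zero hx0)
    have h2 := Polynomial.eval₂_reverse_mul_pow (RingHom.id K) x⁻¹ B
    simp only [invOf_eq_inv, inv_inv, Polynomial.eval₂_id] at h2
    change Polynomial.eval x _ = Polynomial.eval x _
    rw [Polynomial.eval_mul, Polynomial.eval_pow, Polynomial.eval_X, h x hx0, ← h2, mul_assoc,
      ← mul_pow, inv_mul_cancel₀ hx0, one_pow, mul_one]
  have h2 : A.natDegree = 0 := by
    by_cases hA : A = 0
    · simp [hA]
    have := congrArg Polynomial.natDegree h1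
    rw [Polynomial.natDegree_mul_X_pow _ hA] at this
    have := Polynomial.reverse_natDegree_le B
    omega
  rw [Polynomial.eq_C_of_natDegree_eq_zero h2]
  simp

namespace ToricCoords

variable {K : Type*} [Field K] {X : Set (ProjSpace K 5)} (C : ToricCoords X) [IsAlgClosed K]

/-- Rational functions with numerator `P` and denominator a power of `yz` in a chart. -/
def chartFun (s : Cube) (N : ℕ) (P : MvPolynomial (Fin 3) K) (p : X) : K :=
  eval (C.c s p) P / eval (C.c s p) (yz ^ N)

theorem chartFun_isRegularOn (s : Cube) (N : ℕ) (P : MvPolynomial (Fin 3) K) :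
    IsRegularOn (C.chartFun s N P) (C.U s) := fun p hp =>
  C.isRegularAt_eval_div s _ _ hp (by
    rw [map_pow]
    exact pow_ne_zero _ (C.eval_yz_ne_zero s hp))

/-- The chart of s ≠ t does not meet the plane t, so f has no poles there; a function without poles
on 𝔸¹ × 𝔾ₘ² is a polynomial divided by a power of yz. -/
theorem exists_chartFun (s t : Cube) (hst : s ≠ t) (f : (functionField X)ˣ)
    (h : ∀ Z : PrimeDivisor X, Z ≠ C.D t → ∃ m, 0 ≤ m ∧ HasOrd Z (f : functionField X).1 m) :
    ∃ (N : ℕ) (P : MvPolynomial (Fin 3) K),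
      (f : functionField X).1 = ((C.chartFun s N P : X → K) : GenericGerm X) := by
  have h' : ∀ Z : PrimeDivisor X, ((Z.1 : Set X) ∩ C.U s).Nonempty → Z ≠ C.D t := by
    intro Z hZ hZt
    rw [hZt] at hZ
    exact hst (C.D_inter_U_eq t s hZ).symm
  obtain ⟨N, P, hP⟩ := C.exists_mul_pow_eq s f yz (fun _ h => h)
    fun Z hZ _ => h Z (h' Z hZ)
  rw [← map_pow] at hP
  exact ⟨N, P, C.eq_germ_div s (pow_ne_zero N yz_ne_zero) hP⟩

/-- Opposite vertices define inverse coordinates. -/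
theorem c_add_one (s : Cube) {p : X} (hp : p ∈ C.T) (i : Fin 3) :
    C.c (s + 1) p i = (C.c s p i)⁻¹ := by
  have e1 := C.prod_eq p 1 0 (s 1) (s 0)
  have e2 := C.prod_eq p 2 0 (s 2) (s 0)
  have h := hp
  have h0 := hp (0, s 0)
  have h1 := hp (0, s 0 + 1)
  have h2 := hp (1, s 1 + 1)
  have h3 := hp (2, s 2 + 1)
  have hs : ∀ j, (s + 1) j = s j + 1 := fun j => rfl
  fin_cases i <;> simp [c, hs, ZMod.add_one_add_one]
  · field_simp
    linear_combination e1
  · field_simp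
    linear_combination e2

/-- A function which is regular on two opposite charts only depends on the last two coordinates. -/
theorem chartFun_eq_of_opposite {s : Cube} {N N' : ℕ} {P P' : MvPolynomial (Fin 3) K}
    (h : ∀ p ∈ C.T, C.chartFun s N P p = C.chartFun (s + 1) N' P' p) {p q : X} (hp : p ∈ C.T)
    (hq : q ∈ C.T) (h1 : C.c s p 1 = C.c s q 1) (h2 : C.c s p 2 = C.c s q 2) :
    C.chartFun s N P p = C.chartFun s N P q := by
  set y := C.c s p 1 with hy
  set z := C.c s p 2 with hz
  have hy0 : y ≠ 0 := C.c_one_ne s (C.T_subset_U s hp)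
  have hz0 : z ≠ 0 := C.c_two_ne s (C.T_subset_U s hp)
  -- `A` is the restriction of the function to the line with the last two coordinates fixed, written
  -- in the chart s. `B` is the same restriction in the opposite chart, where the three coordinates
  -- are inverted.
  let A : Polynomial K := Polynomial.C (((y * z) ^ N)⁻¹) *
    aeval ![Polynomial.X, Polynomial.C y, Polynomial.C z] P
  let B : Polynomial K := Polynomial.C (((y⁻¹ * z⁻¹) ^ N')⁻¹) *
    aeval ![Polynomial.X, Polynomial.C y⁻¹, Polynomial.C z⁻¹] P'
  have haux : ∀ (Q : MvPolynomial (Fin 3) K) (x b c : K),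
      (aeval ![Polynomial.X, Polynomial.C b, Polynomial.C c] Q : Polynomial K).eval x =
        eval ![x, b, c] Q := by
    intro Q x b c
    induction Q using MvPolynomial.induction_on with
    | C r => simp
    | add F G hF hG => simp only [map_add, Polynomial.eval_add, hF, hG]
    | mul_X F i hF =>
      rw [map_mul, Polynomial.eval_mul, hF, map_mul]
      fin_cases i <;> simp
  have hA : ∀ r ∈ C.T, C.c s r 1 = y → C.c s r 2 = z →
      C.chartFun s N P r = A.eval (C.c s r 0) := by
    intro r hr hr1 hr2
    have hv : C.c s r = ![C.c s r 0, y, z] := by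
      ext i; fin_cases i <;> simp [hr1, hr2]
    rw [chartFun, Polynomial.eval_mul, haux, ← hv, Polynomial.eval_C]
    simp [yz, hr1, hr2, div_eq_inv_mul]
  have hB : ∀ r ∈ C.T, C.c s r 1 = y → C.c s r 2 = z →
      C.chartFun (s + 1) N' P' r = B.eval (C.c s r 0)⁻¹ := by
    intro r hr hr1 hr2
    have hv : C.c (s + 1) r = ![(C.c s r 0)⁻¹, y⁻¹, z⁻¹] := by
      ext i; rw [C.c_add_one s hr]; fin_cases i <;> simp [hr1, hr2]
    rw [chartFun, Polynomial.eval_mul, haux, ← hv, Polynomial.eval_C]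
    simp [yz, hv, div_eq_inv_mul]
  rw [hA p hp rfl rfl, hA q hq h1.symm h2.symm]
  refine eval_eq_eval_of_eval_inv (B := B) (fun x hx => ?_) _ _
  obtain ⟨r, hr, hrc⟩ := C.exists_point s ![x, y, z] hy0 hz0
  have hrT : r ∈ C.T := (C.mem_T_iff s hr).2 (by simpa [hrc] using hx)
  have e0 : C.c s r 0 = x := by simp [hrc]
  rw [← e0, ← hA r hrT (by simp [hrc]) (by simp [hrc]), ← hB r hrT (by simp [hrc]) (by simp [hrc])]
  exact h r hrT

/-- The weights of the one-parameter subgroup which corresponds to the neighbour of `t` in the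
`j`-th direction. -/
def weight (t : Cube) (j : Fin 3) (a : Kˣ) (k : Fin 3 × ZMod 2) : Kˣ :=
  if (k.2 = t k.1 + 1 ↔ k.1 = j) then a else 1

theorem weight_mul (t : Cube) (j : Fin 3) (a : Kˣ) (i : Fin 3) :
    weight t j a (i, 0) * weight t j a (i, 1) = a := by
  have e : (1 : ZMod 2) + 1 = 0 := by decide
  by_cases hij : i = j
  · subst hij
    rcases ZMod.two_cases (t i) with h | h <;> simp [weight, h, e]
  · rcases ZMod.two_cases (t i) with h | h <;> simp [weight, h, hij, e]

theorem weight_same (t : Cube) (j : Fin 3) (a : Kˣ) (i : Fin 3) :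
    weight t j a (i, t i) = if i = j then 1 else a := by
  have : ¬ (t i = t i + 1) := fun h => ZMod.add_one_ne_self _ h.symm
  by_cases hij : i = j <;> simp [weight, hij]

theorem weight_opp (t : Cube) (j : Fin 3) (a : Kˣ) (i : Fin 3) :
    weight t j a (i, t i + 1) = if i = j then a else 1 := by
  by_cases hij : i = j <;> simp [weight, hij]

/-- A rational function with poles only along one of the planes is constant. -/
theorem eq_const_of_hasOrd (t : Cube) (f : (functionField X)ˣ)
    (h : ∀ Z : PrimeDivisor X, Z ≠ C.D t → ∃ m, 0 ≤ m ∧ HasOrd Z (f : functionField X).1 m) :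
    ∃ c : K, c ≠ 0 ∧ (f : functionField X).1 = ((fun _ => c : X → K) : GenericGerm X) := by
  have hex := fun (s : {s : Cube // s ≠ t}) => C.exists_chartFun s.1 t s.2 f h
  choose N P hf using hex
  have hagree : ∀ s s' : {s : Cube // s ≠ t}, ∀ p ∈ C.T,
      C.chartFun s.1 (N s) (P s) p = C.chartFun s'.1 (N s') (P s') p := by
    intro s s'
    refine IsRegularOn.eq_of_germ_eq (U := C.T)
      (fun p hp => C.chartFun_isRegularOn _ _ _ p (C.T_subset_U _ hp))
      (fun p hp => C.chartFun_isRegularOn _ _ _ p (C.T_subset_U _ hp)) ?_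
    rw [← hf s, ← hf s']
  -- Of the four antipodal pairs of vertices three do not contain t, and `nb 0`, `nb 1`, `nb 2`
  -- represent them. On each such pair of charts f is regular.
  let nb : Fin 3 → Cube := fun j i => if i = j then t i + 1 else t i
  have hnb : ∀ j, nb j ≠ t := fun j h => ZMod.add_one_ne_self (t j) (by
    simpa [nb] using congrFun h j)
  have hnb' : ∀ j, nb j + 1 ≠ t := fun j h => by
    obtain ⟨i, hi⟩ : ∃ i : Fin 3, i ≠ j := exists_ne j
    exact ZMod.add_one_ne_self (t i) (by simpa [nb, hi] using congrFun h i)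
  let s0 : {s : Cube // s ≠ t} := ⟨nb 0, hnb 0⟩
  let g : X → K := C.chartFun s0.1 (N s0) (P s0)
  -- The weight for j is trivial on the coordinates opposite to `nb j`, so this one-parameter group
  -- fixes the last two affine coordinates of that chart, and `chartFun_eq_of_opposite` shows that f
  -- is invariant.
  have hstep : ∀ (j : Fin 3) (a : Kˣ), ∀ p ∈ C.T, ∃ q ∈ C.T, g p = g q ∧
      ∃ r : K, r ≠ 0 ∧ ∀ k, C.cd q k = r * (weight t j a k * C.cd p k) := by
    intro j a p hp
    obtain ⟨φ, hφ⟩ := C.exists_torusAut (weight t j a) (fun i => by rw [weight_mul, weight_mul])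
    obtain ⟨r, hr, hcd⟩ := hφ p
    have hq : φ.1 p ∈ C.T := fun k => by
      rw [hcd]
      exact mul_ne_zero hr (mul_ne_zero (Units.ne_zero _) (hp k))
    refine ⟨φ.1 p, hq, ?_, r, hr, hcd⟩
    have e1 := fun q hq => hagree s0 ⟨nb j, hnb j⟩ q hq
    rw [show g p = _ from e1 p hp, show g _ = _ from e1 _ hq]
    have hw : ∀ i, weight t j a (i, nb j i + 1) = 1 := by
      intro i
      by_cases hij : i = j
      · subst hij
        simp [nb, ZMod.add_one_add_one, weight_same]
      · simp [nb, hij, weight_opp]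
    have hcd' : ∀ i, C.cd (φ.1 p) (i, nb j i + 1) = r * C.cd p (i, nb j i + 1) := by
      intro i
      rw [hcd, hw]
      simp
    refine C.chartFun_eq_of_opposite (fun q hq => hagree ⟨nb j, hnb j⟩ ⟨_, hnb' j⟩ q hq) hp hq
      ?_ ?_
    · simp only [c, Matrix.cons_val_one, Matrix.cons_val_zero, hcd']
      rw [mul_div_mul_left _ _ hr]
    · simp only [c, Matrix.cons_val, hcd']
      rw [mul_div_mul_left _ _ hr]
  have hconst : ∀ p ∈ C.T, ∀ q ∈ C.T, g p = g q := by
    intro p hp q hq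
    have hu : ∀ i, C.cd p (i, t i + 1) ≠ 0 := fun i => hp _
    have hu' : ∀ i, C.cd q (i, t i + 1) ≠ 0 := fun i => hq _
    have hv : ∀ i, C.cd p (i, t i) ≠ 0 := fun i => hp _
    have hv' : ∀ i, C.cd q (i, t i) ≠ 0 := fun i => hq _
    let u : Fin 3 → Kˣ := fun i => Units.mk0 (C.cd q (i, t i + 1) / C.cd p (i, t i + 1))
      (div_ne_zero (hu' i) (hu i))
    let v : Fin 3 → Kˣ := fun i => Units.mk0 (C.cd q (i, t i) / C.cd p (i, t i))
      (div_ne_zero (hv' i) (hv i))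
    have huv : ∀ i, v i * u i = v 0 * u 0 := by
      intro i
      ext
      simp only [u, v, Units.val_mul, Units.val_mk0]
      rw [div_mul_div_comm, div_mul_div_comm, C.prod_eq q i 0 (t i) (t 0),
        C.prod_eq p i 0 (t i) (t 0)]
    -- The three weights with parameters μuⱼ multiply the coordinate (i, t i + 1) by μuᵢ and the
    -- coordinate (i, t i) by μ²u₀u₁u₂/uᵢ. For p to reach q the latter has to be μvᵢ. As vᵢuᵢ does
    -- not depend on i, this determines μ.
    let μ : Kˣ := v 0 * u 0 * (u 0 * u 1 * u 2)⁻¹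
    obtain ⟨p1, hp1, e1, r1, hr1, h1⟩ := hstep 0 (μ * u 0) p hp
    obtain ⟨p2, hp2, e2, r2, hr2, h2⟩ := hstep 1 (μ * u 1) p1 hp1
    obtain ⟨p3, hp3, e3, r3, hr3, h3⟩ := hstep 2 (μ * u 2) p2 hp2
    rw [e1, e2, e3]
    congr 1
    refine C.eq_of_cd (a := r3 * r2 * r1 * μ) (forall_index t (fun i => ?_) (fun i => ?_))
    · rw [h3, h2, h1]
      have hm : (weight t 2 (μ * u 2) (i, t i) * weight t 1 (μ * u 1) (i, t i) *
          weight t 0 (μ * u 0) (i, t i) : Kˣ) = μ * v i := by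
        rw [eq_mul_inv_of_mul_eq (huv i)]
        simp only [weight_same, μ]
        fin_cases i <;> simp <;> (ext; push_cast; field_simp)
      have hm' := congrArg Units.val hm
      push_cast at hm'
      have e : C.cd q (i, t i) = v i * C.cd p (i, t i) := by
        simp only [v, Units.val_mk0]
        have := hv i
        field_simp
      rw [e]
      linear_combination r3 * r2 * r1 * C.cd p (i, t i) * hm'
    · rw [h3, h2, h1]
      have hm : (weight t 2 (μ * u 2) (i, t i + 1) * weight t 1 (μ * u 1) (i, t i + 1) *
          weight t 0 (μ * u 0) (i, t i + 1) : Kˣ) = μ * u i := by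
        simp only [weight_opp]
        fin_cases i <;> simp
      have hm' := congrArg Units.val hm
      push_cast at hm'
      have e : C.cd q (i, t i + 1) = u i * C.cd p (i, t i + 1) := by
        simp only [u, Units.val_mk0]
        have := hu i
        field_simp
      rw [e]
      linear_combination r3 * r2 * r1 * C.cd p (i, t i + 1) * hm'
  have := C.irreducibleSpace
  obtain ⟨p, -, hp⟩ := C.exists_mem_T isOpen_univ Set.univ_nonempty
  have hg : (f : functionField X).1 = ((fun _ => g p : X → K) : GenericGerm X) := by
    rw [hf s0]
    exact germ_eq_iff.2 ⟨C.T, C.isOpen_T, C.dense_of_isOpen C.isOpen_T ⟨p, hp⟩,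
      fun x hx => hconst x hx p hp⟩
  refine ⟨g p, fun h0 => ?_, hg⟩
  have h1 : (f : functionField X).1 = C.ev 0 0 := by
    rw [hg, h0, map_zero]
    rfl
  have h2 := congrArg Subtype.val f.mul_inv
  have h3 : (f : functionField X).1 * ((f⁻¹ : (functionField X)ˣ) : functionField X).1 = 1 := h2
  rw [h1, map_zero, zero_mul] at h3
  exact C.ev_ne_zero 0 one_ne_zero (by rw [map_one, ← h3])

end ToricCoords

end ProjVar
end

/-! ### Divisors of monomials and generation of the class group by the planes -/

open Filter
noncomputable section
set_option linter.unusedSectionVars false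
namespace ProjVar
open MvPolynomial TopologicalSpace

/-- Whether the plane attached to a vertex lies in a coordinate hyperplane. -/
def ind (s : Cube) (k : Fin 3 × ZMod 2) : ℤ := if k.2 = s k.1 then 1 else 0

theorem ind_same (s : Cube) (i : Fin 3) : ind s (i, s i) = 1 := by simp [ind]

theorem ind_opp (s : Cube) (i : Fin 3) : ind s (i, s i + 1) = 0 := by simp [ind]

/-- The orders along the planes of a monomial in the coordinates of the chart at the origin. -/
def monoOrd (m : Fin 3 → ℤ) (s : Cube) : ℤ :=
  m 0 * (ind s (0, 0) - ind s (0, 1)) + m 1 * (ind s (1, 1) - ind s (0, 1)) +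
    m 2 * (ind s (2, 1) - ind s (0, 1))

theorem exists_dvd_pow_mul_pow_mul_pow {R : Type*} [CommRing R] [IsDomain R]
    [UniqueFactorizationMonoid R] {p q r P : R} (hp : Prime p) (hq : Prime q) (hr : Prime r) {N : ℕ}
    (h : P ∣ (p * (q * r)) ^ N) :
    ∃ (u : Rˣ) (a b c : ℕ), P = u * (p ^ a * q ^ b * r ^ c) := by
  rw [mul_pow, mul_pow] at h
  obtain ⟨P1, P2, h1, h2, rfl⟩ := exists_dvd_and_dvd_of_dvd_mul h
  obtain ⟨P3, P4, h3, h4, rfl⟩ := exists_dvd_and_dvd_of_dvd_mul h2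
  obtain ⟨a, -, ha⟩ := (dvd_prime_pow hp N).1 h1
  obtain ⟨b, -, hb⟩ := (dvd_prime_pow hq N).1 h3
  obtain ⟨c, -, hc⟩ := (dvd_prime_pow hr N).1 h4
  obtain ⟨u, hu⟩ := (ha.mul_mul (hb.mul_mul hc)).symm
  exact ⟨u, a, b, c, by rw [← hu]; ring⟩

theorem HasOrd.congr {K : Type*} [Field K] {n : ℕ} {X : Set (ProjSpace K n)} {Z : PrimeDivisor X}
    {f : GenericGerm X} {m m' : ℤ} (h : HasOrd Z f m) (e : m = m') : HasOrd Z f m' := e ▸ h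

namespace ToricCoords

variable {K : Type*} [Field K] {X : Set (ProjSpace K 5)} (C : ToricCoords X) [IsAlgClosed K]

/-- The quotient of two coordinates. -/
def ratFun (k l : Fin 3 × ZMod 2) (p : X) : K := C.cd p k / C.cd p l

theorem ratFun_isRegularOn (k l : Fin 3 × ZMod 2) :
    IsRegularOn (C.ratFun k l) {p : X | C.cd p l ≠ 0} := fun p hp => by
  have := isRegularAt_div (p := p) (C.form_isHomogeneous k) (C.form_isHomogeneous l)
    (by rwa [evalAt_form])
  simp only [evalAt_form] at this
  exact this

/-- The quotient of two coordinates as a rational function. -/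
def rat (k l : Fin 3 × ZMod 2) : GenericGerm X := (C.ratFun k l : X → K)

theorem T_nonempty : (C.T).Nonempty := by
  have := C.irreducibleSpace
  obtain ⟨p, -, hp⟩ := C.exists_mem_T isOpen_univ Set.univ_nonempty
  exact ⟨p, hp⟩

theorem dense_T : Dense C.T := C.dense_of_isOpen C.isOpen_T C.T_nonempty

theorem germ_eq_of_T {f g : X → K} (h : ∀ p ∈ C.T, f p = g p) : (f : GenericGerm X) = g :=
  germ_eq_iff.2 ⟨C.T, C.isOpen_T, C.dense_T, h⟩

theorem rat_mul_rat (k l m : Fin 3 × ZMod 2) : C.rat k l * C.rat l m = C.rat k m :=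
  C.germ_eq_of_T fun p hp => by
    have h1 := hp l
    have h2 := hp m
    simp only [ratFun]
    field_simp

theorem rat_self (k : Fin 3 × ZMod 2) : C.rat k k = 1 :=
  C.germ_eq_of_T fun p hp => by
    simp only [ratFun]
    exact div_self (hp k)

theorem rat_mem_functionField (k l : Fin 3 × ZMod 2) : C.rat k l ∈ functionField X :=
  ⟨_, _, C.isOpen_cd_ne l, C.dense_of_isOpen (C.isOpen_cd_ne l)
    (C.T_nonempty.mono (show C.T ⊆ {p | C.cd p l ≠ 0} from fun _ hp => hp l)), C.ratFun_isRegularOn k l, rfl⟩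

/-- The quotient of two coordinates as a unit of the function field. -/
def ratUnit (k l : Fin 3 × ZMod 2) : (functionField X)ˣ where
  val := ⟨C.rat k l, C.rat_mem_functionField k l⟩
  inv := ⟨C.rat l k, C.rat_mem_functionField l k⟩
  val_inv := Subtype.ext ((C.rat_mul_rat k l k).trans (C.rat_self k))
  inv_val := Subtype.ext ((C.rat_mul_rat l k l).trans (C.rat_self l))

theorem hasOrd_rat_of_inter_T {Z : PrimeDivisor X} (hZ : ((Z.1 : Set X) ∩ C.T).Nonempty)
    (k l : Fin 3 × ZMod 2) : HasOrd Z (C.rat k l) 0 :=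
  HasOrd.zero_of_regular C.isOpen_T C.dense_T hZ
    (fun p hp => C.ratFun_isRegularOn k l p (hp l)) fun _ hp => div_ne_zero (hp k) (hp l)

theorem ev_X_zero (s : Cube) : C.ev s (.X 0) = C.rat (0, s 0) (0, s 0 + 1) := by
  rw [ev_apply]
  simp only [eval_X]
  rfl

theorem ev_X_one (s : Cube) : C.ev s (.X 1) = C.rat (1, s 1 + 1) (0, s 0 + 1) := by
  rw [ev_apply]
  simp only [eval_X]
  rfl

theorem ev_X_two (s : Cube) : C.ev s (.X 2) = C.rat (2, s 2 + 1) (0, s 0 + 1) := by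
  rw [ev_apply]
  simp only [eval_X]
  rfl

theorem hasOrd_D_rat_opp (s : Cube) (i j : Fin 3) :
    HasOrd (C.D s) (C.rat (i, s i + 1) (j, s j + 1)) 0 := by
  have hd : Dense (C.U s) := C.dense_T.mono (C.T_subset_U s)
  exact HasOrd.zero_of_regular (C.isOpen_U s) hd (C.D_inter_U s)
    (fun p hp => C.ratFun_isRegularOn _ _ p (hp j)) fun _ hp => div_ne_zero (hp i) (hp j)

/-- On the chart the first affine coordinate is a uniformiser of the plane. By the equations of X, a
coordinate (i, s i) is this uniformiser times a quotient of coordinates which do not vanish on the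
chart. -/
theorem hasOrd_D_rat_aux (s : Cube) (k : Fin 3 × ZMod 2) :
    HasOrd (C.D s) (C.rat k (0, s 0 + 1)) (ind s k) := by
  refine forall_index (P := fun k => HasOrd (C.D s) (C.rat k (0, s 0 + 1)) (ind s k)) s
    (fun i => ?_) (fun i => ?_) k
  · have h1 := (C.hasOrd_ev_one s _ (C.D_inter_U s) (C.I_D s) (X_ne_zero 0)).mul
      (C.hasOrd_D_rat_opp s 0 i)
    have e : C.rat (i, s i) (0, s 0 + 1) = C.ev s (.X 0) * C.rat (0, s 0 + 1) (i, s i + 1) := by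
      rw [ev_X_zero]
      refine C.germ_eq_of_T fun p hp => ?_
      have h1 := hp (0, s 0 + 1)
      have h2 := hp (i, s i + 1)
      have h3 := C.prod_eq p i 0 (s i) (s 0)
      simp only [ratFun]
      field_simp
      linear_combination h3
    rw [e, ind_same]
    simpa using h1
  · rw [ind_opp]
    exact C.hasOrd_D_rat_opp s i 0

theorem hasOrd_D_rat (s : Cube) (k l : Fin 3 × ZMod 2) :
    HasOrd (C.D s) (C.rat k l) (ind s k - ind s l) := by
  rw [← C.rat_mul_rat k (0, s 0 + 1) l]
  exact (C.hasOrd_D_rat_aux s k).mul ((C.hasOrd_D_rat_aux s l).inv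
    ((C.rat_mul_rat _ _ _).trans (C.rat_self _)))

include C in
theorem hasOrd_const (Z : PrimeDivisor X) {c : K} (hc : c ≠ 0) :
    HasOrd Z ((fun _ => c : X → K) : GenericGerm X) 0 := by
  have := C.irreducibleSpace
  exact HasOrd.zero_of_regular isOpen_univ dense_univ (by simpa using Z.1.isIrreducible.1)
    (fun p _ => IsRegularAt.const c p) fun _ _ => hc

theorem ev_C (s : Cube) (c : K) :
    C.ev s (MvPolynomial.C c) = ((fun _ => c : X → K) : GenericGerm X) := by
  rw [ev_apply]
  simp only [eval_C]

/-- A rational function without zeros and poles on the torus is a monomial. -/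
theorem exists_eq_monoOrd (f : (functionField X)ˣ) (h : Cube → ℤ)
    (hT : ∀ Z : PrimeDivisor X, ((Z.1 : Set X) ∩ C.T).Nonempty →
      HasOrd Z (f : functionField X).1 0)
    (hD : ∀ s, HasOrd (C.D s) (f : functionField X).1 (h s)) : ∃ m, h = monoOrd m := by
  have hR : ∀ q : MvPolynomial (Fin 3) K, ¬ q ∣ .X 0 * yz → MeetsChart q :=
    fun q hq hq' => hq (hq'.mul_left _)
  have hreg : ∀ Z : PrimeDivisor X, ((Z.1 : Set X) ∩ C.U 0).Nonempty →
      .X 0 * yz ∉ C.I 0 Z.1 → ((Z.1 : Set X) ∩ C.T).Nonempty := by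
    intro Z hZ hI
    simp only [mem_I, not_forall] at hI
    obtain ⟨p, hp, hps, h0⟩ := hI
    rw [map_mul, eval_X] at h0
    exact ⟨p, hp, (C.mem_T_iff 0 hps).2 (left_ne_zero_of_mul h0)⟩
  obtain ⟨N, P, hP⟩ := C.exists_mul_pow_eq 0 f (.X 0 * yz) hR
    fun Z hZ hI => ⟨0, le_rfl, hT Z (hreg Z hZ hI)⟩
  have hinv : (f : functionField X).1 * ((f⁻¹ : (functionField X)ˣ) : functionField X).1 = 1 :=
    congrArg Subtype.val f.mul_inv
  have hinv' : ((f⁻¹ : (functionField X)ˣ) : functionField X).1 * (f : functionField X).1 = 1 :=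
    congrArg Subtype.val f.inv_mul
  obtain ⟨N', P', hP'⟩ := C.exists_mul_pow_eq 0 f⁻¹ (.X 0 * yz) hR
    fun Z hZ hI => ⟨0, le_rfl, by simpa using (hT Z (hreg Z hZ hI)).inv hinv'⟩
  -- Both f and its inverse become polynomials after multiplication by powers of xyz, so the
  -- numerator of f divides a power of xyz and is a monomial up to a constant.
  have hPP : P ∣ (.X 0 * yz) ^ (N + N') := by
    refine ⟨P', C.ev_injective 0 ?_⟩
    rw [map_mul, ← hP, ← hP', map_pow, pow_add]
    linear_combination (-(C.ev 0 (.X 0 * yz)) ^ N * (C.ev 0 (.X 0 * yz)) ^ N') * hinv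
  obtain ⟨u, a, b, c, hu⟩ := exists_dvd_pow_mul_pow_mul_pow (X_prime (i := 0)) (X_prime (i := 1))
    (X_prime (i := 2)) hPP
  obtain ⟨r, hr, hru⟩ := MvPolynomial.isUnit_iff_eq_C_of_isReduced.1 u.isUnit
  refine ⟨![a - N, b - N, c - N], funext fun s => ?_⟩
  have e0 := C.ev_X_zero 0
  have e1 := C.ev_X_one 0
  have e2 := C.ev_X_two 0
  simp only [Pi.zero_apply, zero_add] at e0 e1 e2
  have h0 := C.hasOrd_D_rat s (0, 0) (0, 1)
  have h1 := C.hasOrd_D_rat s (1, 1) (0, 1)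
  have h2 := C.hasOrd_D_rat s (2, 1) (0, 1)
  -- The identity found in the chart at the origin is one of rational functions on X, so it can be
  -- evaluated along every plane. The exponents are shifted by `N` because f was multiplied by
  -- (xyz)^N.
  have hl := (hD s).mul ((h0.mul (h1.mul h2)).pow N)
  have hr' := (C.hasOrd_const (C.D s) hr.ne_zero).mul (((h0.pow a).mul (h1.pow b)).mul (h2.pow c))
  have heq : (f : functionField X).1 * (C.rat (0, 0) (0, 1) * (C.rat (1, 1) (0, 1) *
      C.rat (2, 1) (0, 1))) ^ N = ((fun _ => r : X → K) : GenericGerm X) *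
      (C.rat (0, 0) (0, 1) ^ a * C.rat (1, 1) (0, 1) ^ b * C.rat (2, 1) (0, 1) ^ c) := by
    rw [hu, hru] at hP
    rw [← e0, ← e1, ← e2, ← C.ev_C 0]
    simpa only [map_mul, map_pow, yz] using hP
  rw [heq] at hl
  have := hl.unique hr'
  simp only [monoOrd, Matrix.cons_val_zero, Matrix.cons_val_one, Matrix.cons_val]
  linear_combination this

/-! ### The class group is generated by the planes -/

/-- The divisors supported on the planes. -/
def cubeDiv : (Cube → ℤ) →+ Div X where
  toFun h := ∑ s, Finsupp.single (C.D s) (h s)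
  map_zero' := by simp
  map_add' h h' := by simp [Finset.sum_add_distrib]

theorem cubeDiv_def (h : Cube → ℤ) : C.cubeDiv h = ∑ s, Finsupp.single (C.D s) (h s) := rfl

theorem cubeDiv_D (h : Cube → ℤ) (s : Cube) : C.cubeDiv h (C.D s) = h s := by
  classical
  rw [cubeDiv_def, Finsupp.finsetSum_apply, Finset.sum_eq_single s]
  · simp
  · intro t _ hts
    rw [Finsupp.single_apply, if_neg (fun h => hts (C.D_injective h))]
  · simp

theorem cubeDiv_of_inter_T (h : Cube → ℤ) {Z : PrimeDivisor X}
    (hZ : ((Z.1 : Set X) ∩ C.T).Nonempty) : C.cubeDiv h Z = 0 := by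
  classical
  rw [cubeDiv_def, Finsupp.finsetSum_apply]
  refine Finset.sum_eq_zero fun s _ => ?_
  rw [Finsupp.single_apply, if_neg]
  rintro rfl
  rw [C.D_inter_T s] at hZ
  exact Set.not_nonempty_empty hZ

theorem cubeDiv_single (s : Cube) : C.cubeDiv (Pi.single s 1) = Finsupp.single (C.D s) 1 := by
  classical
  rw [cubeDiv_def, Finset.sum_eq_single s]
  · simp
  · intro t _ hts
    simp [hts]
  · simp

include C in
theorem forall_primeDivisor {P : PrimeDivisor X → Prop} (h1 : ∀ s, P (C.D s))
    (h2 : ∀ Z : PrimeDivisor X, ((Z.1 : Set X) ∩ C.T).Nonempty → P Z) : ∀ Z, P Z := by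
  intro Z
  by_cases hZ : ((Z.1 : Set X) ∩ C.T).Nonempty
  · exact h2 Z hZ
  · obtain ⟨s, rfl⟩ := C.exists_eq_D (Set.not_nonempty_iff_eq_empty.1 hZ)
    exact h1 s

theorem exists_monoOrd_of_mem_principal {h : Cube → ℤ} (hp : C.cubeDiv h ∈ principal X) :
    ∃ m, h = monoOrd m := by
  obtain ⟨f, hf⟩ := hp
  refine C.exists_eq_monoOrd f h (fun Z hZ => ?_) fun s => ?_
  · have := hf Z
    rwa [C.cubeDiv_of_inter_T h hZ] at this
  · have := hf (C.D s)
    rwa [C.cubeDiv_D] at this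

/-- This is the divisor of the quotient of the coordinates k and l. -/
theorem cubeDiv_ind_sub_mem_principal (k l : Fin 3 × ZMod 2) :
    C.cubeDiv (fun s => ind s k - ind s l) ∈ principal X := by
  refine ⟨C.ratUnit k l, C.forall_primeDivisor (fun s => ?_) fun Z hZ => ?_⟩
  · rw [C.cubeDiv_D]
    exact C.hasOrd_D_rat s k l
  · rw [C.cubeDiv_of_inter_T _ hZ]
    exact C.hasOrd_rat_of_inter_T hZ k l

/-- The unit of the function field defined by a nonzero polynomial. -/
theorem exists_evUnit (s : Cube) {P : MvPolynomial (Fin 3) K} (hP : P ≠ 0) :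
    ∃ f : (functionField X)ˣ, (f : functionField X).1 = C.ev s P := by
  obtain ⟨γ, h⟩ := (C.isUnit_ev s hP).exists_right_inv
  have hγ : γ ∈ functionField X :=
    (C.mem_functionField_iff s).2 ⟨1, P, hP, by rw [mul_comm, h, map_one]⟩
  exact ⟨⟨⟨_, C.ev_mem_functionField s P⟩, ⟨γ, hγ⟩, Subtype.ext h,
    Subtype.ext ((mul_comm _ _).trans h)⟩, rfl⟩

/-- A prime divisor meeting the torus has an irreducible equation q in the chart at the origin. On
the torus q vanishes along this divisor only and to order one, so its divisor on X differs from Z by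
a combination of planes. -/
theorem exists_single_sub_mem_principal (Z : PrimeDivisor X) :
    ∃ h, Finsupp.single Z 1 - C.cubeDiv h ∈ principal X := by
  classical
  revert Z
  refine C.forall_primeDivisor (fun s => ⟨Pi.single s 1, ?_⟩) fun Z hZ => ?_
  · rw [cubeDiv_single, sub_self]
    exact zero_mem _
  have hZ0 : ((Z.1 : Set X) ∩ C.U 0).Nonempty :=
    hZ.mono (Set.inter_subset_inter_right _ (C.T_subset_U 0))
  obtain ⟨q, hq, hI⟩ := C.exists_I_eq 0 Z hZ0
  obtain ⟨f, hf⟩ := C.exists_evUnit 0 hq.ne_zero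
  choose k hk using fun s => C.exists_hasOrd f (C.D s)
  refine ⟨-k, f, C.forall_primeDivisor (fun s => ?_) fun W hW => ?_⟩
  · have hne : Z ≠ C.D s := by
      rintro rfl
      rw [C.D_inter_T s] at hZ
      exact Set.not_nonempty_empty hZ
    rw [Finsupp.sub_apply, C.cubeDiv_D, Finsupp.single_apply, if_neg hne]
    simpa using hk s
  · rw [Finsupp.sub_apply, C.cubeDiv_of_inter_T _ hW, sub_zero, Finsupp.single_apply, hf]
    split_ifs with e
    · subst e
      exact C.hasOrd_ev_one 0 Z hZ0 hI hq.ne_zero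
    · have hW0 : ((W.1 : Set X) ∩ C.U 0).Nonempty :=
        hW.mono (Set.inter_subset_inter_right _ (C.T_subset_U 0))
      refine C.hasOrd_ev_zero 0 W hW0 fun hmem => e ?_
      refine (C.primeDivisor_eq_of_subset (C.subset_of_I_le 0 W.1.isIrreducible hW0
        Z.1.isClosed ?_)).symm
      rw [hI, Ideal.span_singleton_le_iff_mem]
      exact hmem

/-- Every divisor is linearly equivalent to one which is supported on the planes. -/
theorem exists_sub_mem_principal (E : Div X) : ∃ h, E - C.cubeDiv h ∈ principal X := by
  induction E using Finsupp.induction_linear with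
  | zero => exact ⟨0, by simp⟩
  | add E F hE hF =>
    obtain ⟨h, hh⟩ := hE
    obtain ⟨h', hh'⟩ := hF
    refine ⟨h + h', ?_⟩
    have := add_mem hh hh'
    rw [map_add]
    convert this using 1
    abel
  | single Z n =>
    obtain ⟨h, hh⟩ := C.exists_single_sub_mem_principal Z
    refine ⟨n • h, ?_⟩
    have := zsmul_mem hh n
    rw [map_zsmul]
    convert this using 1
    rw [smul_sub, Finsupp.smul_single, smul_eq_mul, mul_one]

end ToricCoords

end ProjVar
end

/-! ### The action of the automorphism group on the planes -/

open Filter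
noncomputable section
set_option linter.unusedSectionVars false
namespace ProjVar
open MvPolynomial TopologicalSpace

theorem smul_single {K : Type*} [Field K] {n : ℕ} {X : Set (ProjSpace K n)} (g : RegAut X)
    (Z : PrimeDivisor X) (m : ℤ) :
    g • (Finsupp.single Z m : Div X) = Finsupp.single (g • Z) m :=
  Finsupp.mapDomain_single

theorem mem_aut0_iff {K : Type*} [Field K] {n : ℕ} {X : Set (ProjSpace K n)} {g : RegAut X} :
    g ∈ aut0 X ↔ ∀ c : Cl X, g • c = c :=
  ⟨fun h c => DFunLike.congr_fun (MonoidHom.mem_ker.1 h) c,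
    fun h => MonoidHom.mem_ker.2 (AddMonoidHom.ext h)⟩

namespace ToricCoords

variable {K : Type*} [Field K] {X : Set (ProjSpace K 5)} (C : ToricCoords X) [IsAlgClosed K]

theorem smul_D_eq {g : RegAut X} {s s' : Cube} (h : ∀ p ∈ C.plane s, g.1 p ∈ C.plane s') :
    g • C.D s = C.D s' :=
  C.primeDivisor_eq_of_subset (by
    rw [coe_smul, coe_D, coe_D]
    rintro _ ⟨p, hp, rfl⟩
    exact h p hp)

theorem permAut_smul_D (w : C2CubedS3) (s : Cube) : C.permAut w • C.D s = C.D (act w s) := by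
  refine C.smul_D_eq fun p hp i => ?_
  obtain ⟨i, rfl⟩ := w.right.surjective i
  obtain ⟨a, -, h⟩ := C.exists_cd_permAut w p
  rw [← idx_act, h, hp i, mul_zero]

/-- The planes are the only effective divisors in their classes. -/
theorem eq_D_of_single_sub_mem {W : PrimeDivisor X} {s : Cube}
    (h : Finsupp.single W 1 - Finsupp.single (C.D s) 1 ∈ principal X) : W = C.D s := by
  classical
  by_contra hW
  obtain ⟨f, hf⟩ := h
  have hpos : ∀ Z ≠ C.D s, 0 ≤ (Finsupp.single W 1 - Finsupp.single (C.D s) 1 : Div X) Z := by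
    intro Z hZ
    rw [Finsupp.sub_apply, Finsupp.single_apply, Finsupp.single_apply,
      if_neg fun e : C.D s = Z => hZ e.symm]
    split_ifs <;> simp
  -- A function with divisor W − D s has poles along D s only, hence is constant and has order zero
  -- along W, against the order one prescribed there.
  obtain ⟨c, hc, he⟩ := C.eq_const_of_hasOrd s f fun Z hZ => ⟨_, hpos Z hZ, hf Z⟩
  have h1 := hf W
  rw [he] at h1
  have h2 := h1.unique (C.hasOrd_const W hc)
  rw [Finsupp.sub_apply, Finsupp.single_eq_same, Finsupp.single_apply,
    if_neg fun e => hW e.symm] at h2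
  exact one_ne_zero h2

theorem smul_cubeDiv {g : RegAut X} {σ : Equiv.Perm Cube} (h : ∀ s, g • C.D s = C.D (σ s))
    (k : Cube → ℤ) : g • C.cubeDiv k = C.cubeDiv (k ∘ σ.symm) := by
  rw [cubeDiv_def, cubeDiv_def, Finset.smul_sum]
  refine Fintype.sum_equiv σ _ _ fun s => ?_
  rw [smul_single, h, Function.comp_apply, Equiv.symm_apply_apply]

theorem mem_aut0_of_smul_D {g : RegAut X} (h : ∀ s, g • C.D s = C.D s) : g ∈ aut0 X := by
  rw [mem_aut0_iff]
  intro c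
  induction c using QuotientAddGroup.induction_on with
  | H E =>
    obtain ⟨k, hk⟩ := C.exists_sub_mem_principal E
    have e : (QuotientAddGroup.mk E : Cl X) = QuotientAddGroup.mk (C.cubeDiv k) := by
      rw [← sub_eq_zero, ← QuotientAddGroup.mk_sub]
      exact (QuotientAddGroup.eq_zero_iff _).2 hk
    rw [e, smul_mk, C.smul_cubeDiv (σ := 1) h]
    rfl

/-- An element of Aut⁰ preserves the class of Z, and Z is the only prime divisor in its class,
because φ transports this property from the plane. Translates of planes are admitted because
`exists_smul_D`, which shows that they are planes, relies on this lemma. -/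
theorem smul_D_of_mem_aut0 {g : RegAut X} (hg : g ∈ aut0 X) {Z : PrimeDivisor X} {φ : RegAut X}
    {s : Cube} (hZ : Z = φ • C.D s) : g • Z = Z := by
  have h1 : (Finsupp.single (g • Z) 1 - Finsupp.single Z 1 : Div X) ∈ principal X := by
    have := mem_aut0_iff.1 hg (QuotientAddGroup.mk (Finsupp.single Z 1))
    rw [smul_mk, smul_single, ← sub_eq_zero, ← QuotientAddGroup.mk_sub] at this
    exact (QuotientAddGroup.eq_zero_iff _).1 this
  have h2 := smul_mem_principal φ⁻¹ h1
  rw [smul_sub, smul_single, smul_single] at h2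
  have e : φ⁻¹ • Z = C.D s := by rw [hZ, inv_smul_smul]
  rw [e] at h2
  have h3 := C.eq_D_of_single_sub_mem h2
  rw [← e] at h3
  exact MulAction.injective _ h3

/-- Automorphisms permute the planes. -/
theorem exists_smul_D (φ : RegAut X) (s : Cube) : ∃ s', φ • C.D s = C.D s' := by
  refine C.exists_eq_D (Set.not_nonempty_iff_eq_empty.1 ?_)
  rintro ⟨p, hp, hpT⟩
  refine C.primeDivisor_ne_univ (φ • C.D s) (Set.eq_univ_of_univ_subset ?_)
  rw [← C.dense_T.closure_eq]
  refine closure_minimal (fun q hq => ?_) (φ • C.D s).1.isClosed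
  -- The torus element carrying p to q fixes all planes, so it lies in Aut⁰ and preserves the
  -- translate of the plane. A translate meeting the torus would thus contain the whole torus, which
  -- is dense.
  let t : Fin 3 × ZMod 2 → Kˣ := fun k => Units.mk0 (C.cd q k) (hq k) / Units.mk0 (C.cd p k) (hpT k)
  have ht : ∀ i, t (i, 0) * t (i, 1) = t (0, 0) * t (0, 1) := fun i => by
    ext
    have h1 := C.prod_eq p i 0 0 0
    have h2 := C.prod_eq q i 0 0 0
    simp only [zero_add] at h1 h2
    simp only [t, Units.val_mul, Units.val_div_eq_div_val, Units.val_mk0]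
    rw [div_mul_div_comm, div_mul_div_comm, h1, h2]
  obtain ⟨g, hg⟩ := C.exists_torusAut t ht
  have hgD : ∀ s, g • C.D s = C.D s := fun s => C.smul_D_eq fun x hx i => by
    obtain ⟨a, -, h⟩ := hg x
    rw [h, hx i, mul_zero, mul_zero]
  have h1 := C.smul_D_of_mem_aut0 (C.mem_aut0_of_smul_D hgD) (rfl : φ • C.D s = _)
  have h2 : g.1 p = q := by
    obtain ⟨a, -, h⟩ := hg p
    refine C.eq_of_cd (a := a) fun k => ?_
    rw [h]
    simp only [t, Units.val_div_eq_div_val, Units.val_mk0]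
    rw [div_mul_cancel₀ _ (hpT k)]
  rw [← h1, coe_smul]
  exact ⟨p, hp, h2⟩

/-- The action of the automorphism group on the planes. -/
def perm : RegAut X →* Equiv.Perm Cube where
  toFun φ :=
    { toFun := fun s => (C.exists_smul_D φ s).choose
      invFun := fun s => (C.exists_smul_D φ⁻¹ s).choose
      left_inv := fun s => C.D_injective (by
        rw [← (C.exists_smul_D φ⁻¹ _).choose_spec, ← (C.exists_smul_D φ s).choose_spec,
          inv_smul_smul])
      right_inv := fun s => C.D_injective (by
        rw [← (C.exists_smul_D φ _).choose_spec, ← (C.exists_smul_D φ⁻¹ s).choose_spec,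
          smul_inv_smul]) }
  map_one' := Equiv.ext fun s => C.D_injective (by
    change C.D (C.exists_smul_D 1 s).choose = C.D s
    rw [← (C.exists_smul_D 1 s).choose_spec, one_smul])
  map_mul' φ ψ := Equiv.ext fun s => C.D_injective (by
    change C.D (C.exists_smul_D (φ * ψ) s).choose =
      C.D (C.exists_smul_D φ (C.exists_smul_D ψ s).choose).choose
    rw [← (C.exists_smul_D _ s).choose_spec, ← (C.exists_smul_D φ _).choose_spec,
      ← (C.exists_smul_D ψ s).choose_spec, mul_smul])

theorem smul_D (φ : RegAut X) (s : Cube) : φ • C.D s = C.D (C.perm φ s) :=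
  (C.exists_smul_D φ s).choose_spec

theorem perm_permAut (w : C2CubedS3) : C.perm (C.permAut w) = act w :=
  Equiv.ext fun s => C.D_injective (by rw [← smul_D, permAut_smul_D])

theorem ker_perm : C.perm.ker = aut0 X := by
  ext g
  rw [MonoidHom.mem_ker]
  constructor
  · intro h
    exact C.mem_aut0_of_smul_D fun s => by rw [smul_D, h]; rfl
  · intro h
    refine Equiv.ext fun s => C.D_injective ?_
    rw [← smul_D, C.smul_D_of_mem_aut0 h (one_smul (RegAut X) (C.D s)).symm]
    rfl

/-- An automorphism sends the divisor of a quotient of coordinates to a principal divisor, still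
supported on the planes, which is therefore the divisor of a monomial. -/
theorem exists_monoOrd_comp (φ : RegAut X) (k l : Fin 3 × ZMod 2) :
    ∃ m, (fun s => ind ((C.perm φ)⁻¹ s) k - ind ((C.perm φ)⁻¹ s) l) = monoOrd m := by
  refine C.exists_monoOrd_of_mem_principal ?_
  have := smul_mem_principal φ (C.cubeDiv_ind_sub_mem_principal k l)
  rwa [C.smul_cubeDiv (C.smul_D φ)] at this

end ToricCoords

theorem act_injective : Function.Injective act := by
  rw [injective_iff_map_eq_one]
  intro w hw
  have h := fun s i => congrFun (DFunLike.congr_fun hw s) i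
  simp only [act_apply, Equiv.Perm.coe_one, id] at h
  have h1 : w.left = 1 := funext fun i => by
    have := h 0 i
    simpa using this
  have h2 : w.right⁻¹ = 1 := Equiv.ext fun i => by
    have := h (Pi.single i 1) i
    rw [h1] at this
    by_contra hne
    simp [Pi.single_apply] at this
    exact hne this
  exact SemidirectProduct.ext h1 (inv_eq_one.1 h2)

/-- A monomial whose order along each of the eight planes is 1 or −1 has the orders of a quotient of
two paired coordinates. So the sign depends on a single coordinate of the vertex. -/
theorem exists_of_monoOrd {f : Cube → ZMod 2} {m : Fin 3 → ℤ}
    (h : ∀ s, (if 0 = f s then (1 : ℤ) else 0) - (if 1 = f s then 1 else 0) = monoOrd m s) :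
    ∃ j b, ∀ s, f s = s j + b := by
  have hv : ∀ s, monoOrd m s = 1 ∧ f s = 0 ∨ monoOrd m s = -1 ∧ f s = 1 := fun s => by
    rw [← h]
    rcases ZMod.two_cases (f s) with e | e <;> simp [e]
  have key : ∀ (j : Fin 3) (b : ZMod 2),
      (∀ s, monoOrd m s = if s j + b = 0 then 1 else -1) → ∃ j b, ∀ s, f s = s j + b := by
    refine fun j b hj => ⟨j, b, fun s => ?_⟩
    have h1 := hj s
    rcases hv s with ⟨h2, h3⟩ | ⟨h2, h3⟩ <;> rcases ZMod.two_cases (s j + b) with e | e <;>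
      simp_all
  -- The orders at these four vertices are m₀, m₀ + m₁, m₀ + m₂ and m₀ + m₁ + m₂. All being ±1, at
  -- most one of m₁, m₂ is nonzero, and it then equals −2m₀.
  have e1 := hv ![0, 0, 0]
  have e2 := hv ![0, 1, 0]
  have e3 := hv ![0, 0, 1]
  have e4 := hv ![0, 1, 1]
  simp only [monoOrd, ind, Matrix.cons_val_zero, Matrix.cons_val_one, Matrix.cons_val, one_ne_zero,
    if_true, if_false] at e1 e2 e3 e4
  have hm : (m 0 = 1 ∨ m 0 = -1) ∧ (m 1 = 0 ∧ m 2 = 0 ∨ m 1 = -2 * m 0 ∧ m 2 = 0 ∨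
      m 1 = 0 ∧ m 2 = -2 * m 0) := by omega
  obtain ⟨h0, ⟨h1, h2⟩ | ⟨h1, h2⟩ | ⟨h1, h2⟩⟩ := hm
  · rcases h0 with h0 | h0
    · refine key 0 0 fun s => ?_
      simp only [monoOrd, ind, h0, h1, h2]
      rcases ZMod.two_cases (s 0) with e | e <;> simp [e]
    · refine key 0 1 fun s => ?_
      simp only [monoOrd, ind, h0, h1, h2]
      rcases ZMod.two_cases (s 0) with e | e <;> simp [e, CharTwo.add_self_eq_zero]
  · rcases h0 with h0 | h0
    · refine key 1 0 fun s => ?_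
      simp only [monoOrd, ind, h0, h1, h2]
      rcases ZMod.two_cases (s 0) with e | e <;> rcases ZMod.two_cases (s 1) with e' | e' <;>
        simp [e, e']
    · refine key 1 1 fun s => ?_
      simp only [monoOrd, ind, h0, h1, h2]
      rcases ZMod.two_cases (s 0) with e | e <;> rcases ZMod.two_cases (s 1) with e' | e' <;>
        simp [e, e', CharTwo.add_self_eq_zero]
  · rcases h0 with h0 | h0
    · refine key 2 0 fun s => ?_
      simp only [monoOrd, ind, h0, h1, h2]
      rcases ZMod.two_cases (s 0) with e | e <;> rcases ZMod.two_cases (s 2) with e' | e' <;>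
        simp [e, e']
    · refine key 2 1 fun s => ?_
      simp only [monoOrd, ind, h0, h1, h2]
      rcases ZMod.two_cases (s 0) with e | e <;> rcases ZMod.two_cases (s 2) with e' | e' <;>
        simp [e, e', CharTwo.add_self_eq_zero]

/-- Each coordinate of σ s is one coordinate of s, possibly flipped. No coordinate of s is used
twice, since σ is surjective, so σ is a permutation of the coordinates followed by flips. -/
theorem exists_act_eq (σ : Equiv.Perm Cube)
    (h : ∀ i, ∃ m, (fun s => ind (σ s) (i, 0) - ind (σ s) (i, 1)) = monoOrd m) :
    ∃ w, act w = σ := by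
  have h1 : ∀ i, ∃ j b, ∀ s, σ s i = s j + b := fun i => by
    obtain ⟨m, hm⟩ := h i
    exact exists_of_monoOrd fun s => congrFun hm s
  choose j b hjb using h1
  have hj : Function.Injective j := by
    intro i i' hi
    by_contra hne
    have e0 : ∀ t : Cube, t i - t i' = b i - b i' := fun t => by
      obtain ⟨s, rfl⟩ := σ.surjective t
      rw [hjb, hjb, hi]
      ring
    have e1 := e0 0
    rw [← e0 (Pi.single i 1)] at e1
    simp [Ne.symm hne] at e1
  refine ⟨⟨fun i => Multiplicative.ofAdd (b i),
    (Equiv.ofBijective j (Finite.injective_iff_bijective.1 hj))⁻¹⟩, Equiv.ext fun s =>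
    funext fun i => ?_⟩
  rw [act_apply, hjb, inv_inv]
  rfl

namespace ToricCoords

variable {K : Type*} [Field K] {X : Set (ProjSpace K 5)} (C : ToricCoords X) [IsAlgClosed K]

theorem perm_mem_range (φ : RegAut X) : C.perm φ ∈ act.range := by
  rw [← inv_mem_iff]
  exact exists_act_eq _ fun i => C.exists_monoOrd_comp φ (i, 0) (i, 1)

/-- The action of the automorphism group on the cube, as a homomorphism to the group of symmetries
of the cube. -/
def sym : RegAut X →* C2CubedS3 :=
  (MonoidHom.ofInjective act_injective).symm.toMonoidHom.comp
    (C.perm.codRestrict act.range C.perm_mem_range)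

theorem act_sym (φ : RegAut X) : act (C.sym φ) = C.perm φ :=
  congrArg Subtype.val ((MonoidHom.ofInjective act_injective).apply_symm_apply
    (C.perm.codRestrict act.range C.perm_mem_range φ))

theorem sym_permAut (w : C2CubedS3) : C.sym (C.permAut w) = w :=
  act_injective (by rw [act_sym, perm_permAut])

theorem ker_sym : C.sym.ker = aut0 X := by
  rw [← C.ker_perm]
  ext φ
  rw [MonoidHom.mem_ker, MonoidHom.mem_ker, ← act_sym, map_eq_one_iff _ act_injective]

/-- The automorphism group modulo the subgroup acting trivially on the class group. -/
def autHatEquiv : AutHat X ≃* C2CubedS3 :=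
  (QuotientGroup.quotientMulEquivOfEq C.ker_sym.symm).trans
    (QuotientGroup.quotientKerEquivOfSurjective C.sym fun w => ⟨_, C.sym_permAut w⟩)

end ToricCoords

end ProjVar
end

/-! ### Minimality in terms of invariant functions on the cube -/

open Filter
noncomputable section
set_option linter.unusedSectionVars false
namespace ProjVar
open MvPolynomial TopologicalSpace

/-- Torsion in A is allowed: after multiplication by the fixed N, everything is a multiple of the
element a of infinite order. -/
theorem finrank_int_eq_one {A : Type*} [AddCommGroup A] {a : A} (ha : ∀ n : ℤ, n • a = 0 → n = 0)
    {N : ℤ} (hN : N ≠ 0) (h : ∀ c : A, ∃ n : ℤ, N • c = n • a) : Module.finrank ℤ A = 1 := by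
  have h1 : Module.rank ℤ A ≤ (1 : ℕ) := by
    refine rank_le fun s hs => ?_
    by_contra! hc
    obtain ⟨x, hx, y, hy, hxy⟩ := Finset.one_lt_card.1 hc
    obtain ⟨n, hn⟩ := h x
    obtain ⟨m, hm⟩ := h y
    have hp : LinearIndependent ℤ ![x, y] := by
      have h1 := hs.comp ![⟨x, hx⟩, ⟨y, hy⟩] (by
        intro i j hij
        fin_cases i <;> fin_cases j <;> simp_all [Ne.symm hxy])
      convert h1 using 1
      ext i
      fin_cases i <;> rfl
    rw [LinearIndependent.pair_iff] at hp
    have h2 := hp (m * N) (-(n * N)) (by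
      rw [mul_smul, hn, neg_smul, mul_smul, hm, smul_smul, smul_smul, mul_comm m n, add_neg_cancel])
    have hm0 : m = 0 := by simpa [hN] using h2.1
    have h3 := hp 0 N (by rw [hm, hm0]; simp)
    exact hN h3.2
  have h2 : (1 : Cardinal) ≤ Module.rank ℤ A := by
    have : LinearIndependent ℤ fun _ : Unit => a := by
      rw [Fintype.linearIndependent_iff]
      intro g hg i
      exact ha _ (by simpa using hg)
    simpa using this.cardinal_lift_le_rank
  exact Module.finrank_eq_of_rank_eq (le_antisymm h1 (by simpa using h2))

theorem exists_relation_of_finrank_eq_one {A : Type*} [AddCommGroup A]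
    (h : Module.finrank ℤ A = 1) (x y : A) : ∃ m n : ℤ, m • x + n • y = 0 ∧ (m ≠ 0 ∨ n ≠ 0) := by
  by_contra! hc
  have hp : LinearIndependent ℤ ![x, y] := by
    rw [LinearIndependent.pair_iff]
    intro m n hmn
    by_contra h'
    rw [not_and_or] at h'
    obtain ⟨h1, h2⟩ := hc m n hmn
    rcases h' with h' | h'
    · exact h' h1
    · exact h' h2
  have h1 := hp.cardinal_lift_le_rank
  have h2 : Module.rank ℤ A = 1 := Module.rank_eq_one_iff_finrank_eq_one.2 h
  rw [h2] at h1
  simp at h1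

instance : Finite C2CubedS3 := Finite.of_equiv _ SemidirectProduct.equivProd.symm

/-- Affine functions on the cube. -/
def IsAff (h : Cube → ℤ) : Prop :=
  ∀ s, h s = h 0 + ∑ i, if s i = 0 then 0 else h (Pi.single i 1) - h 0

/-- A group of symmetries of the cube is minimal if all invariant functions are affine. -/
def IsMinimalSym (H : Subgroup C2CubedS3) : Prop :=
  ∀ h : Cube → ℤ, (∀ w ∈ H, ∀ s, h (act w s) = h s) → IsAff h

theorem isAff_monoOrd (m : Fin 3 → ℤ) : IsAff (monoOrd m) := by
  intro s
  have hs : s = ![s 0, s 1, s 2] := by ext i; fin_cases i <;> rfl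
  rw [hs, Fin.sum_univ_three]
  rcases ZMod.two_cases (s 0) with e | e <;> rcases ZMod.two_cases (s 1) with e' | e' <;>
    rcases ZMod.two_cases (s 2) with e'' | e'' <;> simp [monoOrd, ind, e, e', e''] <;> ring

theorem IsAff.of_smul_add {h : Cube → ℤ} {a b : ℤ} (ha : a ≠ 0)
    (hh : IsAff fun s => a * h s + b) : IsAff h := by
  intro s
  have h1 := hh s
  refine mul_left_cancel₀ ha ?_
  rw [mul_add, Finset.mul_sum]
  have e : ∀ i, (a * if s i = 0 then 0 else h (Pi.single i 1) - h 0) =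
      if s i = 0 then 0 else a * h (Pi.single i 1) + b - (a * h 0 + b) := fun i => by
    split_ifs
    · simp
    · ring
  simp only [e]
  linear_combination h1

/-- Twice the indicator of s i = 1 is 1 + (ind s (i,1) − ind s (i,0)), and the bracket comes from
the divisor of a quotient of coordinates. Up to linear equivalence, twice an affine function is
constant. -/
theorem IsAff.two_mul_eq {h : Cube → ℤ} (hh : IsAff h) : ∃ (n : ℤ) (d : Fin 3 → ℤ),
    (2 : ℤ) • h = n • (1 : Cube → ℤ) + ∑ i, d i • fun s => ind s (i, 1) - ind s (i, 0) := by
  refine ⟨2 * h 0 + ∑ i, (h (Pi.single i 1) - h 0), fun i => h (Pi.single i 1) - h 0,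
    funext fun s => ?_⟩
  simp only [Pi.smul_apply, Pi.add_apply, Pi.one_apply, Finset.sum_apply, smul_eq_mul, mul_one]
  rw [hh s, mul_add, Finset.mul_sum, add_assoc, ← Finset.sum_add_distrib]
  congr 1
  refine Finset.sum_congr rfl fun i _ => ?_
  rcases ZMod.two_cases (s i) with e | e
  · simp [ind, e]
  · simp [ind, e]
    ring

theorem eq_zero_of_const_eq_monoOrd {n : ℤ} {m : Fin 3 → ℤ}
    (h : n • (1 : Cube → ℤ) = monoOrd m) : n = 0 := by
  have h0 := congrFun h 0
  have h1 := congrFun h 1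
  simp [monoOrd, ind] at h0 h1
  omega

namespace ToricCoords

variable {K : Type*} [Field K] {X : Set (ProjSpace K 5)} (C : ToricCoords X) [IsAlgClosed K]

/-- The sum of the planes is a Cartier divisor. -/
theorem cubeDiv_one_mem_cartier : C.cubeDiv 1 ∈ cartier X := by
  intro p
  obtain ⟨⟨i, ε⟩, hk⟩ := C.exists_cd_ne p
  -- Where the coordinate (i, ε) is nonzero, only planes with s i = ε + 1 occur, and each of them is
  -- a simple zero of the quotient of (i, ε + 1) by (i, ε).
  refine ⟨_, C.isOpen_cd_ne (i, ε), hk, C.ratUnit (i, ε + 1) (i, ε),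
    C.forall_primeDivisor (fun s hs => ?_) fun Z hZ _ => ?_⟩
  · rw [C.cubeDiv_D]
    obtain ⟨x, hx, hx'⟩ := hs
    rw [coe_D] at hx
    have he : ε ≠ s i := by
      rintro rfl
      exact hx' (hx i)
    rw [ZMod.ne_iff_eq_add_one] at he
    refine (C.hasOrd_D_rat s _ _).congr ?_
    rw [he, ZMod.add_one_add_one, ind_same, ind_opp]
    rfl
  · rw [C.cubeDiv_of_inter_T _ hZ]
    exact C.hasOrd_rat_of_inter_T hZ _ _

/-- The class of the sum of the planes. -/
def hyp : Cl X := QuotientAddGroup.mk (C.cubeDiv 1)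

theorem hyp_mem_picInvariants (G : Subgroup (RegAut X)) : C.hyp ∈ picInvariants G := by
  refine ⟨⟨_, C.cubeDiv_one_mem_cartier, rfl⟩, fun g _ => ?_⟩
  rw [hyp, smul_mk, C.smul_cubeDiv (C.smul_D g)]
  rfl

theorem eq_zero_of_smul_hyp {n : ℤ} (h : n • C.hyp = 0) : n = 0 := by
  rw [hyp, ← QuotientAddGroup.mk_zsmul, QuotientAddGroup.eq_zero_iff, ← map_zsmul] at h
  obtain ⟨m, hm⟩ := C.exists_monoOrd_of_mem_principal h
  exact eq_zero_of_const_eq_monoOrd hm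

theorem mk_cubeDiv_of_isAff {h : Cube → ℤ} (hh : IsAff h) :
    ∃ n : ℤ, (2 : ℤ) • (QuotientAddGroup.mk (C.cubeDiv h) : Cl X) = n • C.hyp := by
  obtain ⟨n, d, e⟩ := hh.two_mul_eq
  refine ⟨n, ?_⟩
  rw [hyp, ← QuotientAddGroup.mk_zsmul, ← QuotientAddGroup.mk_zsmul, ← map_zsmul, ← map_zsmul, e,
    map_add, QuotientAddGroup.mk_add, add_eq_left, QuotientAddGroup.eq_zero_iff, map_sum]
  refine sum_mem fun i _ => ?_
  rw [map_zsmul]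
  exact zsmul_mem (C.cubeDiv_ind_sub_mem_principal _ _) _

/-- An invariant class need not have an invariant representative supported on the planes. Summing
the G-translates of a representative gives an invariant function on the cube, hence an affine one,
at the price of the factor |G|; the factor 2 comes from `IsAff.two_mul_eq`. -/
theorem exists_smul_eq_smul_hyp {G : Subgroup (RegAut X)} [Finite G]
    (hG : IsMinimalSym (G.map C.sym)) {c : Cl X} (hc : ∀ g ∈ G, g • c = c) :
    ∃ n : ℤ, (2 * Nat.card G : ℤ) • c = n • C.hyp := by
  have := Fintype.ofFinite G
  obtain ⟨h, hh⟩ : ∃ h, c = QuotientAddGroup.mk (C.cubeDiv h) := by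
    induction c using QuotientAddGroup.induction_on with
    | H E =>
      obtain ⟨h, hh⟩ := C.exists_sub_mem_principal E
      refine ⟨h, ?_⟩
      rw [← sub_eq_zero, ← QuotientAddGroup.mk_sub]
      exact (QuotientAddGroup.eq_zero_iff _).2 hh
  let h' : Cube → ℤ := ∑ g : G, h ∘ (C.perm g.1).symm
  have hsum : (Nat.card G : ℤ) • c = QuotientAddGroup.mk (C.cubeDiv h') := by
    have h1 : ∑ g : G, g.1 • c = (Nat.card G : ℤ) • c := by
      rw [Finset.sum_congr rfl fun g _ => hc g.1 g.2, Finset.sum_const, Finset.card_univ,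
        Nat.card_eq_fintype_card, natCast_zsmul]
    rw [← h1, map_sum, QuotientAddGroup.mk_sum]
    refine Finset.sum_congr rfl fun g _ => ?_
    rw [hh, smul_mk, C.smul_cubeDiv (C.smul_D g.1)]
  have hinv : IsAff h' := by
    refine hG h' ?_
    rintro _ ⟨g, hg, rfl⟩ s
    simp only [h', Finset.sum_apply, Function.comp_apply]
    refine Fintype.sum_equiv (Equiv.mulLeft (⟨g, hg⟩ : G)⁻¹) _ _ fun x => ?_
    rw [act_sym]
    congr 1
    change (C.perm x.1)⁻¹ _ = (C.perm (g⁻¹ * x.1))⁻¹ s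
    rw [map_mul, map_inv, mul_inv_rev, inv_inv]
    rfl
  obtain ⟨n, hn⟩ := C.mk_cubeDiv_of_isAff hinv
  exact ⟨n, by rw [mul_smul, hsum, hn]⟩

theorem isGMinimal_of_isMinimalSym {G : Subgroup (RegAut X)} [Finite G]
    (hG : IsMinimalSym (G.map C.sym)) : IsGMinimal G := by
  have hN : 0 < 2 * Nat.card G := by have := Nat.card_pos (α := G); omega
  refine ⟨fun E hE => ⟨2 * Nat.card G, hN, ?_⟩, ?_⟩
  · obtain ⟨n, hn⟩ := C.exists_smul_eq_smul_hyp hG (c := QuotientAddGroup.mk E)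
      fun g hg => by rw [smul_mk, hE g hg]
    rw [hyp, ← QuotientAddGroup.mk_zsmul, ← QuotientAddGroup.mk_zsmul, ← sub_eq_zero,
      ← QuotientAddGroup.mk_sub, QuotientAddGroup.eq_zero_iff] at hn
    have h1 : ((2 * Nat.card G : ℤ) • E - n • C.cubeDiv 1) ∈ cartier X := by
      obtain ⟨f, hf⟩ := hn
      exact fun p => ⟨Set.univ, isOpen_univ, trivial, f, fun Z _ => hf Z⟩
    have h2 := add_mem h1 (zsmul_mem C.cubeDiv_one_mem_cartier n)
    rw [sub_add_cancel] at h2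
    rw [← natCast_zsmul]
    exact_mod_cast h2
  · refine finrank_int_eq_one (a := ⟨C.hyp, C.hyp_mem_picInvariants G⟩) (N := 2 * Nat.card G)
      (fun n hn => C.eq_zero_of_smul_hyp (congrArg Subtype.val hn)) (by exact_mod_cast hN.ne')
      fun c => ?_
    obtain ⟨n, hn⟩ := C.exists_smul_eq_smul_hyp hG c.2.2
    exact ⟨n, Subtype.ext hn⟩

/-- An invariant function is an invariant divisor, so a multiple of it is Cartier. In a group of
rank one this is dependent on the class of the sum of the planes. The relation says that a nonzero
multiple of the function plus a constant is the divisor of a monomial, and those are affine. -/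
theorem isMinimalSym_of_isGMinimal {G : Subgroup (RegAut X)} (hG : IsGMinimal G) :
    IsMinimalSym (G.map C.sym) := by
  intro h hh
  have hinv : ∀ g ∈ G, g • C.cubeDiv h = C.cubeDiv h := fun g hg => by
    rw [C.smul_cubeDiv (C.smul_D g)]
    congr 1
    ext s
    have := hh _ ⟨g, hg, rfl⟩ ((C.perm g).symm s)
    rw [act_sym, Equiv.apply_symm_apply] at this
    exact this.symm
  obtain ⟨N, hN, hc⟩ := hG.1 _ hinv
  let x : picInvariants G := ⟨QuotientAddGroup.mk (N • C.cubeDiv h), ⟨_, hc, rfl⟩, fun g hg => by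
    rw [smul_mk]
    exact congrArg _ ((map_nsmul (DistribSMul.toAddMonoidHom (Div X) g) N _).trans
      (congrArg _ (hinv g hg)))⟩
  obtain ⟨m, n, hmn, h0⟩ := exists_relation_of_finrank_eq_one hG.2 x
    ⟨C.hyp, C.hyp_mem_picInvariants G⟩
  have hmn' : m • (QuotientAddGroup.mk (N • C.cubeDiv h) : Cl X) + n • C.hyp = 0 :=
    congrArg Subtype.val hmn
  have hm : m ≠ 0 := by
    rintro rfl
    rw [zero_zsmul, zero_add] at hmn'
    rcases h0 with h0 | h0
    · exact h0 rfl
    · exact h0 (C.eq_zero_of_smul_hyp hmn')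
  rw [hyp, ← QuotientAddGroup.mk_zsmul, ← QuotientAddGroup.mk_zsmul, ← QuotientAddGroup.mk_add,
    QuotientAddGroup.eq_zero_iff, ← map_nsmul, ← map_zsmul, ← map_zsmul, ← map_add] at hmn'
  obtain ⟨m', hm'⟩ := C.exists_monoOrd_of_mem_principal hmn'
  refine IsAff.of_smul_add (a := m * N) (b := n)
    (mul_ne_zero hm (by exact_mod_cast hN.ne')) ?_
  have h1 := isAff_monoOrd m'
  rw [← hm'] at h1
  convert h1 using 2 with s
  simp [mul_assoc]

theorem isGMinimal_iff (G : Subgroup (RegAut X)) [Finite G] :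
    IsGMinimal G ↔ IsMinimalSym (G.map C.sym) :=
  ⟨C.isMinimalSym_of_isGMinimal, C.isGMinimal_of_isMinimalSym⟩

theorem map_autHatEquiv_map (G : Subgroup (RegAut X)) :
    (G.map (toAutHat X)).map C.autHatEquiv.toMonoidHom = G.map C.sym := by
  rw [Subgroup.map_map]
  rfl

/-- The section `permAut` of `sym` lifts any group of symmetries of the cube to a finite group of
automorphisms, so finiteness of G puts no restriction on the image. -/
theorem mem_minimalImages_iff (G' : Subgroup (AutHat X)) :
    G' ∈ minimalImages X ↔ IsMinimalSym (G'.map C.autHatEquiv.toMonoidHom) := by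
  constructor
  · rintro ⟨G, hG, h, rfl⟩
    rw [map_autHatEquiv_map]
    exact (C.isGMinimal_iff G).1 h
  · intro h
    have hfin : Finite (Subgroup.map C.permAut (G'.map C.autHatEquiv.toMonoidHom)) :=
      Set.Finite.to_subtype ((Set.toFinite _).image _)
    have e : (Subgroup.map C.permAut (G'.map C.autHatEquiv.toMonoidHom)).map C.sym =
        G'.map C.autHatEquiv.toMonoidHom := by
      rw [Subgroup.map_map]
      have : C.sym.comp C.permAut = MonoidHom.id _ := MonoidHom.ext C.sym_permAut
      rw [this, Subgroup.map_id]
    refine ⟨_, hfin, (C.isGMinimal_iff _).2 (by rwa [e]), ?_⟩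
    have hi : Function.Injective (Subgroup.map C.autHatEquiv.toMonoidHom) :=
      Subgroup.map_injective C.autHatEquiv.injective
    refine hi ?_
    rw [map_autHatEquiv_map, e]

end ToricCoords

end ProjVar
end

/-! ### Finite subgroups of Aut⁰(X) -/

open Filter
noncomputable section
set_option linter.unusedSectionVars false
namespace ProjVar
open MvPolynomial TopologicalSpace

/-- Three generators present A as a quotient of ℤ³ by a sublattice of finite index, and the Smith
normal form splits this quotient into three cyclic factors. -/
theorem exists_equiv_cyc_of_generators {A : Type*} [CommGroup A] [Finite A] (a : Fin 3 → A)
    (h : ∀ x, ∃ n : Fin 3 → ℤ, x = ∏ i, a i ^ n i) :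
    ∃ k l m : ℕ, 0 < k ∧ 0 < l ∧ 0 < m ∧ Nonempty (A ≃* Cyc k × Cyc l × Cyc m) := by
  let f : (Fin 3 → ℤ) →ₗ[ℤ] Additive A :=
    Fintype.linearCombination ℤ fun i => Additive.ofMul (a i)
  have hf : Function.Surjective f := fun x => by
    obtain ⟨n, hn⟩ := h x.toMul
    refine ⟨n, Additive.toMul.injective ?_⟩
    rw [hn]
    simp [f, Fintype.linearCombination_apply]
  let e := f.quotKerEquivOfSurjective hf
  have hfin : Finite ((Fin 3 → ℤ) ⧸ LinearMap.ker f) := Finite.of_equiv _ e.toEquiv.symm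
  have hr := (Submodule.finiteQuotient_iff _).1 hfin
  let b := Pi.basisFun ℤ (Fin 3)
  let e' := e.symm.toAddEquiv.trans (Submodule.quotientEquivPiZMod _ b hr)
  have hd : ∀ i, 0 < (Submodule.smithNormalFormCoeffs b hr i).natAbs := fun i =>
    Int.natAbs_pos.2 (Submodule.smithNormalFormCoeffs_ne_zero b hr i)
  refine ⟨_, _, _, hd 0, hd 1, hd 2, ⟨MulEquiv.ofBijective
    (⟨⟨fun x => (Multiplicative.ofAdd (e' (Additive.ofMul x) 0),
      Multiplicative.ofAdd (e' (Additive.ofMul x) 1),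
      Multiplicative.ofAdd (e' (Additive.ofMul x) 2)), ?_⟩, fun x y => ?_⟩ : A →* _) ⟨?_, ?_⟩⟩⟩
  · rw [ofMul_one, map_zero]
    rfl
  · simp only [ofMul_mul, map_add]
    rfl
  · intro x y hxy
    have h0 : e' (Additive.ofMul x) 0 = e' (Additive.ofMul y) 0 := congrArg (·.1.toAdd) hxy
    have h1 : e' (Additive.ofMul x) 1 = e' (Additive.ofMul y) 1 := congrArg (·.2.1.toAdd) hxy
    have h2 : e' (Additive.ofMul x) 2 = e' (Additive.ofMul y) 2 := congrArg (·.2.2.toAdd) hxy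
    refine Additive.ofMul.injective (e'.injective (funext fun i => ?_))
    fin_cases i <;> assumption
  · rintro ⟨x, y, z⟩
    obtain ⟨u, hu⟩ := e'.surjective
      (Fin.cons x.toAdd (Fin.cons y.toAdd (Fin.cons z.toAdd finZeroElim)))
    refine ⟨u.toMul, ?_⟩
    change (Multiplicative.ofAdd (e' u 0), Multiplicative.ofAdd (e' u 1),
      Multiplicative.ofAdd (e' u 2)) = _
    rw [hu]
    rfl

theorem exists_mul_zpow_mem_ker {A K : Type*} [Group A] [Finite A] [Field K] (f : A →* Kˣ)
    (H : Subgroup A) : ∃ a ∈ H, ∀ x ∈ H, ∃ n : ℤ, f (a ^ (-n) * x) = 1 := by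
  have : Finite (H.map f) := Set.Finite.to_subtype ((Set.toFinite _).image _)
  obtain ⟨⟨_, a, ha, rfl⟩, hg⟩ := IsCyclic.exists_generator (α := H.map f)
  refine ⟨a, ha, fun x hx => ?_⟩
  obtain ⟨n, hn⟩ := hg ⟨f x, x, hx, rfl⟩
  have hn' : f a ^ n = f x := congrArg Subtype.val hn
  exact ⟨n, by rw [map_mul, map_zpow, ← hn', zpow_neg, inv_mul_cancel]⟩

/-- The successive kernels of the three coordinates have cyclic quotients, because finite subgroups
of Kˣ are cyclic. Lifted generators of these quotients generate A. -/
theorem exists_equiv_cyc {A K : Type*} [Group A] [Finite A] [Field K] (f : A →* (Fin 3 → Kˣ))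
    (hf : Function.Injective f) :
    ∃ k l m : ℕ, 0 < k ∧ 0 < l ∧ 0 < m ∧ Nonempty (A ≃* Cyc k × Cyc l × Cyc m) := by
  let f' : ∀ i, A →* Kˣ := fun i => (Pi.evalMonoidHom _ i).comp f
  obtain ⟨a, -, ha⟩ := exists_mul_zpow_mem_ker (f' 0) ⊤
  obtain ⟨b, hb, hb'⟩ := exists_mul_zpow_mem_ker (f' 1) (f' 0).ker
  obtain ⟨c, hc, hc'⟩ := exists_mul_zpow_mem_ker (f' 2) ((f' 0).ker ⊓ (f' 1).ker)
  have hgen : ∀ x, ∃ n : Fin 3 → ℤ, x = a ^ n 0 * b ^ n 1 * c ^ n 2 := fun x => by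
    obtain ⟨n, hn⟩ := ha x trivial
    obtain ⟨m, hm⟩ := hb' _ hn
    have h0 : b ^ (-m) * (a ^ (-n) * x) ∈ (f' 0).ker :=
      Subgroup.mul_mem _ (Subgroup.zpow_mem _ hb _) hn
    obtain ⟨l, hl⟩ := hc' _ ⟨h0, hm⟩
    have h1 : c ^ (-l) * (b ^ (-m) * (a ^ (-n) * x)) = 1 := by
      refine (injective_iff_map_eq_one f).1 hf _ (funext fun i => ?_)
      fin_cases i
      · exact Subgroup.mul_mem (f' 0).ker (Subgroup.zpow_mem _ hc.1 _) h0
      · exact Subgroup.mul_mem (f' 1).ker (Subgroup.zpow_mem _ hc.2 _) hm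
      · exact hl
    refine ⟨![n, m, l], ?_⟩
    simp only [Matrix.cons_val_zero, Matrix.cons_val_one, Matrix.cons_val]
    rw [zpow_neg, zpow_neg, zpow_neg, inv_mul_eq_one] at h1
    rw [mul_assoc, h1]
    group
  let e := MonoidHom.ofInjective hf
  have hfin : Finite f.range := Finite.of_equiv _ e.toEquiv
  -- The range of f replaces A because commutativity is built into its type.
  obtain ⟨k, l, m, hk, hl, hm, ⟨e'⟩⟩ := exists_equiv_cyc_of_generators (A := f.range)
    ![e a, e b, e c] fun x => by
      obtain ⟨n, hn⟩ := hgen (e.symm x)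
      refine ⟨n, ?_⟩
      rw [Fin.prod_univ_three, ← e.apply_symm_apply x, hn]
      simp
  exact ⟨k, l, m, hk, hl, hm, ⟨e.trans e'⟩⟩

namespace ToricCoords

variable {K : Type*} [Field K] {X : Set (ProjSpace K 5)} (C : ToricCoords X) [IsAlgClosed K]

include C in
theorem germ_const_injective {c d : K}
    (h : ((fun _ => c : X → K) : GenericGerm X) = ((fun _ => d : X → K) : GenericGerm X)) :
    c = d := by
  obtain ⟨U, -, hU, h⟩ := germ_eq_iff.1 h
  have : Nonempty X := ⟨C.T_nonempty.some⟩
  obtain ⟨x, hx⟩ := hU.nonempty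
  exact h x hx

/-- An automorphism in Aut⁰ fixes every plane, so the transformed quotient of coordinates has the
same divisor as the original. Their ratio has order zero everywhere and is constant. -/
theorem exists_germMap_rat {φ : RegAut X} (hφ : φ ∈ aut0 X) (k l : Fin 3 × ZMod 2) :
    ∃ c : Kˣ, germMap φ.1 (C.rat k l) = ((fun _ => (c : K) : X → K) : GenericGerm X) * C.rat k l := by
  have hord : ∀ Z : PrimeDivisor X, HasOrd Z (germMap φ.1 (C.rat k l) * C.rat l k) 0 := by
    refine C.forall_primeDivisor (fun s => ?_) fun Z hZ => ?_
    · have h1 := (C.hasOrd_D_rat s k l).map φ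
      rw [C.smul_D_of_mem_aut0 hφ (one_smul (RegAut X) (C.D s)).symm] at h1
      exact (h1.mul (C.hasOrd_D_rat s l k)).congr (by ring)
    · have hW : (((φ⁻¹ • Z).1 : Set X) ∩ C.T).Nonempty := by
        by_contra hc
        obtain ⟨s, hs⟩ := C.exists_eq_D (Set.not_nonempty_iff_eq_empty.1 hc)
        have e : Z = C.D s := by
          rw [← C.smul_D_of_mem_aut0 hφ (one_smul (RegAut X) (C.D s)).symm, ← hs, smul_inv_smul]
        rw [e, C.D_inter_T s] at hZ
        exact Set.not_nonempty_empty hZ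
      have h1 := (C.hasOrd_rat_of_inter_T hW k l).map φ
      rw [smul_inv_smul] at h1
      exact h1.mul (C.hasOrd_rat_of_inter_T hZ l k)
  have hm : ∀ k l, germMap φ.1 (C.rat k l) * germMap φ.1 (C.rat l k) = 1 := fun k l => by
    rw [← map_mul, rat_mul_rat, rat_self, map_one]
  let f : (functionField X)ˣ :=
    { val := ⟨_, germMap_mem_functionField φ (C.rat_mem_functionField k l)⟩
      inv := ⟨_, germMap_mem_functionField φ (C.rat_mem_functionField l k)⟩
      val_inv := Subtype.ext (hm k l)
      inv_val := Subtype.ext (hm l k) }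
  obtain ⟨c, hc, he⟩ := C.eq_const_of_hasOrd 0 (f * C.ratUnit l k) fun Z _ => ⟨0, le_rfl, hord Z⟩
  refine ⟨Units.mk0 c hc, ?_⟩
  have he' : germMap φ.1 (C.rat k l) * C.rat l k = ((fun _ => c : X → K) : GenericGerm X) := he
  rw [Units.val_mk0, ← he', mul_assoc, rat_mul_rat, rat_self, mul_one]

theorem smul_rat_injective {c d : K} {k l : Fin 3 × ZMod 2}
    (h : ((fun _ => c : X → K) : GenericGerm X) * C.rat k l =
      ((fun _ => d : X → K) : GenericGerm X) * C.rat k l) : c = d := by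
  have h1 := congrArg (· * C.rat l k) h
  simp only [mul_assoc, rat_mul_rat, rat_self, mul_one] at h1
  exact C.germ_const_injective h1

/-- The indices of the coordinates of the chart at the origin. -/
def chartIdx : Fin 3 → Fin 3 × ZMod 2 := ![(0, 0), (1, 1), (2, 1)]

/-- The factor by which an automorphism acting trivially on the class group multiplies a quotient
of coordinates. -/
def factor (φ : aut0 X) (k l : Fin 3 × ZMod 2) : Kˣ := (C.exists_germMap_rat φ.2 k l).choose

theorem germMap_rat (φ : aut0 X) (k l : Fin 3 × ZMod 2) : germMap φ.1.1 (C.rat k l) =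
    ((fun _ => (C.factor φ k l : K) : X → K) : GenericGerm X) * C.rat k l :=
  (C.exists_germMap_rat φ.2 k l).choose_spec

theorem factor_mul (φ ψ : aut0 X) (k l : Fin 3 × ZMod 2) :
    C.factor (φ * ψ) k l = C.factor φ k l * C.factor ψ k l := by
  refine Units.ext (C.smul_rat_injective (k := k) (l := l) ?_)
  rw [← germMap_rat]
  change germMap (φ.1.1 * ψ.1.1) _ = _
  rw [← germMap_germMap, germMap_rat, map_mul, germMap_rat, ← mul_assoc, mul_comm (C.factor φ k l)]
  rfl

/-- The action on the chart at the origin of the automorphisms acting trivially on the class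
group. -/
def toTorus : aut0 X →* (Fin 3 → Kˣ) :=
  MonoidHom.mk' (fun φ i => C.factor φ (chartIdx i) (0, 1))
    fun φ ψ => funext fun _ => C.factor_mul φ ψ _ _

include C in
-- One linear form is nonzero at both points, so fractions with this denominator are regular at p
-- and at φ p simultaneously; this plays the role of separatedness in `eq_one_of_dense`.
theorem exists_form_ne (p q : X) : ∃ F : MvPolynomial (Fin 6) K, F.IsHomogeneous 1 ∧
    evalAt p.1 F ≠ 0 ∧ evalAt q.1 F ≠ 0 := by
  obtain ⟨k, hk⟩ := C.exists_cd_ne p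
  obtain ⟨l, hl⟩ := C.exists_cd_ne q
  by_cases h1 : C.cd q k = 0
  · by_cases h2 : C.cd p l = 0
    · refine ⟨C.form k + C.form l, (C.form_isHomogeneous k).add (C.form_isHomogeneous l), ?_, ?_⟩
      · rw [evalAt, map_add]
        change evalAt p.1 _ + evalAt p.1 _ ≠ 0
        rwa [evalAt_form, evalAt_form, h2, add_zero]
      · rw [evalAt, map_add]
        change evalAt q.1 _ + evalAt q.1 _ ≠ 0
        rwa [evalAt_form, evalAt_form, h1, zero_add]
    · exact ⟨C.form l, C.form_isHomogeneous l, by rwa [evalAt_form], by rwa [evalAt_form]⟩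
  · exact ⟨C.form k, C.form_isHomogeneous k, by rwa [evalAt_form], by rwa [evalAt_form]⟩

include C in
/-- An automorphism which is the identity on a dense set is the identity. -/
theorem eq_one_of_dense {φ : RegAut X} {V : Set X} (hV : Dense V) (h : ∀ x ∈ V, φ.1 x = x) :
    φ = 1 := by
  refine Subtype.ext (Homeomorph.ext fun p => ?_)
  obtain ⟨F, hF, h1, h2⟩ := C.exists_form_ne p (φ.1 p)
  refine C.eq_of_cd (a := evalAt (φ.1 p).1 F / evalAt p.1 F) fun k => ?_
  have hr : ∀ q : X, evalAt q.1 F ≠ 0 →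
      IsRegularAt (fun x : X => evalAt x.1 (C.form k) / evalAt x.1 F) q :=
    fun q hq => isRegularAt_div (C.form_isHomogeneous k) hF hq
  have := IsRegularAt.eq_of_dense ((φ.2 _ p).2 (hr _ h2)) (hr p h1) hV fun x hx => by
    rw [Function.comp_apply, h x hx]
  simp only [Function.comp_apply, evalAt_form] at this
  rw [div_eq_iff h2] at this
  rw [this]
  change _ = _ * C.cd p k
  ring

theorem toTorus_injective : Function.Injective C.toTorus := by
  rw [injective_iff_map_eq_one]
  intro φ hφ
  have h : ∀ i, germMap φ.1.1 (C.rat (chartIdx i) (0, 1)) = C.rat (chartIdx i) (0, 1) := fun i => by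
    have h1 : C.factor φ (chartIdx i) (0, 1) = 1 := congrFun hφ i
    rw [germMap_rat, h1]
    exact one_mul _
  have h' : ∀ i, ∃ U : Set X, IsOpen U ∧ Dense U ∧ ∀ x ∈ U,
      C.ratFun (chartIdx i) (0, 1) (φ.1.1.symm x) = C.ratFun (chartIdx i) (0, 1) x :=
    fun i => germ_eq_iff.1 (h i)
  choose U hU hUd hUe using h'
  have hT : IsOpen (φ.1.1 '' C.T) := φ.1.1.isOpenMap _ C.isOpen_T
  have hTd : Dense (φ.1.1 '' C.T) :=
    C.dense_of_isOpen hT (C.T_nonempty.image _)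
  have hV : Dense (U 0 ∩ (U 1 ∩ (U 2 ∩ (C.T ∩ φ.1.1 '' C.T)))) :=
    (hUd 0).inter_of_isOpen_left ((hUd 1).inter_of_isOpen_left ((hUd 2).inter_of_isOpen_left
      (C.dense_T.inter_of_isOpen_left hTd C.isOpen_T) (hU 2)) (hU 1)) (hU 0)
  -- `germMap φ` composes with the inverse of φ, so it is the inverse that is seen to fix the chart
  -- coordinates on a dense open set.
  refine Subtype.ext (inv_eq_one.1 (C.eq_one_of_dense hV ?_))
  rintro x ⟨h0, h1, h2, hx, y, hy, hyx⟩
  have e : (φ.1⁻¹).1 x = φ.1.1.symm x := rfl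
  rw [e]
  have hy' : φ.1.1.symm x ∈ C.T := by rwa [← hyx, Homeomorph.symm_apply_apply]
  refine C.eq_of_c_eq 0 (C.T_subset_U 0 hy') (C.T_subset_U 0 hx) (funext fun i => ?_)
  fin_cases i
  · exact hUe 0 x h0
  · exact hUe 1 x h1
  · exact hUe 2 x h2

include C in
theorem exists_ker_equiv_cyc (G : Subgroup (RegAut X)) [Finite G] :
    ∃ k l m : ℕ, 0 < k ∧ 0 < l ∧ 0 < m ∧
      Nonempty (((toAutHat X).subgroupMap G).ker ≃* Cyc k × Cyc l × Cyc m) := by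
  have hmem : ∀ g : ((toAutHat X).subgroupMap G).ker, g.1.1 ∈ aut0 X := fun g =>
    (QuotientGroup.eq_one_iff _).1 (congrArg Subtype.val (MonoidHom.mem_ker.1 g.2))
  let i : ((toAutHat X).subgroupMap G).ker →* aut0 X :=
    (G.subtype.comp (Subgroup.subtype _)).codRestrict (aut0 X) hmem
  refine exists_equiv_cyc (C.toTorus.comp i) (C.toTorus_injective.comp fun a b hab => ?_)
  exact Subtype.ext (Subtype.ext (congrArg (fun x : aut0 X => x.1) hab))

end ToricCoords

end ProjVar
end

/-! ### Reduction of the pencil to toric form -/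

open Filter
noncomputable section
set_option linter.unusedSectionVars false
namespace ProjVar
open MvPolynomial TopologicalSpace

theorem sum_zmod_two {M : Type*} [AddCommMonoid M] (f : ZMod 2 → M) :
    ∑ a, f a = f 0 + f 1 := Fin.sum_univ_two f

/-- Only the shape of the symbol enters: three brackets are three distinct roots, and a bracket of
length two is corank two, that is rank four. -/
theorem exists_roots {K : Type*} [Field K] {A B : Matrix (Fin 6) (Fin 6) K}
    (h : segreSymbol A B = {[1, 1], [1, 1], [1, 1]}) :
    ∃ t : Fin 3 → K, Function.Injective t ∧ ∀ i, (A + t i • B).rank = 4 := by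
  classical
  rw [segreSymbol] at h
  set R := (pencil A B).det.roots.toFinset with hR
  have hcard : R.card = 3 := by
    have := congrArg Multiset.card h
    rw [Multiset.card_map] at this
    exact this
  have hrank : ∀ t ∈ R, (A + t • B).rank = 4 := fun t ht => by
    have h1 : charNumbers A B t ∈ R.val.map (charNumbers A B) := Multiset.mem_map_of_mem _ ht
    have h2 : charNumbers A B t = [1, 1] := by
      have h3 : charNumbers A B t ∈ ({[1, 1], [1, 1], [1, 1]} : Multiset (List ℕ)) := by
        rw [← h]
        convert h1
      simpa using h3
    have h3 := congrArg List.length h2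
    simp only [charNumbers, List.length_map, List.length_range, List.length_cons,
      List.length_nil] at h3
    omega
  let e := (Finset.equivFinOfCardEq hcard).symm
  exact ⟨fun i => (e i).1, Subtype.val_injective.comp e.injective, fun i => hrank _ (e i).2⟩

/-- An isotropic vector u comes from solving a quadratic equation. Nondegeneracy supplies v with β u
v ≠ 0, which is then rescaled and corrected by a multiple of u. -/
theorem exists_hyperbolic_pair {K V : Type*} [Field K] [IsAlgClosed K] [CharZero K]
    [AddCommGroup V] [Module K V] (β : LinearMap.BilinForm K V) (hβ : ∀ u v, β u v = β v u)
    (E : Submodule K V) (hE : Module.finrank K E = 2)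
    (hn : ∀ u ∈ E, (∀ v ∈ E, β u v = 0) → u = 0) (s : K) :
    ∃ u ∈ E, ∃ w ∈ E, β u u = 0 ∧ β w w = 0 ∧ β u w = s := by
  have hex : ∃ u ∈ E, u ≠ 0 ∧ β u u = 0 := by
    have : Module.Finite K E := Module.finite_of_finrank_eq_succ hE
    let b := Module.finBasisOfFinrankEq K E hE
    have hb : ∀ i, (b i : V) ≠ 0 := fun i h => b.ne_zero i (Subtype.ext h)
    by_cases ha : β (b 0) (b 0) = 0
    · exact ⟨b 0, (b 0).2, hb 0, ha⟩
    · obtain ⟨r, hr⟩ := IsAlgClosed.exists_root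
        (Polynomial.C (β (b 0) (b 0)) * Polynomial.X ^ 2 +
          Polynomial.C (2 * β (b 0) (b 1)) * Polynomial.X + Polynomial.C (β (b 1) (b 1)))
        (by rw [Polynomial.degree_quadratic ha]; norm_num)
      refine ⟨r • (b 0 : V) + b 1, add_mem (E.smul_mem r (b 0).2) (b 1).2, fun h => ?_, ?_⟩
      · have h1 := Fintype.linearIndependent_iff.1 b.linearIndependent ![r, 1] (by
          rw [Fin.sum_univ_two]
          exact Subtype.ext (by simpa using h)) 1
        simp at h1
      · simp only [Polynomial.IsRoot, Polynomial.eval_add, Polynomial.eval_mul, Polynomial.eval_C,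
          Polynomial.eval_pow, Polynomial.eval_X] at hr
        simp only [map_add, map_smul, LinearMap.add_apply, LinearMap.smul_apply, smul_eq_mul]
        rw [hβ (b 1) (b 0)]
        linear_combination hr
  obtain ⟨u, hu, hu0, huu⟩ := hex
  obtain ⟨v, hv, huv⟩ : ∃ v ∈ E, β u v ≠ 0 := by
    by_contra! h
    exact hu0 (hn u hu h)
  let c := s / β u v
  -- The scaling c gives the product s with u. Adding multiples of u does not change that product,
  -- and this multiple cancels β w w.
  refine ⟨u, hu, c • v - (c * β v v / (2 * β u v)) • u, sub_mem (E.smul_mem _ hv) (E.smul_mem _ hu),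
    huu, ?_, ?_⟩
  · simp only [map_sub, map_smul, LinearMap.sub_apply, LinearMap.smul_apply, smul_eq_mul]
    rw [huu, hβ v u]
    field_simp
    ring
  · simp only [map_sub, map_smul, smul_eq_mul]
    rw [huu, mul_zero, sub_zero]
    exact div_mul_cancel₀ _ huv

/-- The spaces E i behave as eigenspaces of α relative to β with distinct eigenvalues −t i: they are
orthogonal for β, independent, and of total dimension 2 + 2 + 2 = 6. Hence β is nondegenerate on
each, and hyperbolic pairs in the three spaces form the basis. -/
theorem exists_pencil_basis {K V : Type*} [Field K] [IsAlgClosed K] [CharZero K]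
    [AddCommGroup V] [Module K V] (hV : Module.finrank K V = 6) (α β : LinearMap.BilinForm K V)
    (hα : ∀ u v, α u v = α v u) (hβ : ∀ u v, β u v = β v u)
    (hn : ∀ u, (∀ v, β v u = 0) → u = 0) (t s : Fin 3 → K) (ht : Function.Injective t)
    (hs : ∀ i, s i ≠ 0) (E : Fin 3 → Submodule K V) (hE : ∀ i, Module.finrank K (E i) = 2)
    (hmem : ∀ i u, u ∈ E i ↔ ∀ v, α v u + t i * β v u = 0) :
    ∃ b : Module.Basis (Fin 3 × ZMod 2) K V, ∀ v,
      β v v = 2 * ∑ i, s i * (b.repr v (i, 0) * b.repr v (i, 1)) ∧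
      α v v = -2 * ∑ i, t i * s i * (b.repr v (i, 0) * b.repr v (i, 1)) := by
  have : Module.Finite K V := Module.finite_of_finrank_eq_succ hV
  have horth : ∀ i j, i ≠ j → ∀ u ∈ E i, ∀ v ∈ E j, β u v = 0 := fun i j hij u hu v hv => by
    have h1 := (hmem i u).1 hu v
    have h2 := (hmem j v).1 hv u
    rw [hα v u, hβ v u] at h1
    have h3 : (t i - t j) * β u v = 0 := by linear_combination h1 - h2
    exact (mul_eq_zero.1 h3).resolve_left (sub_ne_zero.2 (ht.ne hij))
  have hdisj : ∀ i j, i ≠ j → E i ⊓ E j = ⊥ := fun i j hij => by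
    rw [eq_bot_iff]
    rintro u ⟨hi, hj⟩
    refine hn u fun v => ?_
    have h1 := (hmem i u).1 hi v
    have h2 := (hmem j u).1 hj v
    have h3 : (t i - t j) * β v u = 0 := by linear_combination h1 - h2
    exact (mul_eq_zero.1 h3).resolve_left (sub_ne_zero.2 (ht.ne hij))
  have hdisj' : (E 0 ⊔ E 1) ⊓ E 2 = ⊥ := by
    rw [eq_bot_iff]
    rintro z ⟨hz, hz2⟩
    obtain ⟨x, hx, y, hy, rfl⟩ := Submodule.mem_sup.1 hz
    -- Subtracting the relations for x in E 0 and y in E 1 from the relation for x + y in E 2 shows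
    -- that this combination is in the radical of β.
    have h1 : (t 2 - t 0) • x + (t 2 - t 1) • y = 0 := hn _ fun v => by
      have h1 := (hmem 0 x).1 hx v
      have h2 := (hmem 1 y).1 hy v
      have h3 := (hmem 2 _).1 hz2 v
      simp only [map_add, map_smul, smul_eq_mul] at h3 ⊢
      linear_combination h3 - h1 - h2
    have h2 : (t 2 - t 0) • x ∈ E 0 ⊓ E 1 :=
      ⟨(E 0).smul_mem _ hx, by rw [eq_neg_of_add_eq_zero_left h1]; exact neg_mem ((E 1).smul_mem _ hy)⟩
    rw [hdisj 0 1 (by decide), Submodule.mem_bot] at h2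
    have hx0 : x = 0 := (smul_eq_zero.1 h2).resolve_left (sub_ne_zero.2 (ht.ne (by decide)))
    rw [h2, zero_add] at h1
    have hy0 : y = 0 := (smul_eq_zero.1 h1).resolve_left (sub_ne_zero.2 (ht.ne (by decide)))
    rw [hx0, hy0, add_zero]
    exact zero_mem _
  have htop : E 0 ⊔ E 1 ⊔ E 2 = ⊤ := by
    refine Submodule.eq_top_of_finrank_eq ?_
    have h1 := Submodule.finrank_sup_add_finrank_inf_eq (E 0) (E 1)
    have h2 := Submodule.finrank_sup_add_finrank_inf_eq (E 0 ⊔ E 1) (E 2)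
    rw [hdisj 0 1 (by decide), finrank_bot] at h1
    rw [hdisj', finrank_bot] at h2
    have h3 := hE 0
    have h4 := hE 1
    have h5 := hE 2
    omega
  have hnE : ∀ i, ∀ u ∈ E i, (∀ v ∈ E i, β u v = 0) → u = 0 := fun i u hu h => by
    refine hn u fun v => ?_
    have hv : v ∈ E 0 ⊔ E 1 ⊔ E 2 := htop ▸ trivial
    have hall : ∀ j, ∀ w ∈ E j, β w u = 0 := fun j w hw => by
      by_cases hij : j = i
      · subst hij
        rw [hβ]
        exact h w hw
      · exact horth j i hij w hw u hu
    obtain ⟨z', hz', z, hz, rfl⟩ := Submodule.mem_sup.1 hv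
    obtain ⟨x, hx, y, hy, rfl⟩ := Submodule.mem_sup.1 hz'
    simp only [map_add, LinearMap.add_apply]
    rw [hall 0 x hx, hall 1 y hy, hall 2 z hz, add_zero, add_zero]
  have hp := fun i => exists_hyperbolic_pair β hβ (E i) (hE i) (hnE i) (s i)
  choose u hu w hw huu hww huw using hp
  let e : Fin 3 × ZMod 2 → V := fun k => if k.2 = 0 then u k.1 else w k.1
  have e0 : ∀ i, e (i, 0) = u i := fun i => if_pos rfl
  have e1 : ∀ i, e (i, 1) = w i := fun i => if_neg one_ne_zero
  have hsum : ∀ (y : Fin 3 × ZMod 2 → K), ∑ k, y k • e k =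
      ∑ i, (y (i, 0) • u i + y (i, 1) • w i) := fun y => by
    rw [Fintype.sum_prod_type]
    refine Finset.sum_congr rfl fun i _ => ?_
    rw [sum_zmod_two, e0, e1]
  have hpair : ∀ (y : Fin 3 × ZMod 2 → K) (j : Fin 3),
      β (u j) (∑ k, y k • e k) = s j * y (j, 1) ∧ β (w j) (∑ k, y k • e k) = s j * y (j, 0) := by
    intro y j
    rw [hsum, map_sum, map_sum, Finset.sum_eq_single j, Finset.sum_eq_single j]
    · simp only [map_add, map_smul, smul_eq_mul]
      rw [huu, hww, huw, hβ (w j), huw]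
      constructor <;> ring
    · intro i _ hij
      simp only [map_add, map_smul, smul_eq_mul]
      rw [horth j i hij.symm _ (hw j) _ (hu i), horth j i hij.symm _ (hw j) _ (hw i)]
      ring
    · simp
    · intro i _ hij
      simp only [map_add, map_smul, smul_eq_mul]
      rw [horth j i hij.symm _ (hu j) _ (hu i), horth j i hij.symm _ (hu j) _ (hw i)]
      ring
    · simp
  have hli : LinearIndependent K e := by
    rw [Fintype.linearIndependent_iff]
    rintro y hy ⟨j, ε⟩
    obtain ⟨h1, h2⟩ := hpair y j
    rw [hy, map_zero] at h1 h2
    rcases ZMod.two_cases ε with rfl | rfl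
    · exact (mul_eq_zero.1 h2.symm).resolve_left (hs j)
    · exact (mul_eq_zero.1 h1.symm).resolve_left (hs j)
  let b := basisOfLinearIndependentOfCardEqFinrank hli (by
    rw [hV, Fintype.card_prod, ZMod.card, Fintype.card_fin])
  have hb : ∀ k, b k = e k := fun k => by simp [b]
  refine ⟨b, fun v => ?_⟩
  set y := b.repr v with hy
  have hv : v = ∑ k, y k • e k := by
    conv_lhs => rw [← b.sum_repr v]
    exact Finset.sum_congr rfl fun k _ => by rw [hb]
  have hv' := hv.trans (hsum y)
  have hβv : ∀ j, β v (u j) = s j * y (j, 1) ∧ β v (w j) = s j * y (j, 0) := fun j => by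
    rw [hβ v, hβ v, hv]
    exact hpair y j
  have hαv : ∀ j, α v (u j) = -(t j * (s j * y (j, 1))) ∧
      α v (w j) = -(t j * (s j * y (j, 0))) := fun j => by
    have h1 := (hmem j _).1 (hu j) v
    have h2 := (hmem j _).1 (hw j) v
    rw [(hβv j).1] at h1
    rw [(hβv j).2] at h2
    exact ⟨eq_neg_of_add_eq_zero_left h1, eq_neg_of_add_eq_zero_left h2⟩
  have hγ : ∀ (γ : LinearMap.BilinForm K V) (x : V),
      γ x v = ∑ i, (y (i, 0) * γ x (u i) + y (i, 1) * γ x (w i)) := fun γ x => by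
    conv_lhs => rw [hv']
    simp only [map_sum, map_add, map_smul, smul_eq_mul]
  constructor
  · rw [hγ, Finset.mul_sum]
    refine Finset.sum_congr rfl fun i _ => ?_
    rw [(hβv i).1, (hβv i).2]
    ring
  · rw [hγ, Finset.mul_sum]
    refine Finset.sum_congr rfl fun i _ => ?_
    rw [(hαv i).1, (hαv i).2]
    ring

theorem nonempty_toricCoords {K : Type*} [Field K] [IsAlgClosed K] [CharZero K]
    {A B : Matrix (Fin 6) (Fin 6) K} (hA : A.IsSymm) (hB : B.IsSymm) (hBdet : B.det ≠ 0)
    (hσ : segreSymbol A B = {[1, 1], [1, 1], [1, 1]}) :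
    Nonempty (ToricCoords (quadricIntersection A B)) := by
  obtain ⟨t, ht, hrank⟩ := exists_roots hσ
  have hsymm : ∀ {M : Matrix (Fin 6) (Fin 6) K}, M.IsSymm → ∀ u v,
      Matrix.toBilin' M u v = Matrix.toBilin' M v u := fun {M} hM u v => by
    rw [Matrix.toBilin'_apply', Matrix.toBilin'_apply', Matrix.dotProduct_mulVec,
      ← Matrix.mulVec_transpose, hM.eq, dotProduct_comm]
  -- The scaling is chosen so that ∑ sᵢ = 0 and ∑ tᵢsᵢ = 0. The two equations ∑ sᵢzᵢ = ∑ tᵢsᵢzᵢ = 0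
  -- in the products zᵢ then say precisely that the zᵢ are equal.
  let s : Fin 3 → K := ![t 1 - t 2, t 2 - t 0, t 0 - t 1]
  have hs : ∀ i, s i ≠ 0 := fun i => by
    fin_cases i <;> exact sub_ne_zero.2 (ht.ne (by decide))
  have hn : ∀ u, (∀ v, Matrix.toBilin' B v u = 0) → u = 0 := fun u hu => by
    refine Matrix.eq_zero_of_mulVec_eq_zero hBdet (dotProduct_eq_zero _ fun v => ?_)
    rw [dotProduct_comm, ← Matrix.toBilin'_apply']
    exact hu v
  have hE : ∀ i, Module.finrank K (LinearMap.ker (A + t i • B).mulVecLin) = 2 := fun i => by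
    have h1 := LinearMap.finrank_range_add_finrank_ker (A + t i • B).mulVecLin
    have h2 : Module.finrank K (LinearMap.range (A + t i • B).mulVecLin) = 4 := hrank i
    rw [h2, Module.finrank_fin_fun] at h1
    omega
  have hmem : ∀ i u, u ∈ LinearMap.ker (A + t i • B).mulVecLin ↔
      ∀ v, Matrix.toBilin' A v u + t i * Matrix.toBilin' B v u = 0 := fun i u => by
    have h1 : ∀ v, Matrix.toBilin' A v u + t i * Matrix.toBilin' B v u =
        v ⬝ᵥ (A + t i • B).mulVec u := fun v => by
      rw [Matrix.toBilin'_apply', Matrix.toBilin'_apply', Matrix.add_mulVec, Matrix.smul_mulVec,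
        dotProduct_add, dotProduct_smul, smul_eq_mul]
    simp only [h1, LinearMap.mem_ker, Matrix.mulVecLin_apply]
    constructor
    · intro h v
      rw [h, dotProduct_zero]
    · intro h
      exact dotProduct_eq_zero _ fun v => by rw [dotProduct_comm, h]
  obtain ⟨b, hb⟩ := exists_pencil_basis (Module.finrank_fin_fun K) (Matrix.toBilin' A)
    (Matrix.toBilin' B) (hsymm hA) (hsymm hB) hn t s ht hs _ hE hmem
  refine ⟨⟨b.equivFun, fun p => ?_⟩⟩
  obtain ⟨h1, h2⟩ := hb (Projectivization.rep p)
  rw [Matrix.toBilin'_apply'] at h1 h2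
  change (Projectivization.rep p ⬝ᵥ A.mulVec (Projectivization.rep p) = 0 ∧
    Projectivization.rep p ⬝ᵥ B.mulVec (Projectivization.rep p) = 0) ↔ _
  rw [h1, h2]
  simp only [Module.Basis.equivFun_apply]
  generalize b.repr (Projectivization.rep p) = y
  have h01 : t 0 - t 1 ≠ 0 := hs 2
  have h20 : t 2 - t 0 ≠ 0 := hs 1
  have h12 : t 1 - t 2 ≠ 0 := hs 0
  simp only [Fin.sum_univ_three, s, Matrix.cons_val_zero, Matrix.cons_val_one, Matrix.cons_val]
  constructor
  · rintro ⟨h3, h4⟩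
    have e1 : y (1, 0) * y (1, 1) = y (0, 0) * y (0, 1) := by
      refine mul_left_cancel₀ (mul_ne_zero (mul_ne_zero two_ne_zero h20) h12) ?_
      linear_combination -h3 - t 2 * h4
    have e2 : y (2, 0) * y (2, 1) = y (0, 0) * y (0, 1) := by
      refine mul_left_cancel₀ (mul_ne_zero (mul_ne_zero two_ne_zero h01) h12) ?_
      linear_combination h3 + t 1 * h4
    intro i
    fin_cases i
    · rfl
    · exact e1
    · exact e2
  · intro h
    rw [h 1, h 2]
    constructor <;> ring

end ProjVar
end

open Filter
noncomputable section
set_option linter.unusedSectionVars false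
namespace ProjVar

/-! ### Subgroups of the symmetry group of the cube -/

instance : Fintype C2CubedS3 := Fintype.ofEquiv _ SemidirectProduct.equivProd.symm

instance : Fintype C2CubedC3 := Fintype.ofEquiv _ SemidirectProduct.equivProd.symm

instance : DecidableEq C2CubedS3 := fun x y =>
  decidable_of_iff (x.left = y.left ∧ x.right = y.right) SemidirectProduct.ext_iff.symm

instance : DecidableEq C2CubedC3 := fun x y =>
  decidable_of_iff (x.left = y.left ∧ x.right = y.right) SemidirectProduct.ext_iff.symm

/-- The element `(a, π)` of `C₂³ ⋊ S₃`, with `a` written additively. -/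
def el (a : Cube) (π : Equiv.Perm (Fin 3)) : C2CubedS3 := ⟨fun i => Multiplicative.ofAdd (a i), π⟩

/-- The transposition of the last two coordinates. -/
def tau : Equiv.Perm (Fin 3) := Equiv.swap 1 2

/-- The generator is a quarter turn of the facet where the first coordinate is 0; its square flips
the last two coordinates. -/
def homC4 : Cyc 4 →* C2CubedS3 where
  toFun x := el ![0, 1, 0] tau ^ x.toAdd.val
  map_one' := by decide +kernel
  map_mul' := by decide +kernel

def homC2C2 : Cyc 2 × Cyc 2 →* C2CubedS3 where
  toFun x := el ![0, x.1.toAdd, x.2.toAdd] 1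
  map_one' := by decide +kernel
  map_mul' := by decide +kernel

/-- The function on the dihedral group defined by the images of two generators. -/
def dihedralMap {G : Type*} [Group G] (ρ σ : G) : DihedralGroup 4 → G
  | .r i => ρ ^ i.val
  | .sr i => σ * ρ ^ i.val

/-- The three copies of D₈ all have linear parts 1 and `tau`. The first preserves a facet. The other
two are transitive: in the second `tau` accompanies a flip of the first coordinate, in the third an
odd number of flips. -/
def homD8 : DihedralGroup 4 →* C2CubedS3 where
  toFun := dihedralMap (el ![0, 1, 0] tau) (el 0 tau)
  map_one' := by decide +kernel
  map_mul' := by decide +kernel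

def homD8' : DihedralGroup 4 →* C2CubedS3 where
  toFun := dihedralMap (el ![1, 1, 0] tau) (el ![1, 0, 0] tau)
  map_one' := by decide +kernel
  map_mul' := by decide +kernel

def homD8'' : DihedralGroup 4 →* C2CubedS3 where
  toFun := dihedralMap (el ![0, 1, 0] tau) (el ![1, 0, 0] tau)
  map_one' := by decide +kernel
  map_mul' := by decide +kernel

def homC4C2 : Cyc 4 × Cyc 2 →* C2CubedS3 where
  toFun x := homC4 x.1 * el ![x.2.toAdd, 0, 0] 1
  map_one' := by decide +kernel
  map_mul' := by decide +kernel

def homC2C2C2 : Cyc 2 × Cyc 2 × Cyc 2 →* C2CubedS3 where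
  toFun x := el ![x.1.toAdd, x.2.1.toAdd, x.2.2.toAdd] 1
  map_one' := by decide +kernel
  map_mul' := by decide +kernel

def homD8C2 : DihedralGroup 4 × Cyc 2 →* C2CubedS3 where
  toFun x := homD8 x.1 * el ![x.2.toAdd, 0, 0] 1
  map_one' := by decide +kernel
  map_mul' := by decide +kernel

/-- The splitting of four points into two pairs defined by a pair. -/
def splitting (a b : Fin 4) : Fin 3 := Fin.ofNat 3 (Nat.xor a.val b.val + 2)

/-- The action of `S₄` on the splittings of four points into two pairs. -/
def permSplitting (σ : Equiv.Perm (Fin 4)) : Equiv.Perm (Fin 3) where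
  -- The splitting number i pairs 0 with i + 1. The xor of a pair equals that of the complementary
  -- pair and takes the values 1, 2, 3, which `splitting` shifts to 0, 1, 2.
  toFun i := splitting (σ 0) (σ i.succ)
  invFun i := splitting (σ⁻¹ 0) (σ⁻¹ i.succ)
  left_inv := by revert σ; decide +kernel
  right_inv := by revert σ; decide +kernel

/-- The representation of `S₄` as the rotation group of the cube. -/
def homS4 : Equiv.Perm (Fin 4) →* C2CubedS3 where
  -- The first summand has either no or exactly two entries 1. The second flips all three
  -- coordinates when σ is odd, so the parity of the number of flips is that of σ.
  toFun σ := el (fun i => (if σ⁻¹ 0 = 0 ∨ σ⁻¹ 0 = ((permSplitting σ)⁻¹ i).succ then 0 else 1) +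
    if Equiv.Perm.sign σ = 1 then 0 else 1) (permSplitting σ)
  map_one' := by decide +kernel
  map_mul' := by decide +kernel

def homC2CubedC3 : C2CubedC3 →* C2CubedS3 where
  toFun x := ⟨x.left, x.right⟩
  map_one' := rfl
  map_mul' _ _ := rfl

theorem homC4_injective : Function.Injective homC4 := by decide +kernel
theorem homC2C2_injective : Function.Injective homC2C2 := by decide +kernel
theorem homD8_injective : Function.Injective homD8 := by decide +kernel
theorem homD8'_injective : Function.Injective homD8' := by decide +kernel
theorem homD8''_injective : Function.Injective homD8'' := by decide +kernel
theorem homC4C2_injective : Function.Injective homC4C2 := by decide +kernel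
theorem homC2C2C2_injective : Function.Injective homC2C2C2 := by decide +kernel
theorem homD8C2_injective : Function.Injective homD8C2 := by decide +kernel
theorem homS4_injective : Function.Injective homS4 :=
  (injective_iff_map_eq_one _).2 (by decide +kernel)
theorem homC2CubedC3_injective : Function.Injective homC2CubedC3 :=
  (injective_iff_map_eq_one _).2 (by decide +kernel)

end ProjVar
end

/-! ### Orbits of minimal groups and the facet case -/

open Filter
noncomputable section
set_option linter.unusedSectionVars false
namespace ProjVar

theorem exists_el (w : C2CubedS3) : ∃ a π, w = el a π := ⟨fun i => (w.left i).toAdd, w.right, rfl⟩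

theorem el_mul (a b : Cube) (π σ : Equiv.Perm (Fin 3)) :
    el a π * el b σ = el (fun i => a i + b (π⁻¹ i)) (π * σ) := rfl

theorem ext_el {H R : Subgroup C2CubedS3} (h : ∀ a π, el a π ∈ H ↔ el a π ∈ R) : H = R :=
  SetLike.ext fun w => by
    obtain ⟨a, π, rfl⟩ := exists_el w
    exact h a π

theorem act_el (a : Cube) (π : Equiv.Perm (Fin 3)) (s : Cube) :
    act (el a π) s = fun i => a i + s (π⁻¹ i) := funext fun _ => add_comm _ _

/-- `el a π` carries the vertex 0 to a, so the hypothesis says that 0 has the whole cube as its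
orbit, and invariant functions are constant. -/
theorem isMinimalSym_of_transitive {H : Subgroup C2CubedS3} (hH : ∀ a, ∃ π, el a π ∈ H) :
    IsMinimalSym H := by
  intro h hh
  have h1 : ∀ s, h s = h 0 := fun s => by
    obtain ⟨π, hπ⟩ := hH s
    rw [← hh _ hπ 0, act_el]
    congr 1
    ext i
    simp
  intro s
  rw [h1 s]
  simp [h1 (Pi.single _ _)]

/-- The elements over the facet move the vertex with only its first coordinate kept to any vertex
with the same first coordinate. An invariant function thus depends on one binary coordinate only,
and every such function is affine. -/
theorem isMinimalSym_of_facet {H : Subgroup C2CubedS3} (h0 : ∀ a π, el a π ∈ H → π 0 = 0)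
    (hH : ∀ a : Cube, a 0 = 0 → ∃ π, el a π ∈ H) : IsMinimalSym H := by
  intro h hh
  have h1 : ∀ s : Cube, h s = h (Pi.single 0 (s 0)) := fun s => by
    obtain ⟨π, hπ⟩ := hH (Function.update s 0 0) (Function.update_self _ _ _)
    rw [← hh _ hπ (Pi.single 0 (s 0)), act_el]
    congr 1
    ext i
    have hπ0 : π⁻¹ 0 = 0 := by rw [Equiv.Perm.inv_eq_iff_eq, h0 _ _ hπ]
    by_cases hi : i = 0
    · subst hi
      simp [hπ0]
    · have : π⁻¹ i ≠ 0 := fun e => hi (by rw [Equiv.Perm.inv_eq_iff_eq, h0 _ _ hπ] at e; exact e)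
      rw [Pi.single_eq_of_ne this, Function.update_of_ne hi, add_zero]
  intro s
  rw [h1 s, Fin.sum_univ_three, h1 (Pi.single 1 1), h1 (Pi.single 2 1)]
  rcases ZMod.two_cases (s 0) with e | e <;> simp [e]

/-- The indicator of the orbit of 0 is invariant, hence affine. An affine function with values 0 and
1 on the cube which is 1 at the origin is constant or vanishes on exactly one facet, one not
containing the origin. -/
theorem IsMinimalSym.cases {H : Subgroup C2CubedS3} (hH : IsMinimalSym H) :
    (∀ a, ∃ π, el a π ∈ H) ∨ ∃ i, ∀ a : Cube, (∃ π, el a π ∈ H) ↔ a i = 0 := by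
  classical
  let h : Cube → ℤ := fun s => if ∃ π, el s π ∈ H then 1 else 0
  have hinv : ∀ w ∈ H, ∀ s, h (act w s) = h s := by
    intro w hw s
    obtain ⟨a, σ, rfl⟩ := exists_el w
    have : (∃ π, el (act (el a σ) s) π ∈ H) ↔ ∃ π, el s π ∈ H := by
      rw [act_el]
      constructor
      · rintro ⟨π, hπ⟩
        refine ⟨σ⁻¹ * π, (H.mul_mem_cancel_left hw).1 ?_⟩
        rw [el_mul, mul_inv_cancel_left]
        exact hπ
      · rintro ⟨π, hπ⟩
        exact ⟨_, H.mul_mem hw hπ⟩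
    simp only [h, this]
  have haff := hH h hinv
  have h0 : h 0 = 1 := if_pos ⟨1, H.one_mem⟩
  have hv : ∀ s, h s = 0 ∨ h s = 1 := fun s => by
    simp only [h]
    split_ifs <;> simp
  have hmem : ∀ s, (∃ π, el s π ∈ H) ↔ h s = 1 := fun s => by
    simp only [h]
    split_ifs with e <;> simp [e]
  simp only [hmem]
  have haff' : ∀ s, h s = 1 + ∑ i, if s i = 0 then 0 else h (Pi.single i 1) - 1 := fun s => by
    rw [haff s, h0]
  have h1 := haff' 1
  simp only [Fin.sum_univ_three, Pi.one_apply, one_ne_zero, if_false] at h1 haff'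
  have e0 := hv (Pi.single 0 1)
  have e1 := hv (Pi.single 1 1)
  have e2 := hv (Pi.single 2 1)
  have e3 := hv 1
  have key : (h (Pi.single 0 1) = 1 ∧ h (Pi.single 1 1) = 1 ∧ h (Pi.single 2 1) = 1) ∨
      (h (Pi.single 0 1) = 0 ∧ h (Pi.single 1 1) = 1 ∧ h (Pi.single 2 1) = 1) ∨
      (h (Pi.single 0 1) = 1 ∧ h (Pi.single 1 1) = 0 ∧ h (Pi.single 2 1) = 1) ∨
      (h (Pi.single 0 1) = 1 ∧ h (Pi.single 1 1) = 1 ∧ h (Pi.single 2 1) = 0) := by omega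
  rcases key with ⟨k0, k1, k2⟩ | ⟨k0, k1, k2⟩ | ⟨k0, k1, k2⟩ | ⟨k0, k1, k2⟩ <;>
    rw [k0, k1, k2] at haff'
  · exact Or.inl fun a => by rw [haff']; simp
  · exact Or.inr ⟨0, fun a => by rw [haff']; by_cases e : a 0 = 0 <;> simp [e]⟩
  · exact Or.inr ⟨1, fun a => by rw [haff']; by_cases e : a 1 = 0 <;> simp [e]⟩
  · exact Or.inr ⟨2, fun a => by rw [haff']; by_cases e : a 2 = 0 <;> simp [e]⟩

/-- The conjugate of a subgroup by a permutation of the coordinates. -/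
def conjBy (σ : Equiv.Perm (Fin 3)) (H : Subgroup C2CubedS3) : Subgroup C2CubedS3 :=
  H.map (MulAut.conj (el 0 σ)).toMonoidHom

theorem mem_conjBy {σ : Equiv.Perm (Fin 3)} {H : Subgroup C2CubedS3} {a : Cube}
    {π : Equiv.Perm (Fin 3)} : el a π ∈ conjBy σ H ↔ el (a ∘ σ) (σ⁻¹ * π * σ) ∈ H := by
  rw [conjBy, Subgroup.mem_map_equiv, MulAut.conj_symm_apply]
  have : (el 0 σ)⁻¹ * el a π * el 0 σ = el (a ∘ σ) (σ⁻¹ * π * σ) := by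
    rw [mul_assoc, inv_mul_eq_iff_eq_mul, el_mul, el_mul]
    congr 1
    · ext i
      simp
    · group
  rw [this]

/-- The minimal groups of symmetries of the cube, up to conjugacy. -/
def rep : Fin 11 → Subgroup C2CubedS3 :=
  ![homC4.range, homC2C2.range, homC4C2.range, homD8.range, homD8'.range, homD8''.range,
    homC2C2C2.range, homD8C2.range, homS4.range, homC2CubedC3.range, ⊤]

theorem mem_range_homC4 : ∀ a π, el a π ∈ homC4.range ↔
    a 0 = 0 ∧ (π = 1 ∧ a 1 = a 2 ∨ π = tau ∧ a 1 ≠ a 2) := by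
  simp only [MonoidHom.mem_range]
  decide +kernel

theorem mem_range_homC2C2 : ∀ a π, el a π ∈ homC2C2.range ↔ a 0 = 0 ∧ π = 1 := by
  simp only [MonoidHom.mem_range]
  decide +kernel

theorem mem_range_homD8 : ∀ a π, el a π ∈ homD8.range ↔ a 0 = 0 ∧ (π = 1 ∨ π = tau) := by
  simp only [MonoidHom.mem_range]
  decide +kernel

theorem mem_range_homD8' : ∀ a π, el a π ∈ homD8'.range ↔
    (π = 1 ∨ π = tau) ∧ (a 0 = 0 ↔ π = 1) := by
  simp only [MonoidHom.mem_range]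
  decide +kernel

theorem mem_range_homC4C2 : ∀ a π, el a π ∈ homC4C2.range ↔
    (π = 1 ∨ π = tau) ∧ (a 1 + a 2 = 0 ↔ π = 1) := by
  simp only [MonoidHom.mem_range]
  decide +kernel

theorem mem_range_homD8'' : ∀ a π, el a π ∈ homD8''.range ↔
    (π = 1 ∨ π = tau) ∧ (a 0 + a 1 + a 2 = 0 ↔ π = 1) := by
  simp only [MonoidHom.mem_range]
  decide +kernel

theorem mem_range_homC2C2C2 : ∀ a π, el a π ∈ homC2C2C2.range ↔ π = 1 := by
  simp only [MonoidHom.mem_range]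
  decide +kernel

theorem mem_range_homD8C2 : ∀ a π, el a π ∈ homD8C2.range ↔ π = 1 ∨ π = tau := by
  simp only [MonoidHom.mem_range]
  decide +kernel

theorem mem_range_homS4 : ∀ a π, el a π ∈ homS4.range ↔
    (a 0 + a 1 + a 2 = 0 ↔ Equiv.Perm.sign π = 1) := by
  simp only [MonoidHom.mem_range]
  decide +kernel

theorem mem_range_homC2CubedC3 (a : Cube) (π : Equiv.Perm (Fin 3)) :
    el a π ∈ homC2CubedC3.range ↔ Equiv.Perm.sign π = 1 := by
  rw [← Equiv.Perm.mem_alternatingGroup]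
  constructor
  · rintro ⟨x, hx⟩
    have : (x.right : Equiv.Perm (Fin 3)) = π := congrArg SemidirectProduct.right hx
    exact this ▸ x.right.2
  · intro h
    exact ⟨⟨fun i => Multiplicative.ofAdd (a i), ⟨π, h⟩⟩, rfl⟩

theorem perm_eq_of_apply_zero : ∀ π : Equiv.Perm (Fin 3), π 0 = 0 → π = 1 ∨ π = tau := by
  decide +kernel

/-- The linear parts fix the first coordinate, so they are 1 or `tau`. If `el 0 tau` lies in H, all
eight combinations do. Otherwise each vertex of the facet occurs with exactly one linear part, and H
is generated by two translations or by a quarter turn. -/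
theorem eq_range_of_facet_zero {H : Subgroup C2CubedS3}
    (hH : ∀ a : Cube, (∃ π, el a π ∈ H) ↔ a 0 = 0) :
    H = homC4.range ∨ H = homC2C2.range ∨ H = homD8.range := by
  have hπ : ∀ a π, el a π ∈ H → π = 1 ∨ π = tau := by
    intro a π h
    refine perm_eq_of_apply_zero π ?_
    by_contra h0
    have ha : a 0 = 0 := (hH a).1 ⟨π, h⟩
    have hj : π⁻¹ 0 ≠ 0 := fun e => h0 (by rw [Equiv.Perm.inv_eq_iff_eq] at e; exact e.symm)
    -- If π moved the first coordinate, this element composed with `el a π` would leave the facet.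
    obtain ⟨σ, hσ⟩ := (hH (Pi.single (π⁻¹ 0) 1)).2 (Pi.single_eq_of_ne hj.symm _)
    have h1 := (hH _).1 ⟨_, H.mul_mem h hσ⟩
    have h2 : a 0 + (Pi.single (π⁻¹ 0) 1 : Cube) (π⁻¹ 0) = 0 := h1
    rw [ha, Pi.single_eq_same, zero_add] at h2
    exact one_ne_zero h2
  by_cases hτ : el 0 tau ∈ H
  · refine Or.inr (Or.inr (ext_el fun a π => ?_))
    rw [mem_range_homD8]
    refine ⟨fun h => ⟨(hH a).1 ⟨π, h⟩, hπ a π h⟩, fun ⟨h0, h1⟩ => ?_⟩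
    obtain ⟨σ, hσ⟩ := (hH a).2 h0
    have h2 := H.mul_mem hσ hτ
    have e : el a σ * el 0 tau = el a (σ * tau) := by
      rw [el_mul]
      congr 1
      ext i
      simp
    have ht : tau * tau = 1 := by decide +kernel
    rw [e] at h2
    rcases h1 with rfl | rfl <;> rcases hπ a σ hσ with rfl | rfl
    · exact hσ
    · rwa [ht] at h2
    · rwa [one_mul] at h2
    · exact hσ
  have huniq : ∀ a, el a 1 ∈ H → el a tau ∉ H := fun a h1 h2 => hτ (by
    have h3 := H.mul_mem (H.inv_mem h1) h2
    have e : (el a 1)⁻¹ * el a tau = el 0 tau := by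
      rw [inv_mul_eq_iff_eq_mul, el_mul]
      congr 1
      ext i
      simp
    rwa [e] at h3)
  have hsub : ∀ R : Subgroup C2CubedS3, R ≤ H → (∀ a : Cube, a 0 = 0 → ∃ π, el a π ∈ R) →
      H = R := fun R hR hR' => by
    refine le_antisymm (fun w hw => ?_) hR
    obtain ⟨a, π, rfl⟩ := exists_el w
    obtain ⟨σ, hσ⟩ := hR' a ((hH a).1 ⟨π, hw⟩)
    have hσH := hR hσ
    rcases hπ a π hw with rfl | rfl <;> rcases hπ a σ hσH with rfl | rfl
    · exact hσ
    · exact absurd hσH (huniq a hw)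
    · exact absurd hw (huniq a hσH)
    · exact hσ
  have hor : ∀ a : Cube, a 0 = 0 → el a 1 ∈ H ∨ el a tau ∈ H := fun a ha => by
    obtain ⟨σ, hσ⟩ := (hH a).2 ha
    rcases hπ a σ hσ with rfl | rfl
    · exact Or.inl hσ
    · exact Or.inr hσ
  have hC4 : el ![0, 1, 0] tau ∈ H → H = homC4.range := fun h => by
    refine hsub _ ?_ fun a ha => ?_
    · rintro _ ⟨x, rfl⟩
      exact H.pow_mem h _
    · simp only [mem_range_homC4]
      by_cases e : a 1 = a 2
      · exact ⟨1, ha, Or.inl ⟨rfl, e⟩⟩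
      · exact ⟨tau, ha, Or.inr ⟨rfl, e⟩⟩
  rcases hor ![0, 1, 0] rfl with h1 | h1
  · rcases hor ![0, 0, 1] rfl with h2 | h2
    · refine Or.inr (Or.inl (hsub _ ?_ fun a ha => ⟨1, (mem_range_homC2C2 a 1).2 ⟨ha, rfl⟩⟩))
      rintro _ ⟨x, rfl⟩
      have e : homC2C2 x = el ![0, 1, 0] 1 ^ x.1.toAdd.val * el ![0, 0, 1] 1 ^ x.2.toAdd.val := by
        revert x
        decide +kernel
      rw [e]
      exact H.mul_mem (H.pow_mem h1 _) (H.pow_mem h2 _)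
    -- The square of `el ![0, 0, 1] tau` is the translation by (0,1,1). Adding the translation by
    -- (0,1,0) gives that by (0,0,1), so both linear parts would occur at this vertex.
    · refine absurd h2 (huniq _ ?_)
      have h3 := H.mul_mem h1 (H.mul_mem h2 h2)
      have e : el ![0, 1, 0] 1 * (el ![0, 0, 1] tau * el ![0, 0, 1] tau) = el ![0, 0, 1] 1 := by
        decide +kernel
      rwa [e] at h3
  · exact Or.inl (hC4 h1)

/-- The pure translations in a group of symmetries of the cube. -/
def translations (H : Subgroup C2CubedS3) : Subgroup (Fin 3 → Cyc 2) :=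
  H.comap SemidirectProduct.inl

/-- The linear parts of the elements of a group of symmetries of the cube. -/
def linearParts (H : Subgroup C2CubedS3) : Subgroup (Equiv.Perm (Fin 3)) :=
  H.map SemidirectProduct.rightHom

theorem mem_linearParts {H : Subgroup C2CubedS3} {π : Equiv.Perm (Fin 3)} :
    π ∈ linearParts H ↔ ∃ a, el a π ∈ H := by
  constructor
  · rintro ⟨w, hw, rfl⟩
    exact ⟨fun i => (w.left i).toAdd, hw⟩
  · rintro ⟨a, h⟩
    exact ⟨_, h, rfl⟩

theorem card_translations_mul (H : Subgroup C2CubedS3) :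
    Nat.card (translations H) * Nat.card (linearParts H) = Nat.card H := by
  let f : H →* Equiv.Perm (Fin 3) := SemidirectProduct.rightHom.comp H.subtype
  have h1 : Nat.card f.range = Nat.card (linearParts H) := by
    rw [MonoidHom.range_comp, H.range_subtype]
    rfl
  have h2 : Nat.card f.ker = Nat.card (translations H) := by
    refine Nat.card_congr ⟨fun x => ⟨x.1.1.left, ?_⟩, fun x => ⟨⟨_, x.2⟩, rfl⟩, fun x => ?_,
      fun x => rfl⟩
    · have hx : x.1.1.right = 1 := x.2
      have e : (SemidirectProduct.inl x.1.1.left : C2CubedS3) = x.1.1 :=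
        SemidirectProduct.ext rfl hx.symm
      change (SemidirectProduct.inl x.1.1.left : C2CubedS3) ∈ H
      rw [e]
      exact x.1.2
    · have hx : x.1.1.right = 1 := x.2
      exact Subtype.ext (Subtype.ext (SemidirectProduct.ext rfl hx.symm))
  rw [← h1, ← h2, ← Subgroup.index_ker, Subgroup.card_mul_index]

theorem eight_dvd_card {H : Subgroup C2CubedS3} (hH : ∀ a, ∃ π, el a π ∈ H) : 8 ∣ Nat.card H := by
  let _ : MulAction H Cube := MulAction.compHom Cube (act.comp H.subtype)
  have : MulAction.IsPretransitive H Cube := (MulAction.isPretransitive_iff_base 0).2 fun a => by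
    obtain ⟨π, hπ⟩ := hH a
    refine ⟨⟨_, hπ⟩, ?_⟩
    change act (el a π) 0 = a
    rw [act_el]
    ext i
    simp
  have h := MulAction.index_stabilizer_of_transitive H (0 : Cube)
  rw [Nat.card_eq_fintype_card (α := Cube)] at h
  have hc : Fintype.card Cube = 8 := by simp [ZMod.card]
  rw [hc] at h
  rw [← h]
  exact Subgroup.index_dvd_card _

/-- By transitivity 8 divides the number of translations times the number of linear parts. The
latter divides 6, so there are at least four translations. -/
theorem index_translations {H : Subgroup C2CubedS3} (hH : ∀ a, ∃ π, el a π ∈ H)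
    (hN : translations H ≠ ⊤) : (translations H).index = 2 := by
  have hc : Nat.card (Fin 3 → Cyc 2) = 8 := by
    rw [Nat.card_eq_fintype_card]
    decide +kernel
  have h6 : Nat.card (Equiv.Perm (Fin 3)) = 6 := by
    rw [Nat.card_eq_fintype_card]
    decide +kernel
  have h1 := (translations H).card_mul_index
  have h2 := Subgroup.card_subgroup_dvd_card (linearParts H)
  have h3 := eight_dvd_card hH
  have h4 : (translations H).index ≠ 1 := fun h => hN (Subgroup.index_eq_one.1 h)
  rw [← card_translations_mul] at h3
  rw [hc] at h1
  rw [h6] at h2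
  generalize Nat.card (translations H) = x at *
  generalize Nat.card (linearParts H) = y at *
  generalize (translations H).index = z at *
  have hy : y ≤ 6 := Nat.le_of_dvd (by norm_num) h2
  have hz : z ∣ 8 := ⟨x, by rw [mul_comm, h1]⟩
  have hz' : z ≤ 8 := Nat.le_of_dvd (by norm_num) hz
  interval_cases z <;> first | omega | (interval_cases y <;> omega)

end ProjVar
end

/-! ### Classification of the transitive groups -/

open Filter
noncomputable section
set_option linter.unusedSectionVars false
namespace ProjVar

theorem el_one_mem_iff {H : Subgroup C2CubedS3} {a : Cube} :
    el a 1 ∈ H ↔ (fun i => Multiplicative.ofAdd (a i)) ∈ translations H := Iff.rfl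

theorem sign_cases : ∀ π : Equiv.Perm (Fin 3), π = 1 ∨ (Equiv.Perm.sign π = 1 ∧ π ^ 3 = 1) ∨
    (Equiv.Perm.sign π ≠ 1 ∧ ∃ σ, σ⁻¹ * tau * σ = π) := by decide +kernel

theorem generated_by_tau : ∀ π : Equiv.Perm (Fin 3), π ≠ 1 → π ≠ tau → ∀ ρ, ρ = 1 ∨ ρ = tau ∨
    ρ = π ∨ ρ = tau * π ∨ ρ = π * tau ∨ ρ = tau * π * tau ∨ ρ = π * π ∨ ρ = π * tau * π := by
  decide +kernel

theorem eq_or_eq_top_of_tau_mem {Q : Subgroup (Equiv.Perm (Fin 3))} (hQ : tau ∈ Q) :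
    (∀ π, π ∈ Q ↔ π = 1 ∨ π = tau) ∨ ∀ π, π ∈ Q := by
  by_cases h : ∃ π ∈ Q, π ≠ 1 ∧ π ≠ tau
  · obtain ⟨π, hπ, h1, h2⟩ := h
    refine Or.inr fun ρ => ?_
    rcases generated_by_tau π h1 h2 ρ with rfl | rfl | rfl | rfl | rfl | rfl | rfl | rfl
    · exact Q.one_mem
    · exact hQ
    · exact hπ
    · exact Q.mul_mem hQ hπ
    · exact Q.mul_mem hπ hQ
    · exact Q.mul_mem (Q.mul_mem hQ hπ) hQ
    · exact Q.mul_mem hπ hπ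
    · exact Q.mul_mem (Q.mul_mem hπ hQ) hπ
  · push Not at h
    refine Or.inl fun π => ⟨fun hπ => ?_, ?_⟩
    · by_cases h1 : π = 1
      · exact Or.inl h1
      · exact Or.inr (h π hπ h1)
    · rintro (rfl | rfl)
      · exact Q.one_mem
      · exact hQ

theorem eq_one_or_eq_or_eq_mul_self : ∀ π : Equiv.Perm (Fin 3), π ≠ 1 → Equiv.Perm.sign π = 1 →
    ∀ ρ, Equiv.Perm.sign ρ = 1 → ρ = 1 ∨ ρ = π ∨ ρ = π * π := by decide +kernel

theorem eq_bot_or_of_sign {Q : Subgroup (Equiv.Perm (Fin 3))}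
    (hQ : ∀ π ∈ Q, Equiv.Perm.sign π = 1) :
    (∀ π, π ∈ Q ↔ π = 1) ∨ ∀ π, π ∈ Q ↔ Equiv.Perm.sign π = 1 := by
  by_cases h : ∃ π ∈ Q, π ≠ 1
  · obtain ⟨π, hπ, h1⟩ := h
    refine Or.inr fun ρ => ⟨hQ ρ, fun hρ => ?_⟩
    rcases eq_one_or_eq_or_eq_mul_self π h1 (hQ π hπ) ρ hρ with rfl | rfl | rfl
    · exact Q.one_mem
    · exact hπ
    · exact Q.mul_mem hπ hπ
  · push Not at h
    refine Or.inl fun π => ⟨h π, ?_⟩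
    rintro rfl
    exact Q.one_mem

theorem mem_linearParts_conjBy {σ π : Equiv.Perm (Fin 3)} {H : Subgroup C2CubedS3} :
    π ∈ linearParts (conjBy σ H) ↔ σ⁻¹ * π * σ ∈ linearParts H := by
  simp only [mem_linearParts, mem_conjBy]
  constructor
  · rintro ⟨a, h⟩
    exact ⟨_, h⟩
  · rintro ⟨a, h⟩
    refine ⟨a ∘ ⇑σ⁻¹, ?_⟩
    have : (a ∘ ⇑σ⁻¹) ∘ σ = a := by ext; simp
    rwa [this]

/-- The membership in a transitive group which does not contain all translations. -/
theorem mem_iff_of_index_two {H : Subgroup C2CubedS3} (hH : ∀ a, ∃ π, el a π ∈ H)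
    (hN : (translations H).index = 2) (a : Cube) (π : Equiv.Perm (Fin 3)) :
    el a π ∈ H ↔ π ∈ linearParts H ∧ (el a 1 ∈ H ↔ Equiv.Perm.sign π = 1) := by
  have hadd : ∀ a b : Cube, el (a + b) 1 ∈ H ↔ (el a 1 ∈ H ↔ el b 1 ∈ H) := fun a b =>
    Subgroup.mul_mem_iff_of_index_two hN (a := fun i => Multiplicative.ofAdd (a i))
      (b := fun i => Multiplicative.ofAdd (b i))
  have hdiff : ∀ a b π, el a π ∈ H → (el b π ∈ H ↔ (el a 1 ∈ H ↔ el b 1 ∈ H)) := by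
    intro a b π h
    rw [← hadd, ← H.mul_mem_cancel_right (y := el (a + b) 1) h, el_mul]
    have e : (fun i => (a + b) i + a ((1 : Equiv.Perm (Fin 3))⁻¹ i)) = b := by
      ext i
      simp only [Pi.add_apply, inv_one, Equiv.Perm.one_apply]
      rw [add_comm (a i), add_assoc, CharTwo.add_self_eq_zero, add_zero]
    rw [e, one_mul]
  -- Conjugation by an element of H preserves its translations, so they are stable under the linear
  -- parts.
  have hconj : ∀ a b π, el b π ∈ H → (el (fun i => a (π⁻¹ i)) 1 ∈ H ↔ el a 1 ∈ H) := by
    intro a b π h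
    have e : el (fun i => a (π⁻¹ i)) 1 * el b π = el b π * el a 1 := by
      rw [el_mul, el_mul]
      congr 1
      ext i
      simp [add_comm]
    rw [← H.mul_mem_cancel_right h, e, H.mul_mem_cancel_left h]
  -- The cube of `el a π` is the translation by the sum of three permuted copies of a. These lie in
  -- the same class modulo the translations of H, and in a quotient of order two three equal classes
  -- add up to zero only if each is zero.
  have h3 : ∀ a π, el a π ∈ H → π ^ 3 = 1 → el a 1 ∈ H := by
    intro a π h h3
    have h4 := H.mul_mem (H.mul_mem h h) h
    rw [el_mul, el_mul] at h4
    have e : (fun i => a i + a (π⁻¹ i) + a ((π * π)⁻¹ i)) =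
        (a + fun i => a (π⁻¹ i)) + fun i => a ((π * π)⁻¹ i) := rfl
    have h5 : el (fun i => a i + a (π⁻¹ i)) (π * π) ∈ H := H.mul_mem h h
    rw [e, (pow_three' π).symm.trans h3, hadd, hadd, hconj a _ _ h, hconj a _ _ h5] at h4
    simpa using h4
  obtain ⟨a₀, ha₀⟩ : ∃ a, el a 1 ∉ H := by
    by_contra! h
    rw [Subgroup.index_eq_one.2 ((Subgroup.eq_top_iff' _).2 fun x => h fun i => (x i).toAdd)] at hN
    norm_num at hN
  obtain ⟨π₀, hπ₀⟩ := hH a₀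
  have hs₀ : Equiv.Perm.sign π₀ ≠ 1 := by
    rcases sign_cases π₀ with h | ⟨-, h⟩ | ⟨h, -⟩
    · exact absurd (h ▸ hπ₀) ha₀
    · exact absurd (h3 _ _ hπ₀ h) ha₀
    · exact h
  have hsign : ∀ a π, el a π ∈ H → (el a 1 ∈ H ↔ Equiv.Perm.sign π = 1) := by
    intro a π h
    have heven : ∀ a π, el a π ∈ H → Equiv.Perm.sign π = 1 → el a 1 ∈ H := by
      intro a π h hs
      rcases sign_cases π with h' | ⟨-, h'⟩ | ⟨h', -⟩
      · exact h' ▸ h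
      · exact h3 _ _ h h'
      · exact absurd hs h'
    refine ⟨fun h1 => ?_, heven a π h⟩
    -- If an odd π had a among the translations, the product with `el a₀ π₀` would have even linear
    -- part, but its translation part would lie outside the translations of H.
    by_contra hs
    have h4 := H.mul_mem hπ₀ h
    rw [el_mul] at h4
    have h5 := heven _ _ h4 (by
      rw [Equiv.Perm.sign_mul, (Int.units_eq_one_or _).resolve_left hs₀,
        (Int.units_eq_one_or _).resolve_left hs]
      rfl)
    have h6 := (hadd a₀ fun i => a (π₀⁻¹ i)).1 h5
    rw [hconj a _ _ hπ₀] at h6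
    exact ha₀ (h6.2 h1)
  refine ⟨fun h => ⟨mem_linearParts.2 ⟨a, h⟩, hsign a π h⟩, fun ⟨hQ, h⟩ => ?_⟩
  obtain ⟨b, hb⟩ := mem_linearParts.1 hQ
  rw [hdiff b a π hb, hsign b π hb, h]

/-- A subgroup of index two in 𝔽₂³ is the kernel of a linear form, whose coefficients record which
coordinate vectors lie in it. -/
theorem exists_linear_form {H : Subgroup C2CubedS3} (hN : (translations H).index = 2) :
    ∃ f : Fin 3 → ZMod 2, (∀ a, el a 1 ∈ H ↔ f 0 * a 0 + f 1 * a 1 + f 2 * a 2 = 0) ∧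
      ∀ i, f i = 0 ↔ el (Pi.single i 1) 1 ∈ H := by
  classical
  have hadd : ∀ a b : Cube, el (a + b) 1 ∈ H ↔ (el a 1 ∈ H ↔ el b 1 ∈ H) := fun a b =>
    Subgroup.mul_mem_iff_of_index_two hN (a := fun i => Multiplicative.ofAdd (a i))
      (b := fun i => Multiplicative.ofAdd (b i))
  let f : Fin 3 → ZMod 2 := fun i => if el (Pi.single i 1) 1 ∈ H then 0 else 1
  have hf : ∀ i, f i = 0 ↔ el (Pi.single i 1) 1 ∈ H := fun i => by
    simp only [f]
    split_ifs with h <;> simp [h]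
  have hf' : ∀ i x, el (Pi.single i x) 1 ∈ H ↔ f i * x = 0 := fun i x => by
    rcases ZMod.two_cases x with rfl | rfl
    · rw [Pi.single_zero, mul_zero]
      exact iff_of_true H.one_mem rfl
    · rw [mul_one, hf]
  refine ⟨f, fun a => ?_, hf⟩
  have ha : a = (Pi.single 0 (a 0) : Cube) + (Pi.single 1 (a 1) : Cube) + (Pi.single 2 (a 2) : Cube) := by
    ext i
    fin_cases i <;> simp
  have h2 : ∀ x y : ZMod 2, x + y = 0 ↔ (x = 0 ↔ y = 0) := by decide
  conv_lhs => rw [ha]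
  rw [hadd, hadd, hf', hf', hf', h2, h2]

/-- If an odd linear part occurs, conjugation turns it into `tau`, and the linear parts are {1, τ}
or S₃; otherwise they are trivial or A₃. With all translations present, the linear parts determine
the group. With index two the invariant form is (0,1,1), (1,0,0) or (1,1,1) for {1, τ}, giving C₄ ×
C₂ and two copies of D₈, and it is (1,1,1) for S₃, giving S₄. -/
theorem exists_conjBy_eq_of_transitive {H : Subgroup C2CubedS3} (hH : ∀ a, ∃ π, el a π ∈ H) :
    ∃ σ j, conjBy σ H = rep j := by
  have hHσ : ∀ σ a, ∃ π, el a π ∈ conjBy σ H := fun σ a => by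
    obtain ⟨π, hπ⟩ := hH (a ∘ σ)
    refine ⟨σ * π * σ⁻¹, mem_conjBy.2 ?_⟩
    convert hπ using 2
    group
  have h1 : conjBy 1 H = H := ext_el fun a π => by
    rw [mem_conjBy]
    simp
  by_cases hτ : ∃ π ∈ linearParts H, Equiv.Perm.sign π ≠ 1
  · obtain ⟨π, hπ, hs⟩ := hτ
    obtain ⟨σ, hσ⟩ : ∃ σ, σ⁻¹ * tau * σ = π := by
      rcases sign_cases π with h | ⟨h, -⟩ | ⟨-, h⟩
      · rw [h] at hs
        simp at hs
      · exact absurd h hs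
      · exact h
    refine ⟨σ, ?_⟩
    have hτ : tau ∈ linearParts (conjBy σ H) := by
      rw [mem_linearParts_conjBy, hσ]
      exact hπ
    have hH' := hHσ σ
    generalize conjBy σ H = H' at *
    have hst : Equiv.Perm.sign tau ≠ 1 := by decide +kernel
    by_cases hN : translations H' = ⊤
    · have hmem : ∀ a π, el a π ∈ H' ↔ π ∈ linearParts H' := fun a π => by
        refine ⟨fun h => mem_linearParts.2 ⟨a, h⟩, fun h => ?_⟩
        obtain ⟨b, hb⟩ := mem_linearParts.1 h
        have h2 : el (a + b) 1 ∈ H' := by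
          rw [el_one_mem_iff, hN]
          trivial
        have h3 := H'.mul_mem h2 hb
        rw [el_mul, one_mul] at h3
        convert h3 using 2
        ext i
        simp [add_assoc, CharTwo.add_self_eq_zero]
      rcases eq_or_eq_top_of_tau_mem hτ with hQ | hQ
      · exact ⟨7, ext_el fun a π => by rw [hmem, hQ]; exact (mem_range_homD8C2 a π).symm⟩
      · exact ⟨10, ext_el fun a π => by rw [hmem]; exact iff_of_true (hQ π) trivial⟩
    · have hN2 := index_translations hH' hN
      obtain ⟨f, hf, hf'⟩ := exists_linear_form hN2
      have hmem := mem_iff_of_index_two hH' hN2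
      simp only [hf] at hmem
      -- The kernel of f is stable under conjugation by H', and over 𝔽₂ a form is determined by its
      -- kernel.
      have hconj : ∀ π ∈ linearParts H', ∀ i, f (π i) = f i := by
        intro π hπ i
        obtain ⟨b, hb⟩ := mem_linearParts.1 hπ
        have e : el (Pi.single (π i) 1) 1 * el b π = el b π * el (Pi.single i 1) 1 := by
          rw [el_mul, el_mul]
          congr 1
          ext j
          have : (Pi.single i 1 : Cube) (π⁻¹ j) = (Pi.single (π i) 1 : Cube) j := by
            simp only [Pi.single_apply, Equiv.Perm.inv_eq_iff_eq]
          rw [this]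
          simp [add_comm]
        have h2 : f (π i) = 0 ↔ f i = 0 := by
          rw [hf', hf', ← H'.mul_mem_cancel_right hb, e, H'.mul_mem_cancel_left hb]
        have h3 : ∀ x y : ZMod 2, (x = 0 ↔ y = 0) → x = y := by decide
        exact h3 _ _ h2
      have h12 : f 2 = f 1 := hconj tau hτ 1
      have hne : ¬ (f 0 = 0 ∧ f 1 = 0) := fun ⟨h0, h1⟩ => by
        obtain ⟨b, hb⟩ := mem_linearParts.1 hτ
        have h2 := (hmem b tau).1 hb
        rw [h12, h0, h1] at h2
        simp [hst] at h2
      have hsgn : ∀ π : Equiv.Perm (Fin 3), (π = 1 ∨ π = tau) →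
          (Equiv.Perm.sign π = 1 ↔ π = 1) := by decide +kernel
      rcases eq_or_eq_top_of_tau_mem hτ with hQ | hQ
      · have hmem' : ∀ a π, el a π ∈ H' ↔ (π = 1 ∨ π = tau) ∧
            (f 0 * a 0 + f 1 * a 1 + f 2 * a 2 = 0 ↔ π = 1) := fun a π => by
          rw [hmem, hQ]
          exact and_congr_right fun h => by rw [hsgn π h]
        rw [h12] at hmem'
        rcases ZMod.two_cases (f 0) with h0 | h0 <;> rcases ZMod.two_cases (f 1) with h1 | h1 <;>
          rw [h0, h1] at hmem'
        · exact absurd ⟨h0, h1⟩ hne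
        · refine ⟨2, ext_el fun a π => (hmem' a π).trans ?_⟩
          rw [zero_mul, one_mul, one_mul, zero_add]
          exact (mem_range_homC4C2 a π).symm
        · refine ⟨4, ext_el fun a π => (hmem' a π).trans ?_⟩
          rw [zero_mul, zero_mul, one_mul, add_zero, add_zero]
          exact (mem_range_homD8' a π).symm
        · refine ⟨5, ext_el fun a π => (hmem' a π).trans ?_⟩
          rw [one_mul, one_mul, one_mul]
          exact (mem_range_homD8'' a π).symm
      · have h01 : f 1 = f 0 := by
          simpa using hconj (Equiv.swap 0 1) (hQ _) 0
        have h0 : f 0 = 1 := (ZMod.two_cases _).resolve_left fun h => hne ⟨h, h01.trans h⟩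
        refine ⟨8, ext_el fun a π => (hmem a π).trans ?_⟩
        rw [h12, h01, h0, one_mul, one_mul, one_mul]
        exact (and_iff_right (hQ π)).trans (mem_range_homS4 a π).symm
  · push Not at hτ
    -- In index two a vertex occurs with an even linear part only if it is itself a translation of
    -- H. With even linear parts only, transitivity would make every vertex a translation.
    have hN : translations H = ⊤ := by
      by_contra hN
      have hmem := mem_iff_of_index_two hH (index_translations hH hN)
      refine hN ((Subgroup.eq_top_iff' _).2 fun x => ?_)
      obtain ⟨π, hπ⟩ := hH fun i => (x i).toAdd
      have h2 := (hmem _ π).1 hπ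
      exact h2.2.2 (hτ π h2.1)
    have hmem : ∀ a π, el a π ∈ H ↔ π ∈ linearParts H := fun a π => by
      refine ⟨fun h => mem_linearParts.2 ⟨a, h⟩, fun h => ?_⟩
      obtain ⟨b, hb⟩ := mem_linearParts.1 h
      have h2 : el (a + b) 1 ∈ H := by
        rw [el_one_mem_iff, hN]
        trivial
      have h3 := H.mul_mem h2 hb
      rw [el_mul, one_mul] at h3
      convert h3 using 2
      ext i
      simp [add_assoc, CharTwo.add_self_eq_zero]
    refine ⟨1, ?_⟩
    rw [h1]
    rcases eq_bot_or_of_sign hτ with hQ | hQ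
    · exact ⟨6, ext_el fun a π => by rw [hmem, hQ]; exact (mem_range_homC2C2C2 a π).symm⟩
    · exact ⟨9, ext_el fun a π => by rw [hmem, hQ]; exact (mem_range_homC2CubedC3 a π).symm⟩

theorem IsMinimalSym.exists_conjBy_eq_rep {H : Subgroup C2CubedS3} (hH : IsMinimalSym H) :
    ∃ σ j, conjBy σ H = rep j := by
  rcases hH.cases with h | ⟨i, h⟩
  · exact exists_conjBy_eq_of_transitive h
  · refine ⟨Equiv.swap i 0, ?_⟩
    have h' : ∀ a : Cube, (∃ π, el a π ∈ conjBy (Equiv.swap i 0) H) ↔ a 0 = 0 := fun a => by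
      have e := h (a ∘ Equiv.swap i 0)
      rw [Function.comp_apply, Equiv.swap_apply_left] at e
      rw [← e]
      simp only [mem_conjBy]
      constructor
      · rintro ⟨π, hπ⟩
        exact ⟨_, hπ⟩
      · rintro ⟨π, hπ⟩
        refine ⟨Equiv.swap i 0 * π * (Equiv.swap i 0)⁻¹, ?_⟩
        convert hπ using 2
        group
    rcases eq_range_of_facet_zero h' with e | e | e
    · exact ⟨0, e⟩
    · exact ⟨1, e⟩
    · exact ⟨3, e⟩

end ProjVar
end

open Filter
noncomputable section
set_option linter.unusedSectionVars false
namespace ProjVar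

/-! ### Conjugacy classes -/

section Conj

variable {G H : Type*} [Group G] [Group H]

theorem self_mem_conjClass (S : Subgroup G) : S ∈ conjClass S :=
  ⟨1, by
    rw [map_one]
    exact (Subgroup.map_id S).symm⟩

theorem conjClass_eq_of_mem {S T : Subgroup G} (h : T ∈ conjClass S) :
    conjClass T = conjClass S := by
  have key : ∀ {S T : Subgroup G}, T ∈ conjClass S → conjClass T ⊆ conjClass S := by
    rintro S _ ⟨a, rfl⟩ _ ⟨b, rfl⟩
    refine ⟨b * a, ?_⟩
    rw [Subgroup.map_map, map_mul]
    rfl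
  refine (key h).antisymm (key ?_)
  obtain ⟨a, rfl⟩ := h
  refine ⟨a⁻¹, ?_⟩
  rw [Subgroup.map_map]
  have : (MulAut.conj a⁻¹).toMonoidHom.comp (MulAut.conj a).toMonoidHom = MonoidHom.id G := by
    ext x
    simp [mul_assoc]
  rw [this, Subgroup.map_id]

theorem map_mem_conjClass (f : G →* H) {S T : Subgroup G} (h : T ∈ conjClass S) :
    T.map f ∈ conjClass (S.map f) := by
  obtain ⟨a, rfl⟩ := h
  refine ⟨f a, ?_⟩
  rw [Subgroup.map_map, Subgroup.map_map]
  congr 1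
  ext x
  simp

theorem exists_conj_mem {S T : Subgroup G} (h : conjClass S = conjClass T) {x : G} (hx : x ∈ S) :
    ∃ g, g * x * g⁻¹ ∈ T := by
  obtain ⟨a, ha⟩ : T ∈ conjClass S := h ▸ self_mem_conjClass T
  refine ⟨a, ?_⟩
  rw [ha]
  exact ⟨x, hx, rfl⟩

/-- The order of a group together with its number of elements of order at most two. -/
def orders (G : Type*) [Group G] : ℕ × ℕ := (Nat.card G, Nat.card {x : G // x * x = 1})

theorem orders_congr (e : G ≃* H) : orders G = orders H := by
  refine Prod.ext (Nat.card_congr e.toEquiv) (Nat.card_congr (e.toEquiv.subtypeEquiv fun x => ?_))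
  change x * x = 1 ↔ e x * e x = 1
  rw [← map_mul, map_eq_one_iff _ e.injective]

theorem orders_eq [Fintype G] [DecidableEq G] :
    orders G = (Fintype.card G, Fintype.card {x : G // x * x = 1}) := by
  rw [orders, Nat.card_eq_fintype_card, Nat.card_eq_fintype_card]

end Conj

/-! ### The minimal groups of symmetries of the cube -/

theorem isMinimalSym_rep : ∀ j, IsMinimalSym (rep j) := by
  have hτ : tau 0 = 0 := by decide +kernel
  have hs : Equiv.Perm.sign tau ≠ 1 := by decide +kernel
  have h1τ : tau ≠ 1 := by decide +kernel
  intro j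
  fin_cases j
  · refine isMinimalSym_of_facet (fun a π h => ?_) fun a ha => ?_
    · rcases ((mem_range_homC4 a π).1 h).2 with ⟨rfl, -⟩ | ⟨rfl, -⟩
      · rfl
      · exact hτ
    · by_cases e : a 1 = a 2
      · exact ⟨1, (mem_range_homC4 a 1).2 ⟨ha, Or.inl ⟨rfl, e⟩⟩⟩
      · exact ⟨tau, (mem_range_homC4 a tau).2 ⟨ha, Or.inr ⟨rfl, e⟩⟩⟩
  · refine isMinimalSym_of_facet (fun a π h => ?_) fun a ha =>
      ⟨1, (mem_range_homC2C2 a 1).2 ⟨ha, rfl⟩⟩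
    rw [((mem_range_homC2C2 a π).1 h).2]
    rfl
  · refine isMinimalSym_of_transitive fun a => ?_
    by_cases e : a 1 + a 2 = 0
    · exact ⟨1, (mem_range_homC4C2 a 1).2 ⟨Or.inl rfl, iff_of_true e rfl⟩⟩
    · exact ⟨tau, (mem_range_homC4C2 a tau).2 ⟨Or.inr rfl, iff_of_false e h1τ⟩⟩
  · refine isMinimalSym_of_facet (fun a π h => ?_) fun a ha =>
      ⟨1, (mem_range_homD8 a 1).2 ⟨ha, Or.inl rfl⟩⟩
    rcases ((mem_range_homD8 a π).1 h).2 with rfl | rfl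
    · rfl
    · exact hτ
  · refine isMinimalSym_of_transitive fun a => ?_
    by_cases e : a 0 = 0
    · exact ⟨1, (mem_range_homD8' a 1).2 ⟨Or.inl rfl, iff_of_true e rfl⟩⟩
    · exact ⟨tau, (mem_range_homD8' a tau).2 ⟨Or.inr rfl, iff_of_false e h1τ⟩⟩
  · refine isMinimalSym_of_transitive fun a => ?_
    by_cases e : a 0 + a 1 + a 2 = 0
    · exact ⟨1, (mem_range_homD8'' a 1).2 ⟨Or.inl rfl, iff_of_true e rfl⟩⟩
    · exact ⟨tau, (mem_range_homD8'' a tau).2 ⟨Or.inr rfl, iff_of_false e h1τ⟩⟩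
  · exact isMinimalSym_of_transitive fun a => ⟨1, (mem_range_homC2C2C2 a 1).2 rfl⟩
  · exact isMinimalSym_of_transitive fun a => ⟨1, (mem_range_homD8C2 a 1).2 (Or.inl rfl)⟩
  · refine isMinimalSym_of_transitive fun a => ?_
    by_cases e : a 0 + a 1 + a 2 = 0
    · exact ⟨1, (mem_range_homS4 a 1).2 (iff_of_true e (map_one _))⟩
    · exact ⟨tau, (mem_range_homS4 a tau).2 (iff_of_false e hs)⟩
  · exact isMinimalSym_of_transitive fun a => ⟨1, (mem_range_homC2CubedC3 a 1).2 (map_one _)⟩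
  · exact isMinimalSym_of_transitive fun a => ⟨1, trivial⟩

theorem equiv_rep_zero : Nonempty (rep 0 ≃* Cyc 4) :=
  ⟨(MonoidHom.ofInjective homC4_injective).symm⟩

theorem equiv_rep_one : Nonempty (rep 1 ≃* Cyc 2 × Cyc 2) :=
  ⟨(MonoidHom.ofInjective homC2C2_injective).symm⟩

theorem equiv_rep_two : Nonempty (rep 2 ≃* Cyc 4 × Cyc 2) :=
  ⟨(MonoidHom.ofInjective homC4C2_injective).symm⟩

theorem equiv_rep_three : Nonempty (rep 3 ≃* DihedralGroup 4) :=
  ⟨(MonoidHom.ofInjective homD8_injective).symm⟩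

theorem equiv_rep_four : Nonempty (rep 4 ≃* DihedralGroup 4) :=
  ⟨(MonoidHom.ofInjective homD8'_injective).symm⟩

theorem equiv_rep_five : Nonempty (rep 5 ≃* DihedralGroup 4) :=
  ⟨(MonoidHom.ofInjective homD8''_injective).symm⟩

theorem equiv_rep_six : Nonempty (rep 6 ≃* Cyc 2 × Cyc 2 × Cyc 2) :=
  ⟨(MonoidHom.ofInjective homC2C2C2_injective).symm⟩

theorem equiv_rep_seven : Nonempty (rep 7 ≃* DihedralGroup 4 × Cyc 2) :=
  ⟨(MonoidHom.ofInjective homD8C2_injective).symm⟩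

theorem equiv_rep_eight : Nonempty (rep 8 ≃* Equiv.Perm (Fin 4)) :=
  ⟨(MonoidHom.ofInjective homS4_injective).symm⟩

theorem equiv_rep_nine : Nonempty (rep 9 ≃* C2CubedC3) :=
  ⟨(MonoidHom.ofInjective homC2CubedC3_injective).symm⟩

theorem equiv_rep_ten : Nonempty (rep 10 ≃* C2CubedS3) := ⟨Subgroup.topEquiv⟩

theorem orders_C4 : orders (Cyc 4) = (4, 2) := by rw [orders_eq]; decide +kernel

theorem orders_C2C2 : orders (Cyc 2 × Cyc 2) = (4, 4) := by rw [orders_eq]; decide +kernel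

theorem orders_C4C2 : orders (Cyc 4 × Cyc 2) = (8, 4) := by rw [orders_eq]; decide +kernel

theorem orders_D8 : orders (DihedralGroup 4) = (8, 6) := by rw [orders_eq]; decide +kernel

theorem orders_C2C2C2 : orders (Cyc 2 × Cyc 2 × Cyc 2) = (8, 8) := by
  rw [orders_eq]; decide +kernel

theorem orders_D8C2 : orders (DihedralGroup 4 × Cyc 2) = (16, 12) := by
  rw [orders_eq]; decide +kernel

theorem orders_S4 : orders (Equiv.Perm (Fin 4)) = (24, 10) := by rw [orders_eq]; decide +kernel

theorem orders_C2CubedC3 : orders C2CubedC3 = (24, 8) := by rw [orders_eq]; decide +kernel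

theorem orders_C2CubedS3 : orders C2CubedS3 = (48, 20) := by rw [orders_eq]; decide +kernel

/-- The invariants of the minimal groups of symmetries of the cube. -/
def repOrders : Fin 11 → ℕ × ℕ :=
  ![(4, 2), (4, 4), (8, 4), (8, 6), (8, 6), (8, 6), (8, 8), (16, 12), (24, 10), (24, 8), (48, 20)]

theorem orders_rep (j : Fin 11) : orders (rep j) = repOrders j := by
  fin_cases j
  · exact (orders_congr equiv_rep_zero.some).trans orders_C4
  · exact (orders_congr equiv_rep_one.some).trans orders_C2C2
  · exact (orders_congr equiv_rep_two.some).trans orders_C4C2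
  · exact (orders_congr equiv_rep_three.some).trans orders_D8
  · exact (orders_congr equiv_rep_four.some).trans orders_D8
  · exact (orders_congr equiv_rep_five.some).trans orders_D8
  · exact (orders_congr equiv_rep_six.some).trans orders_C2C2C2
  · exact (orders_congr equiv_rep_seven.some).trans orders_D8C2
  · exact (orders_congr equiv_rep_eight.some).trans orders_S4
  · exact (orders_congr equiv_rep_nine.some).trans orders_C2CubedC3
  · exact (orders_congr equiv_rep_ten.some).trans orders_C2CubedS3

/-- The pure swap `el 0 tau` fixes vertices of the cube. A transitive group of order eight acts
simply transitively on the eight vertices, so it contains no conjugate of this swap; the same reason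
applies to `rep 5`. -/
theorem conjClass_rep_three_ne_four : conjClass (rep 3) ≠ conjClass (rep 4) := fun h => by
  obtain ⟨g, hg⟩ := exists_conj_mem h ((mem_range_homD8 0 tau).2 ⟨rfl, Or.inr rfl⟩)
  obtain ⟨x, hx⟩ : g * el 0 tau * g⁻¹ ∈ homD8'.range := hg
  revert hx x g
  decide +kernel

theorem conjClass_rep_three_ne_five : conjClass (rep 3) ≠ conjClass (rep 5) := fun h => by
  obtain ⟨g, hg⟩ := exists_conj_mem h ((mem_range_homD8 0 tau).2 ⟨rfl, Or.inr rfl⟩)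
  obtain ⟨x, hx⟩ : g * el 0 tau * g⁻¹ ∈ homD8''.range := hg
  revert hx x g
  decide +kernel

/-- Conjugates of a flip of one coordinate are again such flips, whereas the translations in `rep 5`
flip an even number of coordinates. -/
theorem conjClass_rep_four_ne_five : conjClass (rep 4) ≠ conjClass (rep 5) := fun h => by
  obtain ⟨g, hg⟩ := exists_conj_mem h
    ((mem_range_homD8' ![0, 1, 0] 1).2 ⟨Or.inl rfl, iff_of_true rfl rfl⟩)
  obtain ⟨x, hx⟩ : g * el ![0, 1, 0] 1 * g⁻¹ ∈ homD8''.range := hg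
  revert hx x g
  decide +kernel

namespace ToricCoords

variable {K : Type*} [Field K] {X : Set (ProjSpace K 5)} (C : ToricCoords X) [IsAlgClosed K]

theorem map_symm_map (G : Subgroup (AutHat X)) :
    (G.map C.autHatEquiv.toMonoidHom).map C.autHatEquiv.symm.toMonoidHom = G := by
  rw [Subgroup.map_map]
  have : C.autHatEquiv.symm.toMonoidHom.comp C.autHatEquiv.toMonoidHom = MonoidHom.id _ := by
    ext x
    simp
  rw [this, Subgroup.map_id]

theorem map_map_symm (H : Subgroup C2CubedS3) :
    (H.map C.autHatEquiv.symm.toMonoidHom).map C.autHatEquiv.toMonoidHom = H := by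
  rw [Subgroup.map_map]
  have : C.autHatEquiv.toMonoidHom.comp C.autHatEquiv.symm.toMonoidHom = MonoidHom.id _ := by
    ext x <;> simp
  rw [this, Subgroup.map_id]

theorem exists_rep_mem_conjClass {G' : Subgroup (AutHat X)} (h : G' ∈ minimalImages X) :
    ∃ j, rep j ∈ conjClass (G'.map C.autHatEquiv.toMonoidHom) := by
  obtain ⟨σ, j, hj⟩ := ((C.mem_minimalImages_iff G').1 h).exists_conjBy_eq_rep
  exact ⟨j, el 0 σ, hj.symm⟩

theorem equiv_of_rep_mem_conjClass {G' : Subgroup (AutHat X)} {j : Fin 11}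
    (h : rep j ∈ conjClass (G'.map C.autHatEquiv.toMonoidHom)) : Nonempty (G' ≃* rep j) := by
  obtain ⟨a, ha⟩ := h
  rw [ha]
  exact ⟨(C.autHatEquiv.subgroupMap G').trans ((MulAut.conj a).subgroupMap _)⟩

include C in
-- Each minimal image is conjugate to some `rep j`, and the invariant `orders` selects the indices
-- that can be isomorphic to Γ. The two hypotheses make these indices correspond bijectively to the
-- conjugacy classes.
theorem numClasses_eq (Γ : Type) [Group Γ] (v : ℕ × ℕ) (hΓ : orders Γ = v)
    (hiso : ∀ j, repOrders j = v → Nonempty (rep j ≃* Γ))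
    (hinj : ∀ i j, repOrders i = v → repOrders j = v → i ≠ j →
      conjClass (rep i) ≠ conjClass (rep j)) :
    numClasses X Γ = (Finset.univ.filter fun j => repOrders j = v).card := by
  have hset : {c : Set (Subgroup (AutHat X)) | ∃ G' ∈ minimalImages X, Nonempty (G' ≃* Γ) ∧
      c = conjClass G'} = (fun j => conjClass ((rep j).map C.autHatEquiv.symm.toMonoidHom)) ''
        (Finset.univ.filter fun j => repOrders j = v : Finset (Fin 11)) := by
    ext c
    constructor
    · rintro ⟨G', hG', ⟨e⟩, rfl⟩
      obtain ⟨j, hj⟩ := C.exists_rep_mem_conjClass hG'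
      obtain ⟨e'⟩ := C.equiv_of_rep_mem_conjClass hj
      refine ⟨j, ?_, ?_⟩
      · simp only [Finset.coe_filter, Finset.mem_univ, true_and, Set.mem_ofPred_eq]
        rw [← hΓ, ← orders_rep, orders_congr (e'.symm.trans e)]
      · have := map_mem_conjClass C.autHatEquiv.symm.toMonoidHom hj
        rw [map_symm_map] at this
        exact conjClass_eq_of_mem this
    · rintro ⟨j, hj, rfl⟩
      simp only [Finset.coe_filter, Finset.mem_univ, true_and, Set.mem_ofPred_eq] at hj
      obtain ⟨e⟩ := hiso j hj
      refine ⟨(rep j).map C.autHatEquiv.symm.toMonoidHom, (C.mem_minimalImages_iff _).2 ?_,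
        ⟨(C.autHatEquiv.symm.subgroupMap (rep j)).symm.trans e⟩, rfl⟩
      rw [map_map_symm]
      exact isMinimalSym_rep j
  rw [numClasses, hset, Set.InjOn.ncard_image, Set.ncard_coe_finset]
  intro i hi j hj hij
  simp only [Finset.coe_filter, Finset.mem_univ, true_and, Set.mem_ofPred_eq] at hi hj
  by_contra hne
  refine hinj i j hi hj hne (conjClass_eq_of_mem ?_)
  have h1 : (rep i).map C.autHatEquiv.symm.toMonoidHom ∈
      conjClass ((rep j).map C.autHatEquiv.symm.toMonoidHom) :=
    (show conjClass _ = conjClass _ from hij) ▸ self_mem_conjClass _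
  have h2 := map_mem_conjClass C.autHatEquiv.toMonoidHom h1
  rwa [map_map_symm, map_map_symm] at h2

include C in
theorem numClasses_eq_one (Γ : Type) [Group Γ] {v : ℕ × ℕ} (hΓ : orders Γ = v) (j : Fin 11)
    (hj : Nonempty (rep j ≃* Γ)) (hv : ∀ i, repOrders i = v ↔ i = j) : numClasses X Γ = 1 := by
  rw [C.numClasses_eq Γ v hΓ (fun i hi => ?_) fun i i' hi hi' hne => ?_]
  · simp only [hv, Finset.filter_eq', Finset.mem_univ, if_true, Finset.card_singleton]
  · rw [(hv i).1 hi]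
    exact hj
  · exact absurd (((hv i).1 hi).trans ((hv i').1 hi').symm) hne

include C in
theorem numClasses_D8 : numClasses X (DihedralGroup 4) = 3 := by
  have hv : ∀ j, repOrders j = (8, 6) → j = 3 ∨ j = 4 ∨ j = 5 := by decide +kernel
  rw [C.numClasses_eq _ _ orders_D8 (fun j hj => ?_) fun i j hi hj hne => ?_]
  · decide +kernel
  · rcases hv j hj with rfl | rfl | rfl
    exacts [equiv_rep_three, equiv_rep_four, equiv_rep_five]
  · rcases hv i hi with rfl | rfl | rfl <;> rcases hv j hj with rfl | rfl | rfl
    exacts [absurd rfl hne, conjClass_rep_three_ne_four, conjClass_rep_three_ne_five,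
      conjClass_rep_three_ne_four.symm, absurd rfl hne, conjClass_rep_four_ne_five,
      conjClass_rep_three_ne_five.symm, conjClass_rep_four_ne_five.symm, absurd rfl hne]

end ToricCoords

end ProjVar
end

/-! ### The classification theorem -/

theorem mainTheorem4 {K : Type*} [Field K] [IsAlgClosed K] [CharZero K]
    (A B : Matrix (Fin 6) (Fin 6) K) (hA : A.IsSymm) (hB : B.IsSymm) (hBdet : B.det ≠ 0)
    (hσ : ProjVar.segreSymbol A B = {[1, 1], [1, 1], [1, 1]})
    (X : Set (ProjVar.ProjSpace K 5)) (hX : X = ProjVar.quadricIntersection A B) :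
    (∀ G : Subgroup (ProjVar.RegAut X), Finite G → ProjVar.IsGMinimal G →
      (∃ k l m : ℕ, 0 < k ∧ 0 < l ∧ 0 < m ∧
        Nonempty (((ProjVar.toAutHat X).subgroupMap G).ker ≃*
          ProjVar.Cyc k × ProjVar.Cyc l × ProjVar.Cyc m)) ∧
      (Nonempty (G.map (ProjVar.toAutHat X) ≃* ProjVar.Cyc 4) ∨
        Nonempty (G.map (ProjVar.toAutHat X) ≃* ProjVar.Cyc 2 × ProjVar.Cyc 2) ∨
        Nonempty (G.map (ProjVar.toAutHat X) ≃* ProjVar.Cyc 4 × ProjVar.Cyc 2) ∨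
        Nonempty (G.map (ProjVar.toAutHat X) ≃* DihedralGroup 4) ∨
        Nonempty (G.map (ProjVar.toAutHat X) ≃*
          ProjVar.Cyc 2 × ProjVar.Cyc 2 × ProjVar.Cyc 2) ∨
        Nonempty (G.map (ProjVar.toAutHat X) ≃* DihedralGroup 4 × ProjVar.Cyc 2) ∨
        Nonempty (G.map (ProjVar.toAutHat X) ≃* Equiv.Perm (Fin 4)) ∨
        Nonempty (G.map (ProjVar.toAutHat X) ≃* ProjVar.C2CubedC3) ∨
        Nonempty (G.map (ProjVar.toAutHat X) ≃* ProjVar.C2CubedS3))) ∧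
    ProjVar.numClasses X (ProjVar.Cyc 4) = 1 ∧
    ProjVar.numClasses X (ProjVar.Cyc 2 × ProjVar.Cyc 2) = 1 ∧
    ProjVar.numClasses X (ProjVar.Cyc 4 × ProjVar.Cyc 2) = 1 ∧
    ProjVar.numClasses X (DihedralGroup 4) = 3 ∧
    ProjVar.numClasses X (ProjVar.Cyc 2 × ProjVar.Cyc 2 × ProjVar.Cyc 2) = 1 ∧
    ProjVar.numClasses X (DihedralGroup 4 × ProjVar.Cyc 2) = 1 ∧
    ProjVar.numClasses X (Equiv.Perm (Fin 4)) = 1 ∧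
    ProjVar.numClasses X ProjVar.C2CubedC3 = 1 ∧
    ProjVar.numClasses X ProjVar.C2CubedS3 = 1 := by
  subst hX
  obtain ⟨C⟩ := ProjVar.nonempty_toricCoords hA hB hBdet hσ
  refine ⟨fun G _ hG => ⟨C.exists_ker_equiv_cyc G, ?_⟩,
    C.numClasses_eq_one _ ProjVar.orders_C4 0 ProjVar.equiv_rep_zero (by decide +kernel),
    C.numClasses_eq_one _ ProjVar.orders_C2C2 1 ProjVar.equiv_rep_one (by decide +kernel),
    C.numClasses_eq_one _ ProjVar.orders_C4C2 2 ProjVar.equiv_rep_two (by decide +kernel),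
    C.numClasses_D8,
    C.numClasses_eq_one _ ProjVar.orders_C2C2C2 6 ProjVar.equiv_rep_six (by decide +kernel),
    C.numClasses_eq_one _ ProjVar.orders_D8C2 7 ProjVar.equiv_rep_seven (by decide +kernel),
    C.numClasses_eq_one _ ProjVar.orders_S4 8 ProjVar.equiv_rep_eight (by decide +kernel),
    C.numClasses_eq_one _ ProjVar.orders_C2CubedC3 9 ProjVar.equiv_rep_nine (by decide +kernel),
    C.numClasses_eq_one _ ProjVar.orders_C2CubedS3 10 ProjVar.equiv_rep_ten (by decide +kernel)⟩
  obtain ⟨j, hj⟩ := C.exists_rep_mem_conjClass ⟨G, ‹_›, hG, rfl⟩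
  obtain ⟨e⟩ := C.equiv_of_rep_mem_conjClass hj
  fin_cases j
  · exact Or.inl (ProjVar.equiv_rep_zero.map e.trans)
  · exact Or.inr (Or.inl (ProjVar.equiv_rep_one.map e.trans))
  · exact Or.inr (Or.inr (Or.inl (ProjVar.equiv_rep_two.map e.trans)))
  · exact Or.inr (Or.inr (Or.inr (Or.inl (ProjVar.equiv_rep_three.map e.trans))))
  · exact Or.inr (Or.inr (Or.inr (Or.inl (ProjVar.equiv_rep_four.map e.trans))))
  · exact Or.inr (Or.inr (Or.inr (Or.inl (ProjVar.equiv_rep_five.map e.trans))))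
  · exact Or.inr (Or.inr (Or.inr (Or.inr (Or.inl (ProjVar.equiv_rep_six.map e.trans)))))
  · exact Or.inr (Or.inr (Or.inr (Or.inr (Or.inr (Or.inl
      (ProjVar.equiv_rep_seven.map e.trans))))))
  · exact Or.inr (Or.inr (Or.inr (Or.inr (Or.inr (Or.inr (Or.inl
      (ProjVar.equiv_rep_eight.map e.trans)))))))
  · exact Or.inr (Or.inr (Or.inr (Or.inr (Or.inr (Or.inr (Or.inr (Or.inl
      (ProjVar.equiv_rep_nine.map e.trans))))))))
  · exact Or.inr (Or.inr (Or.inr (Or.inr (Or.inr (Or.inr (Or.inr (Or.inr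
      (ProjVar.equiv_rep_ten.map e.trans))))))))
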